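/- Let $M$ be a smooth $n$-dimensional Riemannian manifold without boundary (for example a compact oriented one with $n\ge 3$), with Levi-Civita connection $\nabla^L$, let $F\subset TM$ be a smooth subbundle, and let $F^\perp$ be its orthogonal complement, of rank $k$. Let $\pi^F,\pi^{F^\perp}$ be the orthogonal projections of $TM$ onto $F,F^\perp$ and let $S$ be the tensor $$S(X)Y=\nabla^L_XY-\pi^F\nabla^L_X(\pi^FY)-\pi^{F^\perp}\nabla^L_X(\pi^{F^\perp}Y).$$ Let $U\subset M$ be open, $e_1,\dots,e_n$ a smooth orthonormal frame of $TM$ over $U$ and $f_1,\dots,f_k$ a smooth orthonormal frame of $F^\perp$ over $U$. On $\bigwedge^*T^*M\otimes\mathbb C$ let $\varepsilon(v^*)$ be exterior multiplication by $v^*=\langle v,\cdot\rangle$, $\iota(v^*)$ contraction with $v$, and $$c(v)=\varepsilon(v^*)-\iota(v^*),\qquad \widehat c(v)=\varepsilon(v^*)+\iota(v^*).$$ Let $\nabla=\nabla^{\bigwedge^*T^*M}$ be the connection on forms induced by $\nabla^L$, and $(\nabla_XB)\eta=\nabla_X(B\eta)-B\nabla_X\eta$ for endomorphism fields $B$. Let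 $d$ be the exterior derivative and $\delta$ the codifferential ($\delta=(-1)^{n(p+1)+1}\star d\star$ on $p$-forms). For $t\in\mathbb C$ put $$A=\sum_{i=1}^n\sum_{\alpha=1}^k c(e_i)\,\widehat c(S(e_i)f_\alpha)\,\widehat c(f_\alpha),\qquad D_t=d+\delta+tA,\qquad D_t^*=d+\delta+\bar t A,$$ $$\nabla^1_X=\nabla_X-\tfrac12\big(t\,c(X)A+\bar t\,A\,c(X)\big),\qquad \nabla^2_X=\nabla_X-\tfrac t2\big(c(X)A+A\,c(X)\big),$$ $$\Delta^j=-\sum_i\nabla^j_{e_i}\nabla^j_{e_i}+\sum_i\nabla^j_{\nabla^L_{e_i}e_i}\qquad(j=1,2).$$ Let $R(X,Y)=[\nabla^L_X,\nabla^L_Y]-\nabla^L_{[X,Y]}$, $R_{ijkl}=\langle R(e_i,e_j)e_k,e_l\rangle$, and let $K=\sum_{i,j}\langle R(e_i,e_j)e_j,e_i\rangle$ be the scalar curvature. Then, on smooth complex differential forms over $U$, $$\begin{aligned}D_t^*D_t={}&\Delta^1-\tfrac18\sum_{i,j,k,l}R_{ijkl}\,\widehat c(e_i)\widehat c(e_j)c(e_k)c(e_l)+\tfrac14K+\tfrac14\sum_j\big(t\,c(e_j)A+\bar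 t\,A\,c(e_j)\big)^2\\&+\tfrac12\sum_j\big(t\,c(e_j)(\nabla_{e_j}A)-\bar t\,(\nabla_{e_j}A)c(e_j)\big)+\bar t\,t\,A^2,\end{aligned}$$ $$\begin{aligned}D_t^2={}&\Delta^2-\tfrac18\sum_{i,j,k,l}R_{ijkl}\,\widehat c(e_i)\widehat c(e_j)c(e_k)c(e_l)+\tfrac14K+\tfrac14\sum_jt^2\big(c(e_j)A+A\,c(e_j)\big)^2\\&+\tfrac t2\sum_j\big(c(e_j)(\nabla_{e_j}A)-(\nabla_{e_j}A)c(e_j)\big)+t^2A^2.\end{aligned}$$ -/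

import Mathlib

open Bundle
open scoped Manifold ContDiff ComplexConjugate

noncomputable section

namespace SubSignature

/-! ## Exterior algebra of one inner product space -/

section Fiber

/-- `⋀^* V^* ⊗ ℂ`: inhomogeneous complex-valued alternating forms on `V`, one component in each
degree (on a finite dimensional `V` the components of degree `> dim V` vanish). -/
abbrev Forms (V : Type*) [NormedAddCommGroup V] [InnerProductSpace ℝ V] : Type _ :=
  ∀ p : ℕ, V [⋀^Fin p]→L[ℝ] ℂ

variable {V : Type*} [NormedAddCommGroup V] [InnerProductSpace ℝ V]

/-- The exterior product `v^* ∧ η` of the covector `v^* = ⟨v, ·⟩` with a `p`-form: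
`(v^* ∧ η)(v₀, …, v_p) = ∑ᵢ (-1)^i ⟨v, vᵢ⟩ η(v₀, …, v̂ᵢ, …, v_p)`. -/
def wedge (v : V) {p : ℕ} (η : V [⋀^Fin p]→L[ℝ] ℂ) : V [⋀^Fin (p + 1)]→L[ℝ] ℂ :=
  ContinuousAlternatingMap.alternatizeUncurryFin ((innerSL ℝ v).smulRight η)

/-- Exterior multiplication by `v^* = ⟨v, ·⟩`. -/
def extMul (v : V) : Module.End ℂ (Forms V) where
  toFun η p := match p with
    | 0 => 0
    | q + 1 => wedge v (η q)
  map_add' η ξ := by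
    funext p
    cases p with
    | zero => simp
    | succ q =>
      ext w
      simp [wedge, ContinuousAlternatingMap.alternatizeUncurryFin_apply, smul_add,
        Finset.sum_add_distrib]
  map_smul' a η := by
    funext p
    cases p with
    | zero => exact (smul_zero (A := V [⋀^Fin 0]→L[ℝ] ℂ) a).symm
    | succ q =>
      ext w
      simp [wedge, ContinuousAlternatingMap.alternatizeUncurryFin_apply, Finset.mul_sum,
        mul_left_comm]

/-- Interior multiplication (contraction) by `v`: `(ι(v)η)(v₁, …, v_p) = η(v, v₁, …, v_p)`. -/
def intMul (v : V) : Module.End ℂ (Forms V) where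
  toFun η p := (η (p + 1)).curryLeft v
  map_add' η ξ := by
    funext p
    ext w
    simp
  map_smul' a η := by
    funext p
    ext w
    simp

/-- The Clifford action `c(v) = ε(v^*) - ι(v^*)`. -/
def cl (v : V) : Module.End ℂ (Forms V) := extMul v - intMul v

/-- The Clifford action `ĉ(v) = ε(v^*) + ι(v^*)`. -/
def clHat (v : V) : Module.End ℂ (Forms V) := extMul v + intMul v

/-- The form `1` (the constant `1` in degree zero). -/
def oneForm : Forms V := fun p => match p with
  | 0 => ContinuousAlternatingMap.constOfIsEmpty ℝ V (Fin 0) (1 : ℂ)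
  | _ + 1 => 0

/-- The volume form `b₁^* ∧ ⋯ ∧ b_n^*` of an orthonormal basis `b₁, …, b_n` of `V`. -/
def volForm {n : ℕ} (b : Fin n → V) : Forms V :=
  (List.ofFn b).foldr (fun v η => extMul v η) oneForm

/-- The Hodge star operator of `V` oriented by the orthonormal basis `b`:
`⋆η = ∑_{i₁ < ⋯ < i_p} η(b_{i₁}, …, b_{i_p}) vol(b_{i₁}, …, b_{i_p}, · , …, ·)`,
summed over all degrees `p`; equivalently `ξ ∧ ⋆η = ⟨ξ, η⟩ vol`, extended `ℂ`-linearly. -/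
def hodgeStar {n : ℕ} (b : Fin n → V) (η : Forms V) : Forms V :=
  ∑ I : Finset (Fin n), η I.card (fun k => b (I.orderEmbOfFin rfl k)) •
    (I.sort (· ≤ ·)).foldl (fun ξ i => intMul (b i) ξ) (volForm b)

end Fiber

/-! ## Forms and vector fields on a Riemannian manifold -/

section Manifold

variable {n : ℕ} {M : Type*} [TopologicalSpace M] [ChartedSpace (EuclideanSpace ℝ (Fin n)) M]
  [IsManifold (𝓡 n) ∞ M]

instance (x : M) : FiniteDimensional ℝ (TangentSpace (𝓡 n) x) :=
  inferInstanceAs (FiniteDimensional ℝ (EuclideanSpace ℝ (Fin n)))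

variable (n M) in
/-- (Not necessarily smooth) vector fields on `M`. -/
abbrev VField : Type _ := ∀ x : M, TangentSpace (𝓡 n) x

/-- `X` is a smooth vector field on the set `U`. -/
def SmoothFieldOn (X : VField n M) (U : Set M) : Prop :=
  ContMDiffOn (𝓡 n) (𝓡 n).tangent ∞ (fun x => (⟨x, X x⟩ : TangentBundle (𝓡 n) M)) U

/-- The exterior derivative of a `p`-form on `M`, computed in the preferred chart at each point. -/
def extDerivAt {p : ℕ} (η : ∀ x : M, TangentSpace (𝓡 n) x [⋀^Fin p]→L[ℝ] ℂ) (x : M) :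
    TangentSpace (𝓡 n) x [⋀^Fin (p + 1)]→L[ℝ] ℂ :=
  ContinuousAlternatingMap.compContinuousLinearMap
    (extDeriv (fun y : EuclideanSpace ℝ (Fin n) =>
      (η ((extChartAt (𝓡 n) x).symm y)).compContinuousLinearMap
        (mfderiv 𝓘(ℝ, EuclideanSpace ℝ (Fin n)) (𝓡 n) (extChartAt (𝓡 n) x).symm y))
      (extChartAt (𝓡 n) x x))
    (mfderiv (𝓡 n) 𝓘(ℝ, EuclideanSpace ℝ (Fin n)) (extChartAt (𝓡 n) x) x)

variable [RiemannianBundle (fun x : M => TangentSpace (𝓡 n) x)]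

variable (n M) in
/-- (Not necessarily smooth) sections of `⋀^* T^*M ⊗ ℂ`. -/
abbrev FormField : Type _ := ∀ x : M, Forms (TangentSpace (𝓡 n) x)

/-- `η` is smooth on the open set `U`: for all smooth vector fields `X₁, …, X_p` on an open
subset `W` of `U` the function `η(X₁, …, X_p)` is smooth on `W`. -/
def SmoothFormOn (η : FormField n M) (U : Set M) : Prop :=
  ∀ (p : ℕ) (W : Set M) (X : Fin p → VField n M), IsOpen W → W ⊆ U →
    (∀ i, SmoothFieldOn (X i) W) →
    ContMDiffOn (𝓡 n) 𝓘(ℝ, ℂ) ∞ (fun x => η x p (fun i => X i x)) W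

/-- `e` is a smooth orthonormal family of vector fields on `U`. If it has `n = dim M` members it is
an orthonormal frame of `TM` over `U`. -/
structure IsOrthonormalFrameOn {k : ℕ} (e : Fin k → VField n M) (U : Set M) : Prop where
  smooth : ∀ i, SmoothFieldOn (e i) U
  orthonormal : ∀ x ∈ U, Orthonormal ℝ (fun i => e i x)

/-- `F` is a smooth subbundle of rank `r` of `TM`: near each point it is the span of `r` linearly
independent smooth vector fields. -/
def IsSmoothSubbundle (F : ∀ x : M, Submodule ℝ (TangentSpace (𝓡 n) x)) (r : ℕ) : Prop :=
  ∀ x : M, ∃ (W : Set M) (s : Fin r → VField n M), IsOpen W ∧ x ∈ W ∧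
    (∀ i, SmoothFieldOn (s i) W) ∧
    ∀ y ∈ W, LinearIndependent ℝ (fun i => s i y) ∧
      Submodule.span ℝ (Set.range (fun i => s i y)) = F y

/-- The exterior derivative `d` on inhomogeneous forms. -/
def dForm (η : FormField n M) : FormField n M := fun x p => match p with
  | 0 => 0
  | q + 1 => extDerivAt (fun y => η y q) x

/-- The codifferential `δ = (-1)^{n(r+1)+1} ⋆ d ⋆` on `r`-forms, on the domain of the orthonormal
frame `e` (independently of the orientation). Its component of degree `p` comes from
`r = p + 1`, where the sign is `(-1)^{np+1}`. -/
def codiff (e : Fin n → VField n M) (η : FormField n M) : FormField n M := fun x p =>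
  ((-1 : ℂ) ^ (n * p + 1)) •
    hodgeStar (fun i => e i x) (dForm (fun y => hodgeStar (fun i => e i y) (η y)) x) p

end Manifold

/-! ## Levi-Civita connection, curvature and the splitting `TM = F ⊕ F^⊥` -/

section Connection

variable {n : ℕ} {M : Type*} [TopologicalSpace M] [ChartedSpace (EuclideanSpace ℝ (Fin n)) M]
  [IsManifold (𝓡 n) ∞ M] [RiemannianBundle (fun x : M => TangentSpace (𝓡 n) x)]

instance [h : IsContMDiffRiemannianBundle (𝓡 n) ∞ (EuclideanSpace ℝ (Fin n))
      (fun x : M => TangentSpace (𝓡 n) x)] :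
    IsContMDiffRiemannianBundle (𝓡 n) 1 (EuclideanSpace ℝ (Fin n))
      (fun x : M => TangentSpace (𝓡 n) x) :=
  h.of_le (by norm_cast)

variable (n M) in
/-- Connections on `TM`. `D Y x v` stands for `(∇_v Y)(x)`. -/
abbrev Connection : Type _ :=
  CovariantDerivative (𝓡 n) (EuclideanSpace ℝ (Fin n)) (fun x : M => TangentSpace (𝓡 n) x)

/-- `D` is the Levi-Civita connection: metric and torsion-free. -/
def IsLeviCivita
    [IsContMDiffRiemannianBundle (𝓡 n) ∞ (EuclideanSpace ℝ (Fin n))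
      (fun x : M => TangentSpace (𝓡 n) x)]
    (D : Connection n M) : Prop :=
  D.IsMetricCompatible ∧ D.torsion = 0

/-- `R(X, Y)Z = ∇_X ∇_Y Z - ∇_Y ∇_X Z - ∇_{[X, Y]} Z`. -/
def curvature (D : Connection n M) (X Y Z : VField n M) : VField n M := fun x =>
  D (fun y => D Z y (Y y)) x (X x) - D (fun y => D Z y (X y)) x (Y x)
    - D Z x (VectorField.mlieBracket (𝓡 n) X Y x)

/-- `R_{ijkl} = ⟨R(e_i, e_j) e_k, e_l⟩`. -/
def Rm (D : Connection n M) (e : Fin n → VField n M) (x : M) (i j k l : Fin n) : ℝ :=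
  inner ℝ (curvature D (e i) (e j) (e k) x) (e l x)

/-- The scalar curvature `K = ∑_{i,j} ⟨R(e_i, e_j) e_j, e_i⟩` (positive on round spheres). -/
def scal (D : Connection n M) (e : Fin n → VField n M) (x : M) : ℝ :=
  ∑ i, ∑ j, Rm D e x i j j i

/-- The orthogonal projection of `TM` onto a subbundle `F`, applied to a vector field. -/
def proj (F : ∀ x : M, Submodule ℝ (TangentSpace (𝓡 n) x)) (Y : VField n M) : VField n M :=
  fun x => (F x).starProjection (Y x)

/-- The tensor `S = ∇^L - ∇^F - ∇^{F^⊥}`, where `∇^F = π^F ∇^L π^F` and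
`∇^{F^⊥} = π^{F^⊥} ∇^L π^{F^⊥}`; `tensorS D F X Y = S(X)Y`. -/
def tensorS (D : Connection n M) (F : ∀ x : M, Submodule ℝ (TangentSpace (𝓡 n) x))
    (X Y : VField n M) : VField n M := fun x =>
  D Y x (X x)
    - proj F (fun y => D (proj F Y) y (X y)) x
    - proj (fun y => (F y)ᗮ) (fun y => D (proj (fun z => (F z)ᗮ) Y) y (X y)) x

/-! ## The connection on forms and the sub-signature operators -/

/-- The linear map `T_xM → T_yM` which sends `e_i(x)` to `e_i(y)`. -/
def frameTransport (e : Fin n → VField n M) (x y : M) :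
    TangentSpace (𝓡 n) x →L[ℝ] TangentSpace (𝓡 n) y :=
  ∑ i, (innerSL ℝ (e i x)).smulRight (e i y)

/-- The directional derivative at `x` in the direction `v` of the coefficients of `η` with respect
to the frame `e`: `∑_I v(η_I) e^I`. -/
def coeffDeriv (e : Fin n → VField n M) (η : FormField n M) (x : M) (v : TangentSpace (𝓡 n) x) :
    Forms (TangentSpace (𝓡 n) x) := fun p =>
  mvfderiv (𝓡 n) (fun y => (η y p).compContinuousLinearMap (frameTransport e x y)) x v

/-- The connection on `⋀^* T^*M ⊗ ℂ` induced by the Levi-Civita connection by the Leibniz rule,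
on the domain of the orthonormal frame `e`:
`(∇_v η)(X₁, …, X_p) = v(η(X₁, …, X_p)) - ∑_j η(X₁, …, ∇_v X_j, …, X_p)`
for `X₁, …, X_p` among the `e_i`. The sum is the derivation `∑_i ε(e_i^*) ι(∇_v e_i)`. -/
def nabla (D : Connection n M) (e : Fin n → VField n M) (η : FormField n M) (x : M)
    (v : TangentSpace (𝓡 n) x) : Forms (TangentSpace (𝓡 n) x) :=
  coeffDeriv e η x v - ∑ i, extMul (e i x) (intMul (D (e i) x v) (η x))

variable (n M) in
/-- Fields of endomorphisms of `⋀^* T^*M ⊗ ℂ`. -/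
abbrev EndField : Type _ := ∀ x : M, Module.End ℂ (Forms (TangentSpace (𝓡 n) x))

/-- The covariant derivative `∇_v B` of an endomorphism field:
`(∇_v B) η = ∇_v (B η) - B (∇_v η)`. -/
def nablaEnd (D : Connection n M) (e : Fin n → VField n M) (B : EndField n M) (η : FormField n M)
    (x : M) (v : TangentSpace (𝓡 n) x) : Forms (TangentSpace (𝓡 n) x) :=
  nabla D e (fun y => B y (η y)) x v - B x (nabla D e η x v)

/-- `A = ∑_i ∑_α c(e_i) ĉ(S(e_i) f_α) ĉ(f_α)`. -/
def opA (D : Connection n M) (F : ∀ x : M, Submodule ℝ (TangentSpace (𝓡 n) x))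
    (e : Fin n → VField n M) {k : ℕ} (f : Fin k → VField n M) : EndField n M := fun x =>
  ∑ i, ∑ α, cl (e i x) * clHat (tensorS D F (e i) (f α) x) * clHat (f α x)

/-- The sub-signature operator `D_t = d + δ + t A`. -/
def subSig (D : Connection n M) (F : ∀ x : M, Submodule ℝ (TangentSpace (𝓡 n) x))
    (e : Fin n → VField n M) {k : ℕ} (f : Fin k → VField n M) (t : ℂ) (η : FormField n M) :
    FormField n M := fun x =>
  dForm η x + codiff e η x + t • opA D F e f x (η x)

/-- The sub-signature operator `D_t^* = d + δ + t̄ A`. -/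
def subSigStar (D : Connection n M) (F : ∀ x : M, Submodule ℝ (TangentSpace (𝓡 n) x))
    (e : Fin n → VField n M) {k : ℕ} (f : Fin k → VField n M) (t : ℂ) (η : FormField n M) :
    FormField n M := fun x =>
  dForm η x + codiff e η x + conj t • opA D F e f x (η x)

/-- The connection `∇¹_v = ∇_v - ½ (t c(v) A + t̄ A c(v))`. -/
def nabla1 (D : Connection n M) (F : ∀ x : M, Submodule ℝ (TangentSpace (𝓡 n) x))
    (e : Fin n → VField n M) {k : ℕ} (f : Fin k → VField n M) (t : ℂ) (η : FormField n M) (x : M)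
    (v : TangentSpace (𝓡 n) x) : Forms (TangentSpace (𝓡 n) x) :=
  nabla D e η x v
    - (1 / 2 : ℂ) • (t • (cl v * opA D F e f x) + conj t • (opA D F e f x * cl v)) (η x)

/-- The connection `∇²_v = ∇_v - (t/2) (c(v) A + A c(v))`. -/
def nabla2 (D : Connection n M) (F : ∀ x : M, Submodule ℝ (TangentSpace (𝓡 n) x))
    (e : Fin n → VField n M) {k : ℕ} (f : Fin k → VField n M) (t : ℂ) (η : FormField n M) (x : M)
    (v : TangentSpace (𝓡 n) x) : Forms (TangentSpace (𝓡 n) x) :=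
  nabla D e η x v - (t / 2) • (cl v * opA D F e f x + opA D F e f x * cl v) (η x)

/-- The Laplacian `-∑_i ∇'_{e_i} ∇'_{e_i} + ∑_i ∇'_{∇^L_{e_i} e_i}` of a connection `∇'` on forms;
`N η x v` stands for `(∇'_v η)(x)`. -/
def laplacian (D : Connection n M) (e : Fin n → VField n M)
    (N : FormField n M → ∀ x : M, TangentSpace (𝓡 n) x → Forms (TangentSpace (𝓡 n) x))
    (η : FormField n M) : FormField n M := fun x =>
  -(∑ i, N (fun y => N η y (e i y)) x (e i x)) + ∑ i, N η x (D (e i) x (e i x))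

/-- The curvature endomorphism `∑_{ijkl} R_{ijkl} ĉ(e_i) ĉ(e_j) c(e_k) c(e_l)`. -/
def curvEnd (D : Connection n M) (e : Fin n → VField n M) : EndField n M := fun x =>
  ∑ i, ∑ j, ∑ k, ∑ l, (Rm D e x i j k l : ℂ) •
    (clHat (e i x) * clHat (e j x) * cl (e k x) * cl (e l x))

end Connection

end SubSignature

end

/-! In an orthonormal frame, d = ∑ ε(e_i)∇_{e_i} and δ = -∑ ι(e_i)∇_{e_i}, so d + δ is the Dirac
operator ∑ c(e_i)∇_{e_i}. Both claims are then cases of one formula for (∑ c_i N_i + sA)(∑ c_i N_i +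
tA), where N_i = ∇_{e_i}, with s = t̄ or s = t (`subSig_subSig`).

That formula is algebra in a ring where the c_i satisfy the Clifford relations and the N_i commute
with them, and with each other, as covariant derivatives along a frame do. `dirac_sq` splits c_i c_j
N_i N_j into a symmetric part, which is the Laplacian, and an antisymmetric part, which is
curvature. `perturbed_dirac_mul` completes the square: with w_j = t c_j A + s A c_j, the first order
cross terms w_j N_j are absorbed by passing to N_j - w_j/2, and what is left over has order zero.
The tensor S matters only because it makes A a smooth endomorphism field.

The curvature of forms is ∑ R_{ijkl} ε_l ι_k = ¼ ∑ R_{ijkl}(c_k c_l - ĉ_k ĉ_l). After multiplication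
by ½ c_i c_j and summation, the c-part collapses to K/4 by the first Bianchi identity and the
symmetry of Ricci (`sum_curvature_quartic`), and the ĉ-part is the quartic term with factor -1/8
(`weitzenboeck_curvature`).

For d, the flat connection of a chart and the Levi-Civita connection are both torsion-free, so they
differ by a symmetric tensor, which the wedge product kills (`dForm_eq`). For δ, the Hodge star is,
up to signs depending on the degree, the product ω of all ĉ(e_i) (`hodgeStar_eq`). Passing ω
exchanges ε and ι up to sign, and ⋆ is parallel, whence `codiff_eq`.

To use the ring identities, smooth forms over U are made into a vector space `Sections`. The
operators become elements of its endomorphism ring (`LocalOperators`), and the resulting identity is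
evaluated at a point. -/

namespace SubSignature

/-! ### Algebra of creation and annihilation elements -/

section CAR

/-- Creation and annihilation elements `ε i`, `ι i` satisfying the canonical anticommutation
relations in a ring. -/
structure CAR {n : ℕ} {A : Type*} [Ring A] (ε ι : Fin n → A) : Prop where
  cre_cre : ∀ i j, ε i * ε j = -(ε j * ε i)
  ann_ann : ∀ i j, ι i * ι j = -(ι j * ι i)
  ann_cre : ∀ i j, ι i * ε j = (if i = j then 1 else 0) - ε j * ι i

variable {n : ℕ} {A : Type*} [Ring A] {ε ι : Fin n → A}

/-- The product `ε i_p ⋯ ε i_1` over `I = {i_1 < ⋯ < i_p}`. -/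
def revProd (ε : Fin n → A) (I : Finset (Fin n)) : A :=
  (I.sort (· ≤ ·)).foldl (fun z i => ε i * z) 1

lemma revProd_insert_max (ε : Fin n → A) {I : Finset (Fin n)} {a : Fin n} (h : ∀ i ∈ I, i < a) :
    revProd ε (insert a I) = ε a * revProd ε I := by
  have ha : a ∉ I := fun h' => lt_irrefl _ (h a h')
  have : (insert a I).sort (· ≤ ·) = I.sort (· ≤ ·) ++ [a] := by
    refine List.Perm.eq_of_pairwise' (r := (· ≤ ·)) ?_ ?_ ?_
    · exact Finset.pairwise_sort _ _
    · rw [List.pairwise_append]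
      refine ⟨Finset.pairwise_sort _ _, by simp, ?_⟩
      intro i hi j hj
      rw [List.mem_singleton] at hj
      subst hj
      exact (h i (by simpa using hi)).le
    · rw [List.perm_ext_iff_of_nodup]
      · intro i; simp [or_comm]
      · exact Finset.sort_nodup _ _
      · rw [List.nodup_append]
        refine ⟨Finset.sort_nodup _ _, by simp, ?_⟩
        intro i hi j hj hij
        rw [List.mem_singleton] at hj
        subst hij hj
        exact ha (by simpa using hi)
  rw [revProd, this, List.foldl_append]
  rfl

lemma revProd_empty (ε : Fin n → A) : revProd ε ∅ = 1 := by simp [revProd]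

/-- An element anticommuting with each `ε i`, `i ∈ I`, commutes with the product up to sign. -/
lemma mul_revProd_of_anticomm {x : A} {ε : Fin n → A} (I : Finset (Fin n))
    (h : ∀ i ∈ I, x * ε i = -(ε i * x)) :
    x * revProd ε I = (-1 : ℤ) ^ I.card • (revProd ε I * x) := by
  induction I using Finset.induction_on_max with
  | empty => simp [revProd_empty]
  | insert a s ha ih =>
    have ha' : a ∉ s := fun h' => lt_irrefl _ (ha a h')
    rw [revProd_insert_max ε ha, Finset.card_insert_of_notMem ha', ← mul_assoc,
      h a (Finset.mem_insert_self _ _), neg_mul, mul_assoc,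
      ih (fun i hi => h i (Finset.mem_insert_of_mem hi)), pow_succ, mul_smul_comm,
      mul_neg_one, neg_smul, mul_assoc]

lemma commute_revProd {x : A} {ε : Fin n → A} (I : Finset (Fin n))
    (h : ∀ i ∈ I, Commute x (ε i)) : Commute x (revProd ε I) := by
  induction I using Finset.induction_on_max with
  | empty => simp [revProd_empty]
  | insert a s ha ih =>
    rw [revProd_insert_max ε ha]
    exact (h a (Finset.mem_insert_self _ _)).mul_right
      (ih fun i hi => h i (Finset.mem_insert_of_mem hi))

namespace CAR

lemma cre_sq [IsAddTorsionFree A] (h : CAR ε ι) (i : Fin n) : ε i * ε i = 0 :=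
  self_eq_neg.mp (h.cre_cre i i)

lemma ann_sq [IsAddTorsionFree A] (h : CAR ε ι) (i : Fin n) : ι i * ι i = 0 :=
  self_eq_neg.mp (h.ann_ann i i)

lemma ann_cre_self (h : CAR ε ι) (i : Fin n) : ι i * ε i = 1 - ε i * ι i := by
  simpa using h.ann_cre i i

lemma ann_cre_of_ne (h : CAR ε ι) {i j : Fin n} (hij : i ≠ j) : ι i * ε j = -(ε j * ι i) := by
  simpa [hij] using h.ann_cre i j

/-- The sign of the reversal of a word of length `p`. -/
def revSign (p : ℕ) : ℤ := (-1) ^ (p * (p - 1) / 2)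

lemma revSign_zero : revSign 0 = 1 := rfl

lemma revSign_succ (p : ℕ) : revSign (p + 1) = (-1) ^ p * revSign p := by
  have : (p + 1) * (p + 1 - 1) / 2 = p + p * (p - 1) / 2 := by
    cases p with
    | zero => rfl
    | succ q =>
      have : (q + 1 + 1) * (q + 1 + 1 - 1) = (q + 1) * (q + 1 - 1) + (q + 1) * 2 := by
        simp only [Nat.add_sub_cancel]; ring
      rw [this, Nat.add_mul_div_right _ _ (by norm_num), add_comm]
  rw [revSign, this, pow_add, revSign]

lemma revSign_mul_self (p : ℕ) : revSign p * revSign p = 1 := by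
  rw [revSign, ← mul_pow]; simp

/-- Resolution of the identity of a system of creation and annihilation elements. -/
theorem exists_vacuum [IsAddTorsionFree A] (h : CAR ε ι) (s : Finset (Fin n)) :
    ∃ P : A, (∀ j ∈ s, ι j * P = 0) ∧ (∀ a ∉ s, Commute (ι a) P) ∧
      (∃ x : Fin n → A, P = 1 + ∑ j, ε j * x j) ∧
      ∑ I ∈ s.powerset, revSign I.card • (revProd ε I * P * revProd ι I) = 1 := by
  induction s using Finset.induction_on_max with
  | empty => exact ⟨1, by simp, by simp, ⟨0, by simp⟩, by simp [revProd_empty, revSign_zero]⟩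
  | insert a s ha ih =>
    obtain ⟨P, h1, h2, ⟨x, hx⟩, h3⟩ := ih
    have ha' : a ∉ s := fun h' => lt_irrefl _ (ha a h')
    have hne : ∀ i ∈ s, i ≠ a := fun i hi => (ha i hi).ne
    have hcomm : ∀ c, c ≠ a → Commute (ι c) (ι a * ε a) := by
      intro c hc
      rw [Commute, SemiconjBy, ← mul_assoc, h.ann_ann c a, neg_mul, mul_assoc,
        h.ann_cre_of_ne hc]
      noncomm_ring
    have hι : ι a * ε a * ι a = ι a := by
      rw [h.ann_cre_self, sub_mul, mul_assoc, h.ann_sq]; simp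
    -- The factor ι_a ε_a is the projection onto elements without e_a, so P is the product of these
    -- projections over s. The new coefficients come from expanding (1 + ∑ ε_j x_j)(1 - ε_a ι_a).
    refine ⟨P * (ι a * ε a), ?_, ?_, ⟨fun j => x j - ((if j = a then 1 else 0) + x j * ε a) * ι a,
      ?_⟩, ?_⟩
    · intro j hj
      rcases Finset.mem_insert.mp hj with rfl | hj
      · rw [← mul_assoc, (h2 j ha').eq, mul_assoc, ← mul_assoc (ι j), h.ann_sq]; simp
      · rw [← mul_assoc, h1 j hj, zero_mul]
    · intro c hc
      rw [Finset.mem_insert, not_or] at hc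
      exact (h2 c hc.2).mul_right (hcomm c hc.1)
    · rw [h.ann_cre_self, mul_sub, mul_one]
      simp only [mul_sub, Finset.sum_sub_distrib, add_mul, mul_add, Finset.sum_add_distrib]
      have : ∑ j, ε j * ((if j = a then 1 else 0) * ι a) = ε a * ι a := by
        rw [Finset.sum_eq_single a] <;> simp +contextual
      rw [this, ← mul_assoc]
      conv_lhs => rw [hx]
      rw [add_mul, add_mul, Finset.sum_mul, Finset.sum_mul]
      simp only [mul_assoc, one_mul]
      abel
    -- Subsets without a add up to ι_a ε_a, those containing a to ε_a ι_a, and ι_a ε_a + ε_a ι_a =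
    -- 1.
    · rw [Finset.sum_powerset_insert ha']
      have e1 : ∀ I ∈ s.powerset, revSign I.card •
          (revProd ε I * (P * (ι a * ε a)) * revProd ι I)
          = revSign I.card • (revProd ε I * P * revProd ι I) * (ι a * ε a) := by
        intro I hI
        have : Commute (ι a * ε a) (revProd ι I) := commute_revProd I fun i hi =>
          (hcomm i (hne i (Finset.mem_powerset.mp hI hi))).symm
        rw [smul_mul_assoc, mul_assoc _ _ (ι a * ε a), ← this.eq]
        simp only [mul_assoc]
      have e2 : ∀ I ∈ s.powerset, revSign (insert a I).card •
          (revProd ε (insert a I) * (P * (ι a * ε a)) * revProd ι (insert a I))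
          = ε a * (revSign I.card • (revProd ε I * P * revProd ι I)) * ι a := by
        intro I hI
        have hI' := Finset.mem_powerset.mp hI
        have haI : a ∉ I := fun h' => ha' (hI' h')
        have hlt : ∀ i ∈ I, i < a := fun i hi => ha i (hI' hi)
        rw [Finset.card_insert_of_notMem haI, revProd_insert_max ε hlt, revProd_insert_max ι hlt]
        have e3 := mul_revProd_of_anticomm (x := ι a) (ε := ι) I (fun i _ => h.ann_ann a i)
        have e4 : P * (ι a * ε a) * (ι a * revProd ι I)
            = (-1 : ℤ) ^ I.card • (P * revProd ι I * ι a) := by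
          rw [mul_assoc P, ← mul_assoc (ι a * ε a), hι, e3, mul_smul_comm, mul_assoc P]
        rw [mul_assoc, e4, revSign_succ, mul_smul_comm, smul_smul, mul_right_comm, ← mul_pow]
        simp only [neg_mul_neg, mul_one, one_pow, one_mul, mul_smul_comm, smul_mul_assoc,
          mul_assoc]
      rw [Finset.sum_congr rfl e1, Finset.sum_congr rfl e2, ← Finset.sum_mul, ← Finset.sum_mul,
        ← Finset.mul_sum, h3, h.ann_cre_self]
      noncomm_ring

/-- The product of the elements `ε i + ι i` over a word. -/
def hatProd (ε ι : Fin n → A) (l : List (Fin n)) : A := (l.map fun i => ε i + ι i).prod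

@[simp] lemma hatProd_nil (ε ι : Fin n → A) : hatProd ε ι [] = 1 := rfl

@[simp] lemma hatProd_cons (ε ι : Fin n → A) (a : Fin n) (l : List (Fin n)) :
    hatProd ε ι (a :: l) = (ε a + ι a) * hatProd ε ι l := rfl

lemma cre_ann (h : CAR ε ι) (i j : Fin n) : ε i * ι j = (if i = j then 1 else 0) - ι j * ε i := by
  rw [h.ann_cre]
  simp [eq_comm]

lemma hat_anticomm (h : CAR ε ι) {i j : Fin n} (hij : i ≠ j) :
    (ε i + ι i) * (ε j + ι j) = -((ε j + ι j) * (ε i + ι i)) := by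
  simp only [add_mul, mul_add, h.cre_cre i j, h.ann_ann i j, h.ann_cre_of_ne hij, h.cre_ann i j, hij,
    if_false]
  abel

lemma hat_sq [IsAddTorsionFree A] (h : CAR ε ι) (i : Fin n) : (ε i + ι i) * (ε i + ι i) = 1 := by
  simp only [add_mul, mul_add, h.cre_sq, h.ann_sq, h.ann_cre_self]
  abel

lemma cl_hat_anticomm [IsAddTorsionFree A] (h : CAR ε ι) (i j : Fin n) :
    (ε i - ι i) * (ε j + ι j) = -((ε j + ι j) * (ε i - ι i)) := by
  simp only [sub_mul, mul_sub, add_mul, mul_add, h.cre_cre i j, h.ann_ann i j, h.ann_cre i j,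
    h.cre_ann i j]
  abel

lemma cl_mul_hatProd [IsAddTorsionFree A] (h : CAR ε ι) (j : Fin n) (l : List (Fin n)) :
    (ε j - ι j) * hatProd ε ι l = (-1 : ℤ) ^ l.length • (hatProd ε ι l * (ε j - ι j)) := by
  induction l with
  | nil => simp
  | cons a l ih =>
    rw [hatProd_cons, ← mul_assoc, h.cl_hat_anticomm, neg_mul, mul_assoc, ih, List.length_cons,
      pow_succ, mul_neg_one, neg_smul, mul_smul_comm, mul_assoc]

lemma hat_mul_hatProd_of_notMem (h : CAR ε ι) {j : Fin n} {l : List (Fin n)} (hj : j ∉ l) :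
    (ε j + ι j) * hatProd ε ι l = (-1 : ℤ) ^ l.length • (hatProd ε ι l * (ε j + ι j)) := by
  induction l with
  | nil => simp
  | cons a l ih =>
    rw [List.mem_cons, not_or] at hj
    rw [hatProd_cons, ← mul_assoc, h.hat_anticomm hj.1, neg_mul, mul_assoc, ih hj.2,
      List.length_cons, pow_succ, mul_neg_one, neg_smul, mul_smul_comm, mul_assoc]

/-- The element commutes with its own factor in the word and anticommutes with every other one, so
one sign is missing. The exponent `l.length + 1` has the parity of `l.length - 1`. -/
lemma hat_mul_hatProd_of_mem [IsAddTorsionFree A] (h : CAR ε ι) {j : Fin n} {l : List (Fin n)}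
    (hl : l.Nodup) (hj : j ∈ l) :
    (ε j + ι j) * hatProd ε ι l = (-1 : ℤ) ^ (l.length + 1) • (hatProd ε ι l * (ε j + ι j)) := by
  induction l with
  | nil => simp at hj
  | cons a l ih =>
    rw [List.nodup_cons] at hl
    rw [hatProd_cons, List.length_cons]
    rcases eq_or_ne j a with rfl | hja
    · have := h.hat_mul_hatProd_of_notMem hl.1
      rw [mul_assoc (ε j + ι j) (hatProd ε ι l), ← mul_smul_comm, pow_add _ _ 2]
      simp only [even_two, Even.neg_pow, one_pow, mul_one]
      congr 1
    · rw [List.mem_cons, or_iff_right hja] at hj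
      rw [← mul_assoc, h.hat_anticomm hja, neg_mul, mul_assoc, ih hl.2 hj, pow_succ _ (l.length + 1),
        mul_neg_one, neg_smul, mul_smul_comm, mul_assoc]

/-- Bringing the first letter of the second copy next to its twin costs (-1)^(length of the tail),
and the twins square to 1. The accumulated signs are those of a reversal. -/
lemma hatProd_mul_self [IsAddTorsionFree A] (h : CAR ε ι) {l : List (Fin n)} (hl : l.Nodup) :
    hatProd ε ι l * hatProd ε ι l = revSign l.length • (1 : A) := by
  induction l with
  | nil => simp [revSign_zero]
  | cons a l ih =>
    rw [List.nodup_cons] at hl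
    have e := h.hat_mul_hatProd_of_notMem hl.1
    rw [hatProd_cons, mul_assoc, ← mul_assoc (hatProd ε ι l), List.length_cons, revSign_succ]
    have e' : hatProd ε ι l * (ε a + ι a)
        = (-1 : ℤ) ^ l.length • ((ε a + ι a) * hatProd ε ι l) := by
      rw [e, smul_smul, ← mul_pow]
      simp
    rw [e', smul_mul_assoc, mul_smul_comm, mul_assoc, ih hl.2, mul_smul, ← mul_assoc, h.hat_sq,
      one_mul]

/-- The product of all `ε i + ι i`. -/
def hatVol (ε ι : Fin n → A) : A := hatProd ε ι (List.finRange n)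

section Vol
variable [IsAddTorsionFree A] (h : CAR ε ι)
include h

lemma hat_mul_hatVol (j : Fin n) :
    (ε j + ι j) * hatVol ε ι = (-1 : ℤ) ^ (n + 1) • (hatVol ε ι * (ε j + ι j)) := by
  simpa [hatVol] using h.hat_mul_hatProd_of_mem (List.nodup_finRange n) (List.mem_finRange j)

lemma cl_mul_hatVol (j : Fin n) :
    (ε j - ι j) * hatVol ε ι = (-1 : ℤ) ^ n • (hatVol ε ι * (ε j - ι j)) := by
  simpa [hatVol] using h.cl_mul_hatProd j (List.finRange n)

/-- ĉ_j and c_j pass `hatVol` with opposite signs, because only ĉ_j occurs among its factors. Adding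
the two relations leaves ε_j on one side and ι_j on the other: `hatVol` exchanges creation and
annihilation, as the Hodge star does. -/
lemma cre_mul_hatVol (j : Fin n) :
    ε j * hatVol ε ι = (-1 : ℤ) ^ (n + 1) • (hatVol ε ι * ι j) := by
  have h1 := h.hat_mul_hatVol j
  have h2 := h.cl_mul_hatVol j
  refine nsmul_right_injective (M := A) two_ne_zero ?_
  have : 2 • (ε j * hatVol ε ι) = (ε j + ι j) * hatVol ε ι + (ε j - ι j) * hatVol ε ι := by
    noncomm_ring
  simp only [this, h1, h2, pow_succ, mul_neg_one, neg_smul, mul_add, mul_sub, smul_add, smul_sub,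
    smul_neg, two_smul]
  abel

lemma ann_mul_hatVol (j : Fin n) :
    ι j * hatVol ε ι = (-1 : ℤ) ^ (n + 1) • (hatVol ε ι * ε j) := by
  have h1 := h.hat_mul_hatVol j
  have h2 := h.cre_mul_hatVol j
  rw [add_mul, h2, mul_add, smul_add, add_comm] at h1
  exact add_right_cancel h1

lemma hatVol_mul_self : hatVol ε ι * hatVol ε ι = revSign n • (1 : A) := by
  simpa [hatVol] using h.hatProd_mul_self (List.nodup_finRange n)

lemma revProd_ann_mul_hatVol (I : Finset (Fin n)) :
    revProd ι I * hatVol ε ι = (-1 : ℤ) ^ ((n + 1) * I.card) • (hatVol ε ι * revProd ε I) := by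
  induction I using Finset.induction_on_max with
  | empty => simp [revProd_empty]
  | insert a s ha ih =>
    have ha' : a ∉ s := fun h' => lt_irrefl _ (ha a h')
    rw [revProd_insert_max ι ha, revProd_insert_max ε ha, mul_assoc, ih, mul_smul_comm, ← mul_assoc,
      h.ann_mul_hatVol, Finset.card_insert_of_notMem ha', smul_mul_assoc, smul_smul, ← pow_add,
      mul_assoc, mul_add, mul_one]

/-- Even bilinear elements are transposed by `hatVol`. -/
lemma cre_ann_mul_hatVol (i j : Fin n) :
    ε i * ι j * hatVol ε ι = hatVol ε ι * (ι i * ε j) := by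
  rw [mul_assoc, h.ann_mul_hatVol, mul_smul_comm, ← mul_assoc, h.cre_mul_hatVol, smul_mul_assoc,
    smul_smul, ← mul_pow, mul_assoc]
  simp

/-- On forms ∑ ε_i ι_i is the degree, so this says that `hatVol` maps degree p to degree n - p. -/
lemma number_mul_hatVol :
    (∑ i, ε i * ι i) * hatVol ε ι = hatVol ε ι * ((n : A) - ∑ i, ε i * ι i) := by
  rw [Finset.sum_mul]
  simp only [h.cre_ann_mul_hatVol, h.ann_cre_self, mul_sub, Finset.sum_sub_distrib, ← Finset.mul_sum]
  simp

end Vol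

end CAR
end CAR
-- Exterior and interior multiplication on forms
section ExteriorAlgebra

variable {V : Type*} [NormedAddCommGroup V] [InnerProductSpace ℝ V]

namespace Forms

/-! The module axioms of `Forms V`, with the instances in the form in which they are found by
unification. -/

lemma zero_smul (η : Forms V) : (0 : ℂ) • η = 0 := _root_.zero_smul ℂ η
lemma one_smul (η : Forms V) : (1 : ℂ) • η = η := _root_.one_smul ℂ η
lemma smul_zero (a : ℂ) : a • (0 : Forms V) = 0 := _root_.smul_zero (A := Forms V) a
lemma add_smul (a b : ℂ) (η : Forms V) : (a + b) • η = a • η + b • η := _root_.add_smul a b η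
lemma smul_add (a : ℂ) (η ξ : Forms V) : a • (η + ξ) = a • η + a • ξ := _root_.smul_add a η ξ
lemma smul_smul (a b : ℂ) (η : Forms V) : a • b • η = (a * b) • η := _root_.smul_smul a b η
lemma smul_sum {ι : Type*} (s : Finset ι) (a : ℂ) (η : ι → Forms V) :
    a • ∑ i ∈ s, η i = ∑ i ∈ s, a • η i := Finset.smul_sum

end Forms

lemma extMul_apply_succ (v : V) (η : Forms V) (q : ℕ) (w : Fin (q + 1) → V) :
    extMul v η (q + 1) w
      = ∑ i : Fin (q + 1), (-1 : ℂ) ^ (i : ℕ) * ((inner ℝ v (w i) : ℝ) * η q (i.removeNth w)) := by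
  simp [extMul, wedge, ContinuousAlternatingMap.alternatizeUncurryFin_apply]

@[simp] lemma extMul_apply_zero (v : V) (η : Forms V) : extMul v η 0 = 0 := rfl

lemma intMul_apply (v : V) (η : Forms V) (p : ℕ) (w : Fin p → V) :
    intMul v η p w = η (p + 1) (Matrix.vecCons v w) := rfl

lemma ext_of_intMul {p : ℕ} {η ξ : Forms V}
    (h : ∀ v, intMul v η p = intMul v ξ p) : η (p + 1) = ξ (p + 1) := by
  ext w
  have := congr($(h (w 0)) (Matrix.vecTail w))
  rw [intMul_apply, intMul_apply,
    show Matrix.vecCons (w 0) (Matrix.vecTail w) = w from Fin.cons_self_tail w] at this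
  exact this

lemma intMul_intMul (v w : V) (η : Forms V) :
    intMul v (intMul w η) = -intMul w (intMul v η) := by
  ext p u
  have h := (η (p + 2)).toAlternatingMap.map_swap (Matrix.vecCons v (Matrix.vecCons w u))
    (i := 0) (j := 1) (by simp)
  have : (Matrix.vecCons v (Matrix.vecCons w u)) ∘ (Equiv.swap (0 : Fin (p + 2)) 1)
      = Matrix.vecCons w (Matrix.vecCons v u) := by
    funext i
    refine Fin.cases ?_ (fun i => Fin.cases ?_ (fun i => ?_) i) i
    · simp
    · simp
    · have : Equiv.swap (0 : Fin (p + 2)) 1 i.succ.succ = i.succ.succ :=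
        Equiv.swap_apply_of_ne_of_ne (by simp [Fin.ext_iff]) (by simp [Fin.ext_iff])
      simp [this]
  rw [this] at h
  exact h

/-- When w^* ∧ η is expanded over its arguments, the term in which w^* takes the first argument v is
the inner product. The other terms form -w^* ∧ ι(v)η, their signs being shifted by one place. -/
lemma intMul_extMul (v w : V) (η : Forms V) :
    intMul v (extMul w η) = (inner ℝ v w : ℂ) • η - extMul w (intMul v η) := by
  ext p u
  simp only [intMul_apply, Pi.sub_apply, Pi.smul_apply,
    ContinuousAlternatingMap.sub_apply, ContinuousAlternatingMap.smul_apply]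
  rw [extMul_apply_succ, Fin.sum_univ_succ]
  cases p with
  | zero => simp [real_inner_comm]
  | succ p =>
    rw [extMul_apply_succ]
    simp [real_inner_comm, intMul_apply, pow_succ]
    rw [sub_eq_add_neg]
    refine congrArg _ (congrArg _ (Finset.sum_congr rfl fun i _ => ?_))
    congr 3
    funext j
    refine Fin.cases ?_ (fun j => ?_) j
    · simp [Fin.removeNth]
    · simp [Fin.removeNth]

/-- Induction on the degree: a form of positive degree is determined by its contractions, and by
`intMul_extMul` a contraction commutes with the symmetrized product ε(v)ε(w) + ε(w)ε(v), since the
inner products cancel. -/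
lemma extMul_extMul (v w : V) (η : Forms V) :
    extMul v (extMul w η) = -extMul w (extMul v η) := by
  have key : ∀ (p : ℕ) (η : Forms V), (extMul v (extMul w η) + extMul w (extMul v η)) p = 0 := by
    intro p
    induction p with
    | zero => intro η; simp
    | succ p ih =>
      intro η
      have : (extMul v (extMul w η) + extMul w (extMul v η)) (p + 1) = (0 : Forms V) (p + 1) := by
        refine ext_of_intMul fun u => ?_
        have h : intMul u (extMul v (extMul w η) + extMul w (extMul v η))
            = extMul v (extMul w (intMul u η)) + extMul w (extMul v (intMul u η)) := by
          simp only [map_add, intMul_extMul, map_sub, map_smul]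
          abel
        rw [h, ih]
        simp
      simpa using this
  exact eq_neg_of_add_eq_zero_left (funext fun p => key p η)

lemma extMul_add (v w : V) (η : Forms V) : extMul (v + w) η = extMul v η + extMul w η := by
  funext p
  cases p with
  | zero => simp
  | succ p =>
    ext u
    simp [extMul_apply_succ, inner_add_left, add_mul, mul_add, Finset.sum_add_distrib]

lemma extMul_smul (a : ℝ) (v : V) (η : Forms V) : extMul (a • v) η = (a : ℂ) • extMul v η := by
  funext p
  cases p with
  | zero => exact (smul_zero (A := V [⋀^Fin 0]→L[ℝ] ℂ) (a : ℂ)).symm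
  | succ p =>
    ext u
    simp only [extMul_apply_succ, inner_smul_left, Pi.smul_apply,
      ContinuousAlternatingMap.smul_apply, smul_eq_mul, Finset.mul_sum]
    refine Finset.sum_congr rfl fun i _ => ?_
    simp
    ring

lemma intMul_add (v w : V) (η : Forms V) : intMul (v + w) η = intMul v η + intMul w η := by
  ext p u
  simp only [intMul_apply, Pi.add_apply, ContinuousAlternatingMap.add_apply]
  exact (η (p + 1)).toAlternatingMap.map_vecCons_add u v w

lemma intMul_smul (a : ℝ) (v : V) (η : Forms V) : intMul (a • v) η = (a : ℂ) • intMul v η := by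
  ext p u
  simp only [intMul_apply, Pi.smul_apply, ContinuousAlternatingMap.smul_apply]
  exact (η (p + 1)).toAlternatingMap.map_vecCons_smul u a v

/-- Exterior multiplication as a real linear map. -/
noncomputable def extMulₗ : V →ₗ[ℝ] Forms V → Forms V where
  toFun v η := extMul v η
  map_add' v w := funext fun η => extMul_add v w η
  map_smul' a v := by
    funext η p
    rw [extMul_smul]
    rfl

/-- Interior multiplication as a real linear map. -/
noncomputable def intMulₗ : V →ₗ[ℝ] Forms V → Forms V where
  toFun v η := intMul v η
  map_add' v w := funext fun η => intMul_add v w η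
  map_smul' a v := by
    funext η p
    rw [intMul_smul]
    rfl

lemma extMul_sum {ι : Type*} (s : Finset ι) (a : ι → ℝ) (v : ι → V) (η : Forms V) :
    extMul (∑ i ∈ s, a i • v i) η = ∑ i ∈ s, (a i : ℂ) • extMul (v i) η := by
  change extMulₗ (∑ i ∈ s, a i • v i) η = _
  rw [map_sum, Finset.sum_apply]
  exact Finset.sum_congr rfl fun i _ => extMul_smul _ _ _

lemma intMul_sum {ι : Type*} (s : Finset ι) (a : ι → ℝ) (v : ι → V) (η : Forms V) :
    intMul (∑ i ∈ s, a i • v i) η = ∑ i ∈ s, (a i : ℂ) • intMul (v i) η := by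
  change intMulₗ (∑ i ∈ s, a i • v i) η = _
  rw [map_sum, Finset.sum_apply]
  exact Finset.sum_congr rfl fun i _ => intMul_smul _ _ _

section Basis

variable {n : ℕ} (b : OrthonormalBasis (Fin n) ℝ V)

lemma car_basis : CAR (A := Module.End ℂ (Forms V)) (fun i => extMul (b i)) (fun i => intMul (b i))
    where
  cre_cre i j := LinearMap.ext fun η => extMul_extMul _ _ η
  ann_ann i j := LinearMap.ext fun η => intMul_intMul _ _ η
  ann_cre i j := LinearMap.ext fun η => by
    have := intMul_extMul (b i) (b j) η
    rw [b.inner_eq_ite] at this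
    split_ifs with h
    · rw [if_pos h, Complex.ofReal_one, Forms.one_smul] at this
      exact this
    · rw [if_neg h, Complex.ofReal_zero, Forms.zero_smul] at this
      exact this

lemma ext_of_intMul_basis {p : ℕ} {η ξ : Forms V}
    (h : ∀ i, intMul (b i) η p = intMul (b i) ξ p) : η (p + 1) = ξ (p + 1) := by
  refine ext_of_intMul fun v => ?_
  rw [← b.sum_repr' v, intMul_sum, intMul_sum, Finset.sum_apply, Finset.sum_apply]
  exact Finset.sum_congr rfl fun i _ => congrArg (fun ζ => (inner ℝ (b i) v : ℂ) • ζ) (h i)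

/-- Induction on the degree through contractions: commuting ι_j past ∑ ε_i ι_i produces exactly one
extra ι_j. -/
lemma number_apply (η : Forms V) (p : ℕ) :
    (∑ i, extMul (b i) (intMul (b i) η)) p = (p : ℂ) • η p := by
  induction p generalizing η with
  | zero =>
    rw [Nat.cast_zero, show (0 : ℂ) • η 0 = ((0 : ℂ) • η) 0 from rfl, Forms.zero_smul]
    simp
  | succ p ih =>
    refine (ext_of_intMul_basis (ξ := ((p + 1 : ℕ) : ℂ) • η) b fun j => ?_)
    have : intMul (b j) (∑ i, extMul (b i) (intMul (b i) η))
        = intMul (b j) η + ∑ i, extMul (b i) (intMul (b i) (intMul (b j) η)) := by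
      have e : ∀ i, intMul (b j) (extMul (b i) (intMul (b i) η))
          = (if j = i then intMul (b i) η else 0)
            + extMul (b i) (intMul (b i) (intMul (b j) η)) := by
        intro i
        rw [intMul_extMul, intMul_intMul (b j), map_neg, sub_neg_eq_add, b.inner_eq_ite]
        split_ifs
        · rw [Complex.ofReal_one, Forms.one_smul]
        · rw [Complex.ofReal_zero, Forms.zero_smul]
      rw [map_sum, Finset.sum_congr rfl fun i _ => e i, Finset.sum_add_distrib]
      simp
    rw [this, Pi.add_apply, ih, map_smul, Pi.smul_apply]
    change (intMul (b j) η + (p : ℂ) • intMul (b j) η) p = (((p + 1 : ℕ) : ℂ) • intMul (b j) η) p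
    rw [Nat.cast_succ, Forms.add_smul, Forms.one_smul, add_comm]

end Basis

end ExteriorAlgebra


/-! ### The Hodge star as a product of Clifford elements -/

section HodgeStar

variable {V : Type*} [NormedAddCommGroup V] [InnerProductSpace ℝ V] {n : ℕ}

/-- Allows the factor 2 to be cancelled, so that x = -x gives x = 0 in the ring of endomorphisms. -/
lemma isAddTorsionFree_end (W : Type*) [AddCommGroup W] [Module ℂ W] :
    IsAddTorsionFree (Module.End ℂ W) where
  nsmul_right_injective k hk f g h := by
    refine LinearMap.ext fun w => ?_
    have e : k • f w = k • g w := congr($h w)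
    rw [← Nat.cast_smul_eq_nsmul ℂ, ← Nat.cast_smul_eq_nsmul ℂ] at e
    exact smul_right_injective W (Nat.cast_ne_zero.mpr hk : (k : ℂ) ≠ 0) e

instance : IsAddTorsionFree (Module.End ℂ (Forms V)) := isAddTorsionFree_end (Forms V)

/-- Multiplication of the component of degree `p` by `s p`. -/
noncomputable def degScale (s : ℕ → ℂ) (η : Forms V) : Forms V := fun p => s p • η p

/-- The product of all `ĉ(b i)`. -/
noncomputable def volOp (b : Fin n → V) : Module.End ℂ (Forms V) :=
  CAR.hatVol (fun i => extMul (b i)) (fun i => intMul (b i))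

lemma intMul_oneForm (v : V) : intMul v oneForm = 0 := rfl

/-- On a wedge product of basis covectors, ĉ of a basis vector outside the word acts as exterior
multiplication, because its contraction part vanishes. The two statements feed each other in the
induction. -/
lemma extMul_foldr_hat (b : OrthonormalBasis (Fin n) ℝ V) (l : List (Fin n)) (hl : l.Nodup) :
    (CAR.hatProd (fun i => extMul (b i)) (fun i => intMul (b i)) l : Module.End ℂ (Forms V)) oneForm
        = (l.map b).foldr (fun v η => extMul v η) oneForm ∧
      ∀ c ∉ l, intMul (b c) ((l.map b).foldr (fun v η => extMul v η) oneForm) = 0 := by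
  induction l with
  | nil => exact ⟨rfl, fun c _ => intMul_oneForm _⟩
  | cons a l ih =>
    rw [List.nodup_cons] at hl
    obtain ⟨h1, h2⟩ := ih hl.2
    rw [CAR.hatProd_cons, List.map_cons, List.foldr_cons, Module.End.mul_apply, h1]
    refine ⟨?_, fun c hc => ?_⟩
    · rw [LinearMap.add_apply, h2 a hl.1, add_zero]
    · rw [List.mem_cons, not_or] at hc
      rw [intMul_extMul, b.inner_eq_ite, if_neg hc.1, h2 c hc.2, map_zero, Complex.ofReal_zero,
        Forms.zero_smul, sub_zero]

lemma volForm_eq (b : OrthonormalBasis (Fin n) ℝ V) : volForm b = volOp b oneForm := by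
  rw [volOp, CAR.hatVol, (extMul_foldr_hat b _ (List.nodup_finRange n)).1, volForm,
    List.ofFn_eq_map]

lemma foldl_intMul_apply_zero (b : Fin n → V) (l : List (Fin n)) (η : Forms V) (u : Fin 0 → V) :
    l.foldl (fun ξ i => intMul (b i) ξ) η 0 u = η l.length (fun i => b (l.get i)) := by
  induction l generalizing η with
  | nil =>
    change η 0 u = η 0 _
    congr 1
    exact Subsingleton.elim _ _
  | cons a l ih =>
    rw [List.foldl_cons, ih, intMul_apply]
    change η (l.length + 1) _ = η (l.length + 1) _
    congr 1
    funext i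
    refine Fin.cases ?_ (fun i => ?_) i <;> rfl

lemma foldl_apply {W X : Type*} [AddCommGroup W] [Module ℂ W] (ι : X → Module.End ℂ W) (l : List X)
    (T : Module.End ℂ W) (η : W) :
    (l.foldl (fun z i => ι i * z) T) η = l.foldl (fun ξ i => ι i ξ) (T η) := by
  induction l generalizing T with
  | nil => rfl
  | cons a l ih => rw [List.foldl_cons, ih, List.foldl_cons]; rfl

/-- The product of all contractions over `I`, from the smallest index to the largest. -/
noncomputable def intMulProd (b : Fin n → V) (I : Finset (Fin n)) : Module.End ℂ (Forms V) :=
  revProd (fun i => intMul (b i)) I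

/-- The product of all exterior multiplications over `I`, from the smallest index to the
largest. -/
noncomputable def extMulProd (b : Fin n → V) (I : Finset (Fin n)) : Module.End ℂ (Forms V) :=
  revProd (fun i => extMul (b i)) I

lemma intMulProd_apply (b : Fin n → V) (I : Finset (Fin n)) (η : Forms V) :
    intMulProd b I η = (I.sort (· ≤ ·)).foldl (fun ξ i => intMul (b i) ξ) η :=
  foldl_apply _ _ _ _

lemma apply_orderEmb (b : Fin n → V) (I : Finset (Fin n)) (η : Forms V) (u : Fin 0 → V) :
    η I.card (fun k => b (I.orderEmbOfFin rfl k)) = intMulProd b I η 0 u := by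
  have key : ∀ (k : ℕ) (l : List (Fin n)) (hk : l.length = k) (f : Fin k → Fin n),
      (∀ i : Fin k, f i = l.get (i.cast hk.symm)) →
      η k (fun i => b (f i)) = η l.length (fun i => b (l.get i)) := by
    rintro k l rfl f hf
    congr 1
    funext i
    rw [hf i]
    rfl
  rw [intMulProd_apply, foldl_intMul_apply_zero]
  exact key _ _ (Finset.length_sort _) _ fun i => rfl

/-- Expansion of a form in the basis `ε_I 1`. -/
lemma sum_extMulProd (b : OrthonormalBasis (Fin n) ℝ V) (η : Forms V) :
    ∑ I : Finset (Fin n), (CAR.revSign I.card : ℂ) •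
      (η I.card (fun k => b (I.orderEmbOfFin rfl k)) • extMulProd b I oneForm) = η := by
  obtain ⟨P, h1, -, ⟨x, hx⟩, h3⟩ := (car_basis b).exists_vacuum Finset.univ
  -- P is the projection onto degree zero. In degree zero the terms ε_j x_j of P vanish, leaving the
  -- identity; in positive degree every contraction of Pξ is zero.
  have hP : ∀ ξ : Forms V, P ξ = (ξ 0 (fun i => i.elim0)) • oneForm := by
    intro ξ
    funext p
    cases p with
    | zero =>
      ext u
      have e : u = fun i => i.elim0 := Subsingleton.elim _ _
      subst e
      have e0 : (∑ j, (extMul (b j) * x j) ξ 0) = 0 := Finset.sum_eq_zero fun j _ => rfl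
      rw [hx, LinearMap.add_apply, LinearMap.sum_apply, Pi.add_apply, Finset.sum_apply, e0,
        add_zero]
      change _ = ξ 0 _ * 1
      rw [mul_one]
      rfl
    | succ p =>
      refine ext_of_intMul_basis b fun i => ?_
      rw [map_smul, intMul_oneForm, Forms.smul_zero]
      exact congr($(h1 i (Finset.mem_univ i)) ξ p)
  conv_rhs => rw [← Module.End.one_apply (R := ℂ) η]
  rw [← h3, LinearMap.sum_apply, Finset.powerset_univ]
  refine Finset.sum_congr rfl fun I _ => ?_
  rw [apply_orderEmb _ _ _ (fun i => i.elim0)]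
  change _ = CAR.revSign I.card • extMulProd b I (P (intMulProd b I η))
  rw [hP, map_smul]
  exact Int.cast_smul_eq_zsmul ℂ (CAR.revSign I.card) (M := Forms V) _

/-- The signs relating the Hodge star and `volOp`. -/
noncomputable def starSign (n p : ℕ) : ℂ := (CAR.revSign p : ℂ) * (-1) ^ ((n + 1) * p)

/-- The volume form is ω·1 with ω = `volOp b`. Pushing the contractions over I through ω turns them
into exterior multiplications with sign (-1)^((n+1)|I|), and the expansion of η in the forms ε_I 1
carries the sign of a reversal. Both signs depend on the degree only and make up `starSign`. -/
lemma hodgeStar_eq (b : OrthonormalBasis (Fin n) ℝ V) (η : Forms V) :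
    hodgeStar b η = volOp b (degScale (starSign n) η) := by
  conv_rhs => rw [← sum_extMulProd b (degScale (starSign n) η)]
  rw [map_sum, hodgeStar]
  refine Finset.sum_congr rfl fun I _ => ?_
  rw [← intMulProd_apply, volForm_eq, map_smul, map_smul]
  have h := congr($((car_basis b).revProd_ann_mul_hatVol I) oneForm)
  change intMulProd b I (volOp b oneForm)
    = (-1 : ℤ) ^ ((n + 1) * I.card) • volOp b (extMulProd b I oneForm) at h
  rw [h, Forms.smul_smul, ← Int.cast_smul_eq_zsmul ℂ, Forms.smul_smul]
  congr 1
  change _ = _ * (starSign n I.card * _)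
  have := congrArg (Int.cast (R := ℂ)) (CAR.revSign_mul_self I.card)
  push_cast at this
  rw [starSign]
  push_cast
  linear_combination (-1 : ℂ) * (-1) ^ ((n + 1) * I.card)
    * η I.card (fun k => b (I.orderEmbOfFin rfl k)) * this

/-- With N the degree operator, ωN = (n - N)ω. If ζ has no part in degree n - q it can be written (N
- (n - q))ζ', so that ωζ = (q - N)ωζ', which vanishes in degree q. -/
lemma volOp_apply_eq_zero (b : OrthonormalBasis (Fin n) ℝ V) {ζ : Forms V} {q : ℕ}
    (h : ∀ p, p + q = n → ζ p = 0) : volOp b ζ q = 0 := by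
  set ζ' : Forms V := degScale (fun p => ((p : ℂ) - (n - q))⁻¹) ζ with hζ'
  have e : ζ = ∑ i, extMul (b i) (intMul (b i) ζ') - ((n : ℂ) - q) • ζ' := by
    funext p
    rw [Pi.sub_apply, number_apply, Pi.smul_apply]
    ext u
    change ζ p u = p * (((p : ℂ) - (n - q))⁻¹ * ζ p u) - (n - q) * (((p : ℂ) - (n - q))⁻¹ * ζ p u)
    by_cases hp : p + q = n
    · simp [h p hp]
    · have : (p : ℂ) - (n - q) ≠ 0 := by
        intro h0
        apply hp
        have : ((p + q : ℕ) : ℂ) = n := by push_cast; linear_combination h0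
        exact_mod_cast this
      field_simp
  have h1 := congr($((car_basis b).number_mul_hatVol) ζ')
  have h2 : ∑ i, extMul (b i) (intMul (b i) (volOp b ζ'))
      = (n : ℂ) • volOp b ζ' - volOp b (∑ i, extMul (b i) (intMul (b i) ζ')) := by
    rw [← map_smul, ← map_sub]
    have e1 : (n : ℂ) • ζ' = ((n : Module.End ℂ (Forms V))) ζ' := by
      rw [Module.End.natCast_apply]
      exact Nat.cast_smul_eq_nsmul ℂ n ζ'
    rw [e1]
    simpa [LinearMap.sum_apply, volOp] using h1
  have h3 : volOp b ζ = (q : ℂ) • volOp b ζ' - ∑ i, extMul (b i) (intMul (b i) (volOp b ζ')) := by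
    rw [h2]
    conv_lhs => rw [e, map_sub, map_smul]
    ext p u
    change _ - ((n : ℂ) - q) * _ = (q : ℂ) * _ - ((n : ℂ) * _ - _)
    ring
  rw [h3, Pi.sub_apply, number_apply, Pi.smul_apply, sub_self]

lemma volOp_apply_congr (b : OrthonormalBasis (Fin n) ℝ V) {ζ ξ : Forms V} {q : ℕ}
    (h : ∀ p, p + q = n → ζ p = ξ p) : volOp b ζ q = volOp b ξ q := by
  rw [← sub_eq_zero, ← Pi.sub_apply, ← map_sub]
  exact volOp_apply_eq_zero b fun p hp => by rw [Pi.sub_apply, h p hp, sub_self]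

lemma volOp_volOp (b : OrthonormalBasis (Fin n) ℝ V) (ζ : Forms V) :
    volOp b (volOp b ζ) = (CAR.revSign n : ℂ) • ζ := by
  have := congr($((car_basis b).hatVol_mul_self) ζ)
  refine Eq.trans this ?_
  exact (Int.cast_smul_eq_zsmul ℂ (CAR.revSign n) ζ).symm

lemma hodgeStar_volOp (b : OrthonormalBasis (Fin n) ℝ V) (ζ : Forms V) {p : ℕ} (hp : p ≤ n) :
    hodgeStar b (volOp b ζ) p = (starSign n (n - p) * CAR.revSign n) • ζ p := by
  rw [hodgeStar_eq]
  have : volOp b (degScale (starSign n) (volOp b ζ)) p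
      = volOp b (starSign n (n - p) • volOp b ζ) p := by
    refine volOp_apply_congr b fun q hq => ?_
    have : q = n - p := by omega
    rw [this]
    rfl
  rw [this, map_smul, volOp_volOp, Forms.smul_smul]
  rfl

/-- ω² = ±1 recovers ζ from ωζ, while no degree is complementary to p > n, so the degree p part of
ω(ωζ) vanishes. -/
lemma apply_eq_zero_of_lt (b : OrthonormalBasis (Fin n) ℝ V) (ζ : Forms V) {p : ℕ} (hp : n < p) :
    ζ p = 0 := by
  have h : volOp b (volOp b ζ) p = 0 := volOp_apply_eq_zero b fun q hq => by omega
  rw [volOp_volOp] at h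
  have h0 : (CAR.revSign n : ℂ) ≠ 0 := by
    have := congrArg (Int.cast (R := ℂ)) (CAR.revSign_mul_self n)
    push_cast at this
    exact left_ne_zero_of_mul_eq_one this
  ext u
  have := congr($h u)
  exact (mul_eq_zero.mp this).resolve_left h0

lemma CAR.revSign_add (m p : ℕ) : revSign (m + p) = revSign m * revSign p * (-1) ^ (m * p) := by
  induction p with
  | zero => simp [revSign_zero]
  | succ p ih =>
    rw [← add_assoc, revSign_succ, ih, revSign_succ, pow_add, mul_add, pow_add, mul_one]
    ring

/-- The total sign picked up in ⋆ε⋆: one `starSign` from each star, `revSign n` from ω², and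
(-1)^(n+1) from moving ε past ω. Reversal signs cancel in pairs, and a parity count does the rest.
-/
lemma starSign_sign {n p : ℕ} (hp : p ≤ n) :
    starSign n (n - p) * CAR.revSign n * ((-1) ^ (n + 1) * starSign n (p + 1))
      = (-1) ^ (n * p) := by
  obtain ⟨m, rfl⟩ := Nat.exists_eq_add_of_le' hp
  rw [Nat.add_sub_cancel, starSign, starSign, CAR.revSign_add, CAR.revSign_succ]
  have h1 := congrArg (Int.cast (R := ℂ)) (CAR.revSign_mul_self m)
  have h2 := congrArg (Int.cast (R := ℂ)) (CAR.revSign_mul_self p)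
  push_cast at h1 h2 ⊢
  have h3 : (-1 : ℂ) ^ ((m + p + 1) * m) * (-1) ^ (m * p) * (-1) ^ (m + p + 1) * (-1) ^ p
      * (-1) ^ ((m + p + 1) * (p + 1)) = (-1) ^ ((m + p) * p) := by
    rw [← pow_add, ← pow_add, ← pow_add, ← pow_add]
    refine neg_one_pow_congr ?_
    simp only [Nat.even_add, Nat.even_mul, Nat.not_even_one, iff_false]
    tauto
  rw [← h3]
  linear_combination ((-1 : ℂ) ^ ((m + p + 1) * m) * (-1) ^ (m * p) * (-1) ^ (m + p + 1) * (-1) ^ p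
      * (-1) ^ ((m + p + 1) * (p + 1))) * (CAR.revSign p * CAR.revSign p * h1 + h2)

/-- Up to signs this is ωεω = ±ω²ι = ±ι. The remaining sign (-1)^(np) is what the factor in the
definition of `codiff` compensates. In degrees above n both sides vanish. -/
lemma hodgeStar_extMul_hodgeStar (b : OrthonormalBasis (Fin n) ℝ V) (j : Fin n) (ξ : Forms V)
    (p : ℕ) :
    hodgeStar b (extMul (b j) (hodgeStar b ξ)) p = ((-1 : ℂ) ^ (n * p)) • intMul (b j) ξ p := by
  rcases lt_or_ge n p with hp | hp
  · rw [apply_eq_zero_of_lt b (hodgeStar b _) hp,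
      apply_eq_zero_of_lt b (intMul (b j) ξ) hp]
    ext u
    exact (mul_zero _).symm
  · have h := congr($((car_basis b).cre_mul_hatVol j) (degScale (starSign n) ξ))
    change extMul (b j) (volOp b (degScale (starSign n) ξ))
      = (-1 : ℤ) ^ (n + 1) • volOp b (intMul (b j) (degScale (starSign n) ξ)) at h
    rw [← Int.cast_smul_eq_zsmul ℂ, ← map_smul] at h
    rw [hodgeStar_eq b ξ, h, hodgeStar_volOp b _ hp, ← starSign_sign hp]
    ext u
    change _ * (((((-1 : ℤ) ^ (n + 1) : ℤ)) : ℂ) * (starSign n (p + 1) * _))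
      = _ * (ξ (p + 1)).toMultilinearMap (Fin.cons (b j) u)
    push_cast
    ring

end HodgeStar

/-! ### Smoothness and differentiation of coefficients in a frame -/

section Coefficients

variable {n : ℕ} {M : Type*} [TopologicalSpace M] [ChartedSpace (EuclideanSpace ℝ (Fin n)) M]
  [IsManifold (𝓡 n) ∞ M]

lemma contMDiffOn_mvfderiv {F : Type*} [NormedAddCommGroup F] [NormedSpace ℝ F] {g : M → F}
    {X : VField n M} {U : Set M} (hU : IsOpen U) (hg : ContMDiffOn (𝓡 n) 𝓘(ℝ, F) ∞ g U)
    (hX : SmoothFieldOn X U) :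
    ContMDiffOn (𝓡 n) 𝓘(ℝ, F) ∞ (fun x => mvfderiv (𝓡 n) g x (X x)) U := by
  have h1 := hg.contMDiffOn_tangentMapWithin (m := ∞) (by norm_num) hU.uniqueMDiffOn
  have h2 : ContMDiffOn (𝓡 n) 𝓘(ℝ, F).tangent ∞
      (fun x => tangentMapWithin (𝓡 n) 𝓘(ℝ, F) g U ⟨x, X x⟩) U :=
    h1.comp hX fun x hx => hx
  have h3 := (contMDiff_snd_tangentBundle_modelSpace F 𝓘(ℝ, F) (n := ∞)).comp_contMDiffOn h2
  refine h3.congr fun x hx => ?_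
  change _ = mfderivWithin (𝓡 n) 𝓘(ℝ, F) g U x (X x)
  rw [mfderivWithin_of_isOpen hU hx]
  rfl

omit [IsManifold (𝓡 n) ∞ M] in
lemma mvfderiv_clm_comp {F F' : Type*} [NormedAddCommGroup F] [NormedSpace ℝ F]
    [NormedAddCommGroup F'] [NormedSpace ℝ F'] (L : F →L[ℝ] F') {g : M → F} {x : M}
    (hg : MDifferentiableAt (𝓡 n) 𝓘(ℝ, F) g x) (v : TangentSpace (𝓡 n) x) :
    mvfderiv (𝓡 n) (fun y => L (g y)) x v = L (mvfderiv (𝓡 n) g x v) := by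
  have h := (L.hasMFDerivAt (x := g x)).comp x hg.hasMFDerivAt
  have h' := h.mfderiv
  change mfderiv (𝓡 n) 𝓘(ℝ, F') (L ∘ g) x v = _
  rw [h']
  rfl

/-- The map `z ↦ (c z) • ζ`. -/
noncomputable def scaleCLM {V : Type*} [NormedAddCommGroup V] [InnerProductSpace ℝ V] {p : ℕ}
    (c : ℂ) (ζ : V [⋀^Fin p]→L[ℝ] ℂ) : ℂ →L[ℝ] V [⋀^Fin p]→L[ℝ] ℂ :=
  LinearMap.toContinuousLinearMap
    { toFun := fun z => (c * z) • ζ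
      map_add' := fun z w => by
        ext u
        change c * (z + w) * ζ u = c * z * ζ u + c * w * ζ u
        ring
      map_smul' := fun r z => by
        ext u
        change c * (r * z) * ζ u = r * (c * z * ζ u)
        ring }

variable [RiemannianBundle (fun x : M => TangentSpace (𝓡 n) x)]

/-- The orthonormal basis given by an orthonormal frame at a point. -/
noncomputable def IsOrthonormalFrameOn.basis {e : Fin n → VField n M} {U : Set M}
    (he : IsOrthonormalFrameOn e U) {x : M} (hx : x ∈ U) :
    OrthonormalBasis (Fin n) ℝ (TangentSpace (𝓡 n) x) :=
  OrthonormalBasis.mk (he.orthonormal x hx) <| by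
    rw [(he.orthonormal x hx).linearIndependent.span_eq_top_of_card_eq_finrank']
    have : Module.finrank ℝ (TangentSpace (𝓡 n) x) = n :=
      (finrank_euclideanSpace_fin : Module.finrank ℝ (EuclideanSpace ℝ (Fin n)) = n)
    rw [this, Fintype.card_fin]

@[simp] lemma IsOrthonormalFrameOn.basis_apply {e : Fin n → VField n M} {U : Set M}
    (he : IsOrthonormalFrameOn e U) {x : M} (hx : x ∈ U) (i : Fin n) : he.basis hx i = e i x := by
  simp [IsOrthonormalFrameOn.basis]

lemma IsOrthonormalFrameOn.basis_coe {e : Fin n → VField n M} {U : Set M}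
    (he : IsOrthonormalFrameOn e U) {x : M} (hx : x ∈ U) :
    (he.basis hx : Fin n → TangentSpace (𝓡 n) x) = fun i => e i x :=
  funext fun i => he.basis_apply hx i

/-- The coefficient functions of a form with respect to a frame. -/
noncomputable def coeff (e : Fin n → VField n M) (η : FormField n M) (p : ℕ) (I : Fin p → Fin n) (y : M) : ℂ :=
  η y p (fun a => e (I a) y)

variable {e : Fin n → VField n M} {U : Set M} (he : IsOrthonormalFrameOn e U)
include he

lemma ext_frame {x : M} (hx : x ∈ U) {ζ ξ : Forms (TangentSpace (𝓡 n) x)}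
    (h : ∀ p (I : Fin p → Fin n), ζ p (fun a => e (I a) x) = ξ p (fun a => e (I a) x)) : ζ = ξ := by
  funext p
  refine ContinuousAlternatingMap.toAlternatingMap_injective ?_
  refine (he.basis hx).toBasis.ext_alternating fun I _ => ?_
  simpa using h p I

lemma frameTransport_apply {x : M} (hx : x ∈ U) (y : M) (i : Fin n) :
    frameTransport e x y (e i x) = e i y := by
  have h := he.orthonormal x hx
  simp [frameTransport, orthonormal_iff_ite.mp h]

lemma apply_eq_sum_coeff (η : FormField n M) {p : ℕ} (X : Fin p → VField n M) {x : M} (hx : x ∈ U) :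
    η x p (fun a => X a x)
      = ∑ I : Fin p → Fin n, (∏ a, inner ℝ (e (I a) x) (X a x)) • coeff e η p I x := by
  have h : ∀ a, X a x = ∑ i, (inner ℝ (e i x) (X a x) : ℝ) • e i x := fun a => by
    simpa using ((he.basis hx).sum_repr' (X a x)).symm
  conv_lhs => rw [show (fun a => X a x) = fun a => ∑ i, (inner ℝ (e i x) (X a x) : ℝ) • e i x from
    funext h]
  refine ((η x p).toMultilinearMap.map_sum _).trans (Finset.sum_congr rfl fun I _ => ?_)
  exact (η x p).toMultilinearMap.map_smul_univ _ _

variable [IsContMDiffRiemannianBundle (𝓡 n) ∞ (EuclideanSpace ℝ (Fin n))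
      (fun x : M => TangentSpace (𝓡 n) x)]

omit he in
lemma smooth_inner {X Y : VField n M} {W : Set M} (hX : SmoothFieldOn X W)
    (hY : SmoothFieldOn Y W) :
    ContMDiffOn (𝓡 n) 𝓘(ℝ, ℝ) ∞ (fun x => inner ℝ (X x) (Y x)) W :=
  ContMDiffOn.inner_bundle hX hY

/-- By multilinearity η(X₁, …, X_p) is a polynomial in the coefficients of η and the smooth
functions ⟨e_i, X_a⟩. -/
lemma smoothFormOn_iff_coeff {η : FormField n M} (hU : IsOpen U) :
    SmoothFormOn η U ↔
      ∀ p I, ContMDiffOn (𝓡 n) 𝓘(ℝ, ℂ) ∞ (coeff e η p I) U := by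
  refine ⟨fun h p I => h p U _ hU subset_rfl fun i => he.smooth _, fun h p W X hW hWU hX => ?_⟩
  have : ContMDiffOn (𝓡 n) 𝓘(ℝ, ℂ) ∞ (fun x =>
      ∑ I : Fin p → Fin n, (∏ a, inner ℝ (e (I a) x) (X a x)) • coeff e η p I x) W := by
    refine contMDiffOn_finsetSum fun I _ => ?_
    have h1 : ContMDiffOn (𝓡 n) 𝓘(ℝ, ℝ) ∞ (fun x => ∏ a, inner ℝ (e (I a) x) (X a x)) W :=
      contMDiffOn_finsetProd fun a _ => ?_
    · exact ContMDiffOn.smul h1 ((h p I).mono hWU)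
    exact smooth_inner (fun x hx => (he.smooth _ x (hWU hx)).mono hWU) (hX a)
  exact this.congr fun x hx => apply_eq_sum_coeff he η X (hWU hx)

/-- The coefficients of the coefficientwise derivative are the derivatives of the coefficients. -/
lemma coeffDeriv_apply (hU : IsOpen U) {η : FormField n M} (hη : SmoothFormOn η U) {x : M}
    (hx : x ∈ U) (v : TangentSpace (𝓡 n) x) (p : ℕ) (I : Fin p → Fin n) :
    coeffDeriv e η x v p (fun a => e (I a) x) = mvfderiv (𝓡 n) (coeff e η p I) x v := by
  have hc := (smoothFormOn_iff_coeff he hU).mp hη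
  have hd : ∀ q J, MDifferentiableAt (𝓡 n) 𝓘(ℝ, ℂ) (coeff e η q J) x := fun q J =>
    ((hc q J).contMDiffAt (hU.mem_nhds hx)).mdifferentiableAt (by simp)
  set Φ : M → TangentSpace (𝓡 n) x [⋀^Fin p]→L[ℝ] ℂ :=
    fun y => (η y p).compContinuousLinearMap (frameTransport e x y) with hΦ
  -- Expanding in the fixed forms ε_I 1 at x writes the transported form as a finite sum of
  -- coefficient functions times constants. This shows that Φ is differentiable, which is needed to
  -- take the derivative through evaluation on frame vectors.
  have hΦ' : Φ = fun y => ∑ I : Finset (Fin n), ((CAR.revSign I.card : ℂ) *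
      coeff e η I.card (I.orderEmbOfFin rfl) y) • (extMulProd (fun i => e i x) I oneForm p) := by
    funext y
    have h := congrFun (sum_extMulProd (he.basis hx)
      (fun q => (η y q).compContinuousLinearMap (frameTransport e x y))) p
    rw [Finset.sum_apply] at h
    change (η y p).compContinuousLinearMap (frameTransport e x y) = _
    rw [← h]
    refine Finset.sum_congr rfl fun I _ => ?_
    rw [he.basis_coe hx]
    ext u
    change (_ : ℂ) * ((_ : ℂ) * (_ : ℂ)) = ((_ : ℂ) * (_ : ℂ)) * (_ : ℂ)
    rw [← mul_assoc]
    congr 2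
    change η y I.card (fun k => frameTransport e x y (e (I.orderEmbOfFin rfl k) x)) = _
    simp only [frameTransport_apply he hx]
    rfl
  have hΦd : MDifferentiableAt (𝓡 n) 𝓘(ℝ, TangentSpace (𝓡 n) x [⋀^Fin p]→L[ℝ] ℂ) Φ x := by
    rw [hΦ']
    have : ContMDiffAt (𝓡 n) 𝓘(ℝ, TangentSpace (𝓡 n) x [⋀^Fin p]→L[ℝ] ℂ) ∞
        (fun y => ∑ I : Finset (Fin n), ((CAR.revSign I.card : ℂ) *
          coeff e η I.card (I.orderEmbOfFin rfl) y) •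
            (extMulProd (fun i => e i x) I oneForm p)) x := by
      refine contMDiffAt_finsetSum fun I _ => ?_
      exact (scaleCLM (CAR.revSign I.card) (extMulProd (fun i => e i x) I oneForm p)
        ).contMDiff.contMDiffAt.comp x ((hc _ _).contMDiffAt (hU.mem_nhds hx))
    exact this.mdifferentiableAt (by simp)
  have := mvfderiv_clm_comp (ContinuousAlternatingMap.apply ℝ (TangentSpace (𝓡 n) x) ℂ
    (fun a => e (I a) x)) hΦd v
  refine this.symm.trans ?_
  congr 2
  funext y
  change η y p (fun k => frameTransport e x y (e (I k) x)) = _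
  simp only [frameTransport_apply he hx]
  rfl

end Coefficients

/-! ### Product rules for the coefficientwise derivative -/

section Leibniz

variable {n : ℕ} {M : Type*} [TopologicalSpace M] [ChartedSpace (EuclideanSpace ℝ (Fin n)) M]
  [IsManifold (𝓡 n) ∞ M]

omit [IsManifold (𝓡 n) ∞ M] in
lemma mvfderiv_congr {F : Type*} [NormedAddCommGroup F] [NormedSpace ℝ F] {g g' : M → F}
    {U : Set M} (hU : IsOpen U) (h : ∀ y ∈ U, g y = g' y) {x : M} (hx : x ∈ U)
    (v : TangentSpace (𝓡 n) x) : mvfderiv (𝓡 n) g x v = mvfderiv (𝓡 n) g' x v := by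
  have h1 : g =ᶠ[nhds x] g' := Filter.eventuallyEq_of_mem (hU.mem_nhds hx) h
  change mfderiv (𝓡 n) 𝓘(ℝ, F) g x v = mfderiv (𝓡 n) 𝓘(ℝ, F) g' x v
  rw [h1.mfderiv_eq]
  rfl

omit [IsManifold (𝓡 n) ∞ M] in
lemma mvfderiv_mul_apply {f g : M → ℂ} {x : M} (hf : MDifferentiableAt (𝓡 n) 𝓘(ℝ, ℂ) f x)
    (hg : MDifferentiableAt (𝓡 n) 𝓘(ℝ, ℂ) g x) (v : TangentSpace (𝓡 n) x) :
    mvfderiv (𝓡 n) (fun y => f y * g y) x v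
      = f x * mvfderiv (𝓡 n) g x v + mvfderiv (𝓡 n) f x v * g x := by
  have h := (hf.hasMFDerivAt.mul' hg.hasMFDerivAt).mfderiv
  change mfderiv (𝓡 n) 𝓘(ℝ, ℂ) (f * g) x v = _
  rw [h]
  rfl

omit [IsManifold (𝓡 n) ∞ M] in
lemma mvfderiv_sum_apply {F ι : Type*} [NormedAddCommGroup F] [NormedSpace ℝ F] (s : Finset ι)
    {g : ι → M → F} {x : M} (hg : ∀ i ∈ s, MDifferentiableAt (𝓡 n) 𝓘(ℝ, F) (g i) x)
    (v : TangentSpace (𝓡 n) x) :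
    mvfderiv (𝓡 n) (fun y => ∑ i ∈ s, g i y) x v = ∑ i ∈ s, mvfderiv (𝓡 n) (g i) x v := by
  classical
  suffices MDifferentiableAt (𝓡 n) 𝓘(ℝ, F) (fun y => ∑ i ∈ s, g i y) x ∧
      mvfderiv (𝓡 n) (fun y => ∑ i ∈ s, g i y) x v = ∑ i ∈ s, mvfderiv (𝓡 n) (g i) x v from this.2
  induction s using Finset.induction_on with
  | empty => exact ⟨mdifferentiableAt_const, congr($(mvfderiv_const (0 : F)) v)⟩
  | insert a s ha ih =>
    have ih' := ih fun i hi => hg i (by simp [hi])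
    have ha' := hg a (by simp)
    simp only [Finset.sum_insert ha]
    refine ⟨ha'.add ih'.1, ?_⟩
    rw [← ih'.2]
    exact congr($(mvfderiv_fun_add ha' ih'.1) v)

omit [IsManifold (𝓡 n) ∞ M] in
lemma mvfderiv_const_mul (c : ℂ) {g : M → ℂ} {x : M}
    (hg : MDifferentiableAt (𝓡 n) 𝓘(ℝ, ℂ) g x) (v : TangentSpace (𝓡 n) x) :
    mvfderiv (𝓡 n) (fun y => c * g y) x v = c * mvfderiv (𝓡 n) g x v :=
  mvfderiv_clm_comp (ContinuousLinearMap.mul ℝ ℂ c) hg v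

omit [IsManifold (𝓡 n) ∞ M] in
lemma contMDiffOn_complex_mul {f g : M → ℂ} {U : Set M} (hf : ContMDiffOn (𝓡 n) 𝓘(ℝ, ℂ) ∞ f U)
    (hg : ContMDiffOn (𝓡 n) 𝓘(ℝ, ℂ) ∞ g U) :
    ContMDiffOn (𝓡 n) 𝓘(ℝ, ℂ) ∞ (fun y => f y * g y) U :=
  (contDiff_mul (𝕜 := ℝ) (𝔸 := ℂ)).contMDiff.comp_contMDiffOn (hf.prodMk_space hg)

omit [IsManifold (𝓡 n) ∞ M] in
lemma mdiffAt_of_contMDiffOn {F : Type*} [NormedAddCommGroup F] [NormedSpace ℝ F] {g : M → F}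
    {U : Set M} (hU : IsOpen U) (hg : ContMDiffOn (𝓡 n) 𝓘(ℝ, F) ∞ g U) {x : M} (hx : x ∈ U) :
    MDifferentiableAt (𝓡 n) 𝓘(ℝ, F) g x :=
  (hg.contMDiffAt (hU.mem_nhds hx)).mdifferentiableAt (by simp)

variable [RiemannianBundle (fun x : M => TangentSpace (𝓡 n) x)] {U : Set M}

lemma SmoothFormOn.congr {η ξ : FormField n M} (h : SmoothFormOn η U)
    (hηξ : ∀ y ∈ U, ξ y = η y) : SmoothFormOn ξ U := fun p W X hW hWU hX =>
  (h p W X hW hWU hX).congr fun y hy => by rw [hηξ y (hWU hy)]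

lemma SmoothFormOn.add {η ξ : FormField n M} (hη : SmoothFormOn η U) (hξ : SmoothFormOn ξ U) :
    SmoothFormOn (fun y => η y + ξ y) U := fun p W X hW hWU hX =>
  (hη p W X hW hWU hX).add (hξ p W X hW hWU hX)

lemma SmoothFormOn.fsmul {g : M → ℂ} (hg : ContMDiffOn (𝓡 n) 𝓘(ℝ, ℂ) ∞ g U) {η : FormField n M}
    (hη : SmoothFormOn η U) : SmoothFormOn (fun y => g y • η y) U := fun p W X hW hWU hX =>
  contMDiffOn_complex_mul (hg.mono hWU) (hη p W X hW hWU hX)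

lemma SmoothFormOn.smul (c : ℂ) {η : FormField n M}
    (hη : SmoothFormOn η U) : SmoothFormOn (fun y => c • η y) U :=
  SmoothFormOn.fsmul contMDiffOn_const hη

lemma SmoothFormOn.zero : SmoothFormOn (fun y => (0 : Forms (TangentSpace (𝓡 n) y))) U :=
  fun _ _ _ _ _ _ => contMDiffOn_const

lemma SmoothFormOn.sub {η ξ : FormField n M} (hη : SmoothFormOn η U) (hξ : SmoothFormOn ξ U) :
    SmoothFormOn (fun y => η y - ξ y) U := fun p W X hW hWU hX =>
  (hη p W X hW hWU hX).sub (hξ p W X hW hWU hX)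

lemma SmoothFormOn.sum {ι : Type*} (s : Finset ι) {η : ι → FormField n M}
    (hη : ∀ i ∈ s, SmoothFormOn (η i) U) : SmoothFormOn (fun y => ∑ i ∈ s, η i y) U := by
  classical
  induction s using Finset.induction_on with
  | empty => exact SmoothFormOn.zero
  | insert a s ha ih =>
    simp only [Finset.sum_insert ha]
    exact (hη a (by simp)).add (ih fun i hi => hη i (by simp [hi]))

lemma SmoothFormOn.degScale (s : ℕ → ℂ) {η : FormField n M}
    (hη : SmoothFormOn η U) : SmoothFormOn (fun y => degScale s (η y)) U := fun p W X hW hWU hX =>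
  contMDiffOn_complex_mul (contMDiffOn_const (c := s p)) (hη p W X hW hWU hX)

lemma SmoothFormOn.intMul {X : VField n M} (hX : SmoothFieldOn X U) {η : FormField n M}
    (hη : SmoothFormOn η U) : SmoothFormOn (fun y => intMul (X y) (η y)) U :=
  fun p W Y hW hWU hY => by
    refine (hη (p + 1) W (Matrix.vecCons X Y) hW hWU fun i => ?_).congr fun y hy => ?_
    · refine Fin.cases (hX.mono hWU) (fun j => hY j) i
    · rw [intMul_apply]
      congr 1
      funext i
      refine Fin.cases rfl (fun j => rfl) i

lemma SmoothFormOn.extMul [IsContMDiffRiemannianBundle (𝓡 n) ∞ (EuclideanSpace ℝ (Fin n))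
      (fun x : M => TangentSpace (𝓡 n) x)] {X : VField n M} (hX : SmoothFieldOn X U)
    {η : FormField n M} (hη : SmoothFormOn η U) : SmoothFormOn (fun y => extMul (X y) (η y)) U := by
  intro p W Y hW hWU hY
  cases p with
  | zero => exact contMDiffOn_const
  | succ q =>
    have : ContMDiffOn (𝓡 n) 𝓘(ℝ, ℂ) ∞ (fun y => ∑ i : Fin (q + 1), (-1 : ℂ) ^ (i : ℕ) *
        ((inner ℝ (X y) (Y i y) : ℝ) * η y q (i.removeNth fun a => Y a y))) W := by
      refine contMDiffOn_finsetSum fun i _ => contMDiffOn_complex_mul contMDiffOn_const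
        (contMDiffOn_complex_mul ?_ ?_)
      · exact Complex.ofRealCLM.contMDiff.comp_contMDiffOn
          (smooth_inner (hX.mono hWU) (hY i))
      · exact hη q W (i.removeNth Y) hW hWU fun a => hY _
    exact this.congr fun y hy => extMul_apply_succ _ _ _ _

variable {e : Fin n → VField n M}

omit [IsManifold (𝓡 n) ∞ M] in
lemma coeffDeriv_congr (hU : IsOpen U) {η ξ : FormField n M} (h : ∀ y ∈ U, η y = ξ y) {x : M}
    (hx : x ∈ U) (v : TangentSpace (𝓡 n) x) : coeffDeriv e η x v = coeffDeriv e ξ x v := by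
  funext p
  exact mvfderiv_congr hU (fun y hy => by rw [h y hy]) hx v

omit [IsManifold (𝓡 n) ∞ M] in
lemma coeffDeriv_add_right (η : FormField n M) (x : M) (v w : TangentSpace (𝓡 n) x) :
    coeffDeriv e η x (v + w) = coeffDeriv e η x v + coeffDeriv e η x w :=
  funext fun _ => map_add _ v w

omit [IsManifold (𝓡 n) ∞ M] in
lemma coeffDeriv_smul_right (η : FormField n M) (x : M) (a : ℝ) (v : TangentSpace (𝓡 n) x) :
    coeffDeriv e η x (a • v) = (a : ℂ) • coeffDeriv e η x v := by
  funext p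
  refine (map_smul (mvfderiv (𝓡 n) (fun y => (η y p).compContinuousLinearMap
    (frameTransport e x y)) x) a v).trans ?_
  ext u
  rfl

variable (he : IsOrthonormalFrameOn e U)
  [IsContMDiffRiemannianBundle (𝓡 n) ∞ (EuclideanSpace ℝ (Fin n))
      (fun x : M => TangentSpace (𝓡 n) x)]
include he

lemma SmoothFormOn.coeff_mdiff (hU : IsOpen U) {η : FormField n M} (hη : SmoothFormOn η U) {x : M}
    (hx : x ∈ U) (p : ℕ) (I : Fin p → Fin n) :
    MDifferentiableAt (𝓡 n) 𝓘(ℝ, ℂ) (coeff e η p I) x :=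
  mdiffAt_of_contMDiffOn hU ((smoothFormOn_iff_coeff he hU).mp hη p I) hx

lemma SmoothFormOn.coeffDeriv (hU : IsOpen U) {X : VField n M} (hX : SmoothFieldOn X U)
    {η : FormField n M} (hη : SmoothFormOn η U) :
    SmoothFormOn (fun y => coeffDeriv e η y (X y)) U := by
  rw [smoothFormOn_iff_coeff he hU]
  intro p I
  exact (contMDiffOn_mvfderiv hU ((smoothFormOn_iff_coeff he hU).mp hη p I) hX).congr
    fun y hy => coeffDeriv_apply he hU hη hy _ p I

section Rules

variable (hU : IsOpen U) {η ξ : FormField n M} (hη : SmoothFormOn η U) (hξ : SmoothFormOn ξ U)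
  {x : M} (hx : x ∈ U) (v : TangentSpace (𝓡 n) x)
include hU hη hx

omit hη in
lemma coeffDeriv_add (hη : SmoothFormOn η U) (hξ : SmoothFormOn ξ U) :
    coeffDeriv e (fun y => η y + ξ y) x v = coeffDeriv e η x v + coeffDeriv e ξ x v := by
  refine ext_frame he hx fun p I => ?_
  rw [coeffDeriv_apply he hU (hη.add hξ) hx v p I]
  change _ = coeffDeriv e η x v p _ + coeffDeriv e ξ x v p _
  rw [coeffDeriv_apply he hU hη hx v p I, coeffDeriv_apply he hU hξ hx v p I]
  have := mvfderiv_fun_add (hη.coeff_mdiff he hU hx p I) (hξ.coeff_mdiff he hU hx p I)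
  exact congr($this v)

lemma coeffDeriv_fsmul {g : M → ℂ} (hg : ContMDiffOn (𝓡 n) 𝓘(ℝ, ℂ) ∞ g U) :
    coeffDeriv e (fun y => g y • η y) x v
      = g x • coeffDeriv e η x v + mvfderiv (𝓡 n) g x v • η x := by
  refine ext_frame he hx fun p I => ?_
  rw [coeffDeriv_apply he hU (hη.fsmul hg) hx v p I]
  change _ = g x * coeffDeriv e η x v p _ + mvfderiv (𝓡 n) g x v * coeff e η p I x
  rw [coeffDeriv_apply he hU hη hx v p I]
  exact mvfderiv_mul_apply (mdiffAt_of_contMDiffOn hU hg hx) (hη.coeff_mdiff he hU hx p I) v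

lemma coeffDeriv_smul (c : ℂ) :
    coeffDeriv e (fun y => c • η y) x v = c • coeffDeriv e η x v := by
  refine ext_frame he hx fun p I => ?_
  rw [coeffDeriv_apply he hU (hη.smul c) hx v p I]
  change _ = c * coeffDeriv e η x v p _
  rw [coeffDeriv_apply he hU hη hx v p I]
  exact mvfderiv_const_mul c (hη.coeff_mdiff he hU hx p I) v

lemma coeffDeriv_degScale (s : ℕ → ℂ) :
    coeffDeriv e (fun y => degScale s (η y)) x v = degScale s (coeffDeriv e η x v) := by
  refine ext_frame he hx fun p I => ?_
  rw [coeffDeriv_apply he hU (hη.degScale s) hx v p I]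
  change _ = s p * coeffDeriv e η x v p _
  rw [coeffDeriv_apply he hU hη hx v p I]
  exact mvfderiv_const_mul (s p) (hη.coeff_mdiff he hU hx p I) v

/-- Contraction with e_j only relabels coefficient functions, so it commutes with differentiating
them. Exterior multiplication by e_j likewise has constant matrix entries in the frame, by
orthonormality. -/
lemma coeffDeriv_intMul (j : Fin n) :
    coeffDeriv e (fun y => intMul (e j y) (η y)) x v = intMul (e j x) (coeffDeriv e η x v) := by
  refine ext_frame he hx fun p I => ?_
  have h : ∀ y, (Matrix.vecCons (e j y) fun a => e (I a) y)
      = fun a => e (Matrix.vecCons j I a) y := fun y => by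
    funext a
    refine Fin.cases rfl (fun _ => rfl) a
  rw [coeffDeriv_apply he hU (hη.intMul (he.smooth j)) hx v p I, intMul_apply, h x,
    coeffDeriv_apply he hU hη hx v (p + 1) _]
  congr 2
  funext y
  change η y (p + 1) (Matrix.vecCons (e j y) fun a => e (I a) y) = _
  rw [h y]
  rfl

lemma coeffDeriv_extMul (j : Fin n) :
    coeffDeriv e (fun y => extMul (e j y) (η y)) x v = extMul (e j x) (coeffDeriv e η x v) := by
  refine ext_frame he hx fun p I => ?_
  rw [coeffDeriv_apply he hU (hη.extMul (he.smooth j)) hx v p I]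
  cases p with
  | zero =>
    have : coeff e (fun y => extMul (e j y) (η y)) 0 I = fun _ => 0 := rfl
    rw [this, mvfderiv_const]
    rfl
  | succ q =>
    have hin : ∀ y ∈ U, ∀ i, inner ℝ (e j y) (e i y) = if j = i then (1 : ℝ) else 0 := fun y hy i =>
      orthonormal_iff_ite.mp (he.orthonormal y hy) j i
    rw [extMul_apply_succ, mvfderiv_congr (g' := fun y => ∑ i : Fin (q + 1), ((-1 : ℂ) ^ (i : ℕ) *
        ((if j = I i then (1 : ℝ) else 0 : ℝ) : ℂ)) * coeff e η q (i.removeNth I) y) hU ?_ hx,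
      mvfderiv_sum_apply]
    · refine Finset.sum_congr rfl fun i _ => ?_
      rw [mvfderiv_const_mul _ (hη.coeff_mdiff he hU hx q _), hin x hx, mul_assoc,
        ← coeffDeriv_apply he hU hη hx v q]
      rfl
    · intro i _
      have h0 := hη.coeff_mdiff he hU hx q (i.removeNth I)
      exact mdifferentiableAt_const.mul h0
    · intro y hy
      change extMul (e j y) (η y) (q + 1) _ = _
      rw [extMul_apply_succ]
      refine Finset.sum_congr rfl fun i _ => ?_
      rw [hin y hy, mul_assoc]
      rfl

end Rules

end Leibniz

/-! ### Smooth vector fields and Lie brackets -/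

section VectorFields

variable {n : ℕ} {M : Type*} [TopologicalSpace M] [ChartedSpace (EuclideanSpace ℝ (Fin n)) M]
  [IsManifold (𝓡 n) ∞ M] {U : Set M} {X Y Z : VField n M}

lemma isManifold_minSmoothness : IsManifold (𝓡 n) (minSmoothness ℝ 3) M :=
  IsManifold.of_le (n := ∞) (by
    rw [minSmoothness_of_isRCLikeNormedField]
    exact WithTop.coe_le_coe.mpr (le_top (a := (3 : ℕ∞))))

attribute [local instance] isManifold_minSmoothness

lemma SmoothFieldOn.congr (hX : SmoothFieldOn X U) (h : ∀ y ∈ U, Y y = X y) : SmoothFieldOn Y U :=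
  ContMDiffOn.congr hX fun y hy => by rw [h y hy]

lemma SmoothFieldOn.add (hX : SmoothFieldOn X U) (hY : SmoothFieldOn Y U) :
    SmoothFieldOn (X + Y) U := ContMDiffOn.add_section hX hY

lemma SmoothFieldOn.sub (hX : SmoothFieldOn X U) (hY : SmoothFieldOn Y U) :
    SmoothFieldOn (X - Y) U := ContMDiffOn.sub_section hX hY

lemma SmoothFieldOn.smul {g : M → ℝ} (hg : ContMDiffOn (𝓡 n) 𝓘(ℝ, ℝ) ∞ g U)
    (hX : SmoothFieldOn X U) : SmoothFieldOn (g • X) U := ContMDiffOn.smul_section hg hX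

lemma SmoothFieldOn.sum {ι : Type*} (s : Finset ι) {X : ι → VField n M}
    (hX : ∀ i ∈ s, SmoothFieldOn (X i) U) : SmoothFieldOn (fun y => ∑ i ∈ s, X i y) U :=
  ContMDiffOn.sum_section hX

lemma SmoothFieldOn.mdiff (hU : IsOpen U) (hX : SmoothFieldOn X U) {x : M} (hx : x ∈ U) :
    MDifferentiableAt (𝓡 n) (𝓡 n).tangent (fun y => (⟨y, X y⟩ : TangentBundle (𝓡 n) M)) x :=
  (ContMDiffOn.contMDiffAt hX (hU.mem_nhds hx)).mdifferentiableAt (by simp)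

lemma SmoothFieldOn.mlieBracket (hU : IsOpen U) (hX : SmoothFieldOn X U) (hY : SmoothFieldOn Y U) :
    SmoothFieldOn (VectorField.mlieBracket (𝓡 n) X Y) U := fun x hx =>
  have : IsManifold (𝓡 n) (((⊤ : ℕ∞) : WithTop ℕ∞) + 1) M := ‹IsManifold (𝓡 n) ∞ M›
  (ContMDiffAt.mlieBracket_vectorField (n := (⊤ : ℕ∞)) (m := (⊤ : ℕ∞))
    (ContMDiffOn.contMDiffAt hX (hU.mem_nhds hx)) (ContMDiffOn.contMDiffAt hY (hU.mem_nhds hx))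
    (by simp [minSmoothness_of_isRCLikeNormedField])).contMDiffWithinAt

omit [IsManifold (𝓡 n) ∞ M] in
lemma mlieBracket_congr {X' Y' : VField n M} (hU : IsOpen U) (hX : ∀ y ∈ U, X y = X' y)
    (hY : ∀ y ∈ U, Y y = Y' y) {x : M} (hx : x ∈ U) :
    VectorField.mlieBracket (𝓡 n) X Y x = VectorField.mlieBracket (𝓡 n) X' Y' x := by
  rw [← VectorField.mlieBracketWithin_univ, ← VectorField.mlieBracketWithin_univ]
  exact Filter.EventuallyEq.mlieBracketWithin_vectorField_eq_nhds
    (Filter.eventuallyEq_of_mem (hU.mem_nhds hx) hX)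
    (Filter.eventuallyEq_of_mem (hU.mem_nhds hx) hY)

lemma jacobi_mlieBracket (hU : IsOpen U) (hX : SmoothFieldOn X U) (hY : SmoothFieldOn Y U)
    (hZ : SmoothFieldOn Z U) {x : M} (hx : x ∈ U) :
    VectorField.mlieBracket (𝓡 n) X (VectorField.mlieBracket (𝓡 n) Y Z) x =
      VectorField.mlieBracket (𝓡 n) (VectorField.mlieBracket (𝓡 n) X Y) Z x
        + VectorField.mlieBracket (𝓡 n) Y (VectorField.mlieBracket (𝓡 n) X Z) x := by
  have h : minSmoothness ℝ 2 ≤ ∞ := by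
    rw [minSmoothness_of_isRCLikeNormedField]; exact WithTop.coe_le_coe.mpr (le_top (a := (2 : ℕ∞)))
  exact VectorField.leibniz_identity_mlieBracket_apply
    ((ContMDiffOn.contMDiffAt hX (hU.mem_nhds hx)).of_le h)
    ((ContMDiffOn.contMDiffAt hY (hU.mem_nhds hx)).of_le h)
    ((ContMDiffOn.contMDiffAt hZ (hU.mem_nhds hx)).of_le h)

/-- The bracket of vector fields is the commutator of derivations, deduced from the Jacobi
identity for `X`, `Y` and `g • Z`. -/
lemma mvfderiv_mlieBracket_smul {g : M → ℝ} (hU : IsOpen U)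
    (hg : ContMDiffOn (𝓡 n) 𝓘(ℝ, ℝ) ∞ g U)
    (hX : SmoothFieldOn X U) (hY : SmoothFieldOn Y U) (hZ : SmoothFieldOn Z U) {x : M}
    (hx : x ∈ U) :
    (mvfderiv (𝓡 n) (fun y => mvfderiv (𝓡 n) g y (Y y)) x (X x)
      - mvfderiv (𝓡 n) (fun y => mvfderiv (𝓡 n) g y (X y)) x (Y x)
      - mvfderiv (𝓡 n) g x (VectorField.mlieBracket (𝓡 n) X Y x)) • Z x = 0 := by
  have key : ∀ {X Y : VField n M}, SmoothFieldOn X U → SmoothFieldOn Y U →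
      VectorField.mlieBracket (𝓡 n) X (VectorField.mlieBracket (𝓡 n) Y (g • Z)) x =
        mvfderiv (𝓡 n) (fun y => mvfderiv (𝓡 n) g y (Y y)) x (X x) • Z x
        + mvfderiv (𝓡 n) g x (Y x) • VectorField.mlieBracket (𝓡 n) X Z x
        + (mvfderiv (𝓡 n) g x (X x) • VectorField.mlieBracket (𝓡 n) Y Z x
        + g x • VectorField.mlieBracket (𝓡 n) X (VectorField.mlieBracket (𝓡 n) Y Z) x) := by
    intro X Y hX hY
    have hYg : ContMDiffOn (𝓡 n) 𝓘(ℝ, ℝ) ∞ (fun y => mvfderiv (𝓡 n) g y (Y y)) U :=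
      contMDiffOn_mvfderiv hU hg hY
    have hYZ := hY.mlieBracket hU hZ
    rw [mlieBracket_congr (X' := X) (Y' := (fun y => mvfderiv (𝓡 n) g y (Y y)) • Z +
      g • VectorField.mlieBracket (𝓡 n) Y Z) hU (fun _ _ => rfl) (fun y hy =>
        VectorField.mlieBracket_smul_right (mdiffAt_of_contMDiffOn hU hg hy) (hZ.mdiff hU hy)) hx,
      VectorField.mlieBracket_add_right ((hZ.smul hYg).mdiff hU hx) ((hYZ.smul hg).mdiff hU hx),
      VectorField.mlieBracket_smul_right (mdiffAt_of_contMDiffOn hU hYg hx) (hZ.mdiff hU hx),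
      VectorField.mlieBracket_smul_right (mdiffAt_of_contMDiffOn hU hg hx) (hYZ.mdiff hU hx)]
  -- From the Jacobi identity for X, Y, gZ subtract g times the one for X, Y, Z. The terms (Yg)[X,
  -- Z] and (Xg)[Y, Z] are symmetric under exchange of X and Y and cancel, leaving only second
  -- derivatives of g and the derivative along [X, Y].
  have h := jacobi_mlieBracket hU hX hY (hZ.smul hg) hx
  rw [key hX hY, key hY hX, jacobi_mlieBracket hU hX hY hZ hx,
    VectorField.mlieBracket_smul_right (mdiffAt_of_contMDiffOn hU hg hx) (hZ.mdiff hU hx)] at h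
  rw [sub_smul, sub_smul, ← sub_eq_zero.mpr h, smul_add]
  abel

end VectorFields


/-! ### Christoffel symbols and symmetries of the curvature tensor -/

section LeviCivita

variable {n : ℕ} {M : Type*} [TopologicalSpace M] [ChartedSpace (EuclideanSpace ℝ (Fin n)) M]
  [IsManifold (𝓡 n) ∞ M] [RiemannianBundle (fun x : M => TangentSpace (𝓡 n) x)]
  {U : Set M} {D : Connection n M} {X Y Z : VField n M} {e : Fin n → VField n M} {x : M}

omit [RiemannianBundle (fun x : M => TangentSpace (𝓡 n) x)] in
lemma conn_congr (hU : IsOpen U) (hX : SmoothFieldOn X U) (h : ∀ y ∈ U, Y y = X y) (hx : x ∈ U) :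
    D Y x = D X x :=
  D.isCovariantDerivativeOn.congr_of_eventuallyEq (s := Set.univ) ((hX.congr h).mdiff hU hx)
    (hX.mdiff hU hx) Filter.univ_mem (Filter.eventually_of_mem (hU.mem_nhds hx) h)

omit [RiemannianBundle (fun x : M => TangentSpace (𝓡 n) x)] in
lemma conn_add (hU : IsOpen U) (hX : SmoothFieldOn X U) (hY : SmoothFieldOn Y U) (hx : x ∈ U)
    (v : TangentSpace (𝓡 n) x) : D (X + Y) x v = D X x v + D Y x v :=
  congr($(D.isCovariantDerivativeOn.add (s := Set.univ) (hX.mdiff hU hx) (hY.mdiff hU hx)) v)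

omit [RiemannianBundle (fun x : M => TangentSpace (𝓡 n) x)] in
lemma conn_smul (hU : IsOpen U) {g : M → ℝ} (hg : ContMDiffOn (𝓡 n) 𝓘(ℝ, ℝ) ∞ g U)
    (hX : SmoothFieldOn X U) (hx : x ∈ U) (v : TangentSpace (𝓡 n) x) :
    D (g • X) x v = g x • D X x v + mvfderiv (𝓡 n) g x v • X x :=
  congr($(D.isCovariantDerivativeOn.leibniz (s := Set.univ) (hX.mdiff hU hx)
    (mdiffAt_of_contMDiffOn hU hg hx)) v)

omit [RiemannianBundle (fun x : M => TangentSpace (𝓡 n) x)] in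
lemma conn_sub (hU : IsOpen U) (hX : SmoothFieldOn X U) (hY : SmoothFieldOn Y U) (hx : x ∈ U)
    (v : TangentSpace (𝓡 n) x) : D (X - Y) x v = D X x v - D Y x v := by
  have h := conn_add (D := D) hU (hX.sub hY) hY hx v
  rw [sub_add_cancel] at h
  rw [h, add_sub_cancel_right]

omit [RiemannianBundle (fun x : M => TangentSpace (𝓡 n) x)] in
lemma conn_sum (hU : IsOpen U) {ι : Type*} (s : Finset ι) {X : ι → VField n M}
    (hX : ∀ i ∈ s, SmoothFieldOn (X i) U) (hx : x ∈ U) (v : TangentSpace (𝓡 n) x) :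
    D (fun y => ∑ i ∈ s, X i y) x v = ∑ i ∈ s, D (X i) x v := by
  classical
  induction s using Finset.induction_on with
  | empty =>
    have : D (fun y => ∑ i ∈ (∅ : Finset ι), X i y) = D 0 := congrArg D (funext fun y => by simp)
    rw [this, CovariantDerivative.zero]
    rfl
  | insert a s ha ih =>
    rw [Finset.sum_insert ha, ← ih fun i hi => hX i (by simp [hi]),
      ← conn_add hU (hX a (by simp)) (SmoothFieldOn.sum s fun i hi => hX i (by simp [hi])) hx]
    congr 2
    funext y
    simp [Finset.sum_insert ha]

variable [IsContMDiffRiemannianBundle (𝓡 n) ∞ (EuclideanSpace ℝ (Fin n))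
      (fun x : M => TangentSpace (𝓡 n) x)]

lemma conn_torsion (hD : IsLeviCivita D) (hU : IsOpen U) (hX : SmoothFieldOn X U)
    (hY : SmoothFieldOn Y U) (hx : x ∈ U) :
    D Y x (X x) - D X x (Y x) = VectorField.mlieBracket (𝓡 n) X Y x :=
  (D.torsion_eq_zero_iff.mp hD.2) (hX.mdiff hU hx) (hY.mdiff hU hx)

lemma conn_metric (hD : IsLeviCivita D) (hU : IsOpen U) (hX : SmoothFieldOn X U)
    (hY : SmoothFieldOn Y U) (hx : x ∈ U) (v : TangentSpace (𝓡 n) x) :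
    mvfderiv (𝓡 n) (fun y => inner ℝ (X y) (Y y)) x v
      = inner ℝ (D X x v) (Y x) + inner ℝ (X x) (D Y x v) := by
  classical
  -- Metric compatibility is applied along a vector field. Any extension of v will do, since only
  -- its value at x enters.
  have := hD.1.mvfderiv_inner_eq (fun y => if h : y = x then h ▸ v else 0) (hX.mdiff hU hx)
    (hY.mdiff hU hx)
  simpa using this

/-- The Christoffel symbols `⟨∇_{e_i} e_j, e_k⟩`. -/
noncomputable def chris (D : Connection n M) (e : Fin n → VField n M) (i j k : Fin n) (x : M) : ℝ :=
  inner ℝ (D (e j) x (e i x)) (e k x)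

variable (he : IsOrthonormalFrameOn e U)
include he

omit [IsContMDiffRiemannianBundle (𝓡 n) ∞ (EuclideanSpace ℝ (Fin n))
      (fun x : M => TangentSpace (𝓡 n) x)] in
lemma frame_expand (hx : x ∈ U) (v : TangentSpace (𝓡 n) x) :
    v = ∑ k, inner ℝ v (e k x) • e k x := by
  have := (he.basis hx).sum_repr' v
  simp only [he.basis_apply] at this
  conv_lhs => rw [← this]
  simp only [real_inner_comm]

omit [IsContMDiffRiemannianBundle (𝓡 n) ∞ (EuclideanSpace ℝ (Fin n))
      (fun x : M => TangentSpace (𝓡 n) x)] in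
lemma conn_frame (hx : x ∈ U) (i j : Fin n) :
    D (e j) x (e i x) = ∑ k, chris D e i j k x • e k x := frame_expand he hx _

omit [IsContMDiffRiemannianBundle (𝓡 n) ∞ (EuclideanSpace ℝ (Fin n))
      (fun x : M => TangentSpace (𝓡 n) x)] in
lemma inner_frame (hx : x ∈ U) (i j : Fin n) :
    inner ℝ (e i x) (e j x) = if i = j then (1 : ℝ) else 0 :=
  orthonormal_iff_ite.mp (he.orthonormal x hx) i j

/-- The function ⟨e_j, e_k⟩ is constant on U, so its derivative in the metric compatibility relation
is zero. -/
lemma chris_antisymm (hD : IsLeviCivita D) (hU : IsOpen U) (hx : x ∈ U) (i j k : Fin n) :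
    chris D e i j k x = -chris D e i k j x := by
  have h := conn_metric hD hU (he.smooth j) (he.smooth k) hx (e i x)
  rw [mvfderiv_congr (g' := fun _ => if j = k then (1 : ℝ) else 0) hU
    (fun y hy => inner_frame he hy j k) hx, mvfderiv_const, real_inner_comm _ (e j x)] at h
  exact eq_neg_of_add_eq_zero_left h.symm

/-- The components of the brackets of the frame. -/
lemma inner_mlieBracket (hD : IsLeviCivita D) (hU : IsOpen U) (hx : x ∈ U) (i j k : Fin n) :
    inner ℝ (VectorField.mlieBracket (𝓡 n) (e i) (e j) x) (e k x)
      = chris D e i j k x - chris D e j i k x := by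
  rw [← conn_torsion hD hU (he.smooth i) (he.smooth j) hx, inner_sub_left]
  rfl

lemma mlieBracket_frame (hD : IsLeviCivita D) (hU : IsOpen U) (hx : x ∈ U) (i j : Fin n) :
    VectorField.mlieBracket (𝓡 n) (e i) (e j) x
      = ∑ k, (chris D e i j k x - chris D e j i k x) • e k x := by
  conv_lhs => rw [frame_expand he hx (VectorField.mlieBracket (𝓡 n) (e i) (e j) x)]
  simp only [inner_mlieBracket he hD hU hx]

/-- Smoothness of the Christoffel symbols, by Koszul's formula. -/
lemma chris_smooth (hD : IsLeviCivita D) (hU : IsOpen U) (i j k : Fin n) :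
    ContMDiffOn (𝓡 n) 𝓘(ℝ, ℝ) ∞ (chris D e i j k) U := by
  have h : ∀ i j k, ContMDiffOn (𝓡 n) 𝓘(ℝ, ℝ) ∞ (fun y =>
      inner ℝ (VectorField.mlieBracket (𝓡 n) (e i) (e j) y) (e k y)) U := fun i j k =>
    smooth_inner ((he.smooth i).mlieBracket hU (he.smooth j)) (he.smooth k)
  refine (ContMDiffOn.smul (contMDiffOn_const (c := (1 / 2 : ℝ)) (I' := 𝓘(ℝ, ℝ)) (I := 𝓡 n))
    (((h i j k).sub (h j k i)).add (h k i j))).congr fun y hy => ?_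
  change chris D e i j k y =
    1 / 2 * (inner ℝ (VectorField.mlieBracket (𝓡 n) (e i) (e j) y) (e k y)
      - inner ℝ (VectorField.mlieBracket (𝓡 n) (e j) (e k) y) (e i y)
      + inner ℝ (VectorField.mlieBracket (𝓡 n) (e k) (e i) y) (e j y))
  simp only [inner_mlieBracket he hD hU hy]
  -- Of the six Christoffel symbols in Koszul's expression, antisymmetry cancels four and identifies
  -- the remaining two.
  rw [chris_antisymm he hD hU hy k j i, chris_antisymm he hD hU hy j k i,
    chris_antisymm he hD hU hy i k j]
  ring

lemma conn_frame_smooth (hD : IsLeviCivita D) (hU : IsOpen U) (i j : Fin n) :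
    SmoothFieldOn (fun y => D (e j) y (e i y)) U :=
  (SmoothFieldOn.sum Finset.univ fun k _ =>
    (he.smooth k).smul (chris_smooth he hD hU i j k)).congr fun _ hy => conn_frame he hy i j

/-- The curvature in terms of Christoffel symbols. -/
lemma Rm_eq (hD : IsLeviCivita D) (hU : IsOpen U) (hx : x ∈ U) (i j k l : Fin n) :
    Rm D e x i j k l = mvfderiv (𝓡 n) (chris D e j k l) x (e i x)
      - mvfderiv (𝓡 n) (chris D e i k l) x (e j x)
      + ∑ m, (chris D e j k m x * chris D e i m l x - chris D e i k m x * chris D e j m l x)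
      - ∑ m, (chris D e i j m x - chris D e j i m x) * chris D e m k l x := by
  have h1 : ∀ i j, inner ℝ (D (fun y => D (e k) y (e j y)) x (e i x)) (e l x)
      = mvfderiv (𝓡 n) (chris D e j k l) x (e i x)
        + ∑ m, chris D e j k m x * chris D e i m l x := by
    intro i j
    rw [conn_congr (X := fun y => ∑ m, (chris D e j k m • e m) y) hU
      (SmoothFieldOn.sum Finset.univ fun m _ => (he.smooth m).smul (chris_smooth he hD hU j k m))
      (fun _ hy => conn_frame he hy j k) hx, conn_sum hU _
      (fun m _ => (he.smooth m).smul (chris_smooth he hD hU j k m)) hx, sum_inner]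
    have : ∀ m, inner ℝ (D (chris D e j k m • e m) x (e i x)) (e l x)
        = chris D e j k m x * chris D e i m l x
          + mvfderiv (𝓡 n) (chris D e j k m) x (e i x) * if m = l then 1 else 0 := fun m => by
      rw [conn_smul hU (chris_smooth he hD hU j k m) (he.smooth m) hx, inner_add_left,
        real_inner_smul_left, real_inner_smul_left, inner_frame he hx]
      rfl
    simp only [this, Finset.sum_add_distrib]
    simp [add_comm]
  rw [Rm, curvature, inner_sub_left, inner_sub_left, h1, h1, mlieBracket_frame he hD hU hx, map_sum,
    sum_inner, Finset.sum_sub_distrib]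
  simp only [map_smul, real_inner_smul_left]
  simp only [chris]
  ring

lemma Rm_swap_left (hD : IsLeviCivita D) (hU : IsOpen U) (hx : x ∈ U) (i j k l : Fin n) :
    Rm D e x j i k l = -Rm D e x i j k l := by
  rw [Rm_eq he hD hU hx, Rm_eq he hD hU hx]
  have h : ∑ m, (chris D e j i m x - chris D e i j m x) * chris D e m k l x
      = -∑ m, (chris D e i j m x - chris D e j i m x) * chris D e m k l x := by
    rw [← Finset.sum_neg_distrib]
    exact Finset.sum_congr rfl fun m _ => by ring
  rw [h]
  simp only [Finset.sum_sub_distrib]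
  ring

lemma Rm_swap_right (hD : IsLeviCivita D) (hU : IsOpen U) (hx : x ∈ U) (i j k l : Fin n) :
    Rm D e x i j l k = -Rm D e x i j k l := by
  rw [Rm_eq he hD hU hx, Rm_eq he hD hU hx]
  have h : ∀ i j, mvfderiv (𝓡 n) (chris D e j l k) x (e i x)
      = -mvfderiv (𝓡 n) (chris D e j k l) x (e i x) := fun i j => by
    rw [mvfderiv_congr (g' := fun y => -chris D e j k l y) hU
      (fun y hy => chris_antisymm he hD hU hy j l k) hx]
    exact congr($(mvfderiv_fun_neg) _)
  have h2 : ∑ m, (chris D e j l m x * chris D e i m k x - chris D e i l m x * chris D e j m k x)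
      = -∑ m, (chris D e j k m x * chris D e i m l x - chris D e i k m x * chris D e j m l x) := by
    rw [← Finset.sum_neg_distrib]
    refine Finset.sum_congr rfl fun m _ => ?_
    rw [chris_antisymm he hD hU hx j l m, chris_antisymm he hD hU hx i m k,
      chris_antisymm he hD hU hx i l m, chris_antisymm he hD hU hx j m k]
    ring
  have h3 : ∑ m, (chris D e i j m x - chris D e j i m x) * chris D e m l k x
      = -∑ m, (chris D e i j m x - chris D e j i m x) * chris D e m k l x := by
    rw [← Finset.sum_neg_distrib]
    refine Finset.sum_congr rfl fun m _ => ?_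
    rw [chris_antisymm he hD hU hx m l k]
    ring
  rw [h i j, h j i, h2, h3]
  ring

/-- The first Bianchi identity. -/
lemma Rm_bianchi (hD : IsLeviCivita D) (hU : IsOpen U) (hx : x ∈ U) (i j k l : Fin n) :
    Rm D e x i j k l + Rm D e x j k i l + Rm D e x k i j l = 0 := by
  -- Vanishing torsion, used twice, rewrites second covariant derivatives as iterated brackets. The
  -- Bianchi identity thereby becomes the Jacobi identity.
  have key : ∀ a b c : Fin n,
      D (fun y => D (e c) y (e b y)) x (e a x) - D (fun y => D (e b) y (e c y)) x (e a x)
        - D (e a) x (VectorField.mlieBracket (𝓡 n) (e b) (e c) x)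
        = VectorField.mlieBracket (𝓡 n) (e a) (VectorField.mlieBracket (𝓡 n) (e b) (e c)) x := by
    intro a b c
    have hbr := (he.smooth b).mlieBracket hU (he.smooth c)
    rw [← conn_torsion hD hU (he.smooth a) hbr hx, ← conn_sub hU (conn_frame_smooth he hD hU b c)
      (conn_frame_smooth he hD hU c b) hx, conn_congr (Y := (fun y => D (e c) y (e b y)) - fun y => D (e b) y (e c y)) hU hbr
      (fun y hy => conn_torsion hD hU (he.smooth b) (he.smooth c) hy) hx]
  have h := jacobi_mlieBracket hU (he.smooth i) (he.smooth j) (he.smooth k) hx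
  have h1 : VectorField.mlieBracket (𝓡 n) (VectorField.mlieBracket (𝓡 n) (e i) (e j)) (e k) x
      = -VectorField.mlieBracket (𝓡 n) (e k) (VectorField.mlieBracket (𝓡 n) (e i) (e j)) x :=
    VectorField.mlieBracket_swap_apply
  have h2 : VectorField.mlieBracket (𝓡 n) (e j) (VectorField.mlieBracket (𝓡 n) (e i) (e k)) x
      = -VectorField.mlieBracket (𝓡 n) (e j) (VectorField.mlieBracket (𝓡 n) (e k) (e i)) x := by
    rw [← key j i k, ← key j k i, VectorField.mlieBracket_swap_apply (V := e i), map_neg]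
    abel
  rw [h1, h2, ← key, ← key, ← key] at h
  simp only [Rm, ← inner_add_left]
  rw [show curvature D (e i) (e j) (e k) x + curvature D (e j) (e k) (e i) x
      + curvature D (e k) (e i) (e j) x = 0 by
    simp only [curvature]
    rw [← sub_eq_zero] at h
    rw [← h]
    abel, inner_zero_left]

/-- The classical combination of four Bianchi identities, one for each cyclic shift of the indices,
with the antisymmetry in either pair. -/
lemma Rm_pair_symm (hD : IsLeviCivita D) (hU : IsOpen U) (hx : x ∈ U) (i j k l : Fin n) :
    Rm D e x i j k l = Rm D e x k l i j := by
  have b := Rm_bianchi he hD hU hx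
  have s := Rm_swap_left he hD hU hx
  have t := Rm_swap_right he hD hU hx
  linarith [b i j k l, b j k l i, b k l i j, b l i j k, s i j k l, s j k i l, s k i j l, s i l j k,
    s j l k i, t i j k l, t j k i l, t k i j l, t l i j k, t k l i j, t i l j k, t j l i k,
    t i k j l, t j l k i, t i k l j, t l j k i, s j l i k, s i k j l, s l i j k, s l i k j, s k j l i,
    s k l i j, s j k l i, t j k l i, t k j l i, t k l j i, t l i k j]

end LeviCivita


/-! ### Squares and products of abstract Dirac operators -/

section Bochner

variable {A : Type*} [Ring A] [Algebra ℂ A] {n : ℕ}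

/-- Only the diagonal of the symmetric part of T survives, because c_i c_j + c_j c_i = -2δ_{ij}.
Applied to T_{ij} = N_i N_j it separates the Laplacian from the curvature. -/
lemma sum_clifford_swap {c : Fin n → A} (hc : ∀ i j, c i * c j + c j * c i = if i = j then -2 else 0)
    (T : Fin n → Fin n → A) :
    ∑ i, ∑ j, c i * c j * T i j
      = (1 / 2 : ℂ) • ∑ i, ∑ j, c i * c j * (T i j - T j i) - ∑ i, T i i := by
  have h1 : ∑ i, ∑ j, c i * c j * T j i = ∑ i, ∑ j, (if i = j then -2 else 0) * T i j
      - ∑ i, ∑ j, c i * c j * T i j := by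
    rw [Finset.sum_comm, ← Finset.sum_sub_distrib]
    refine Finset.sum_congr rfl fun j _ => ?_
    rw [← Finset.sum_sub_distrib]
    refine Finset.sum_congr rfl fun i _ => ?_
    rw [← hc j i]
    noncomm_ring
  have h2 : ∑ i, ∑ j, (if i = j then (-2 : A) else 0) * T i j = -((2 : ℂ) • ∑ i, T i i) := by
    simp only [ite_mul, zero_mul, Finset.sum_ite_eq, Finset.mem_univ, if_true]
    rw [← Finset.mul_sum, two_smul]
    noncomm_ring
  simp only [mul_sub, Finset.sum_sub_distrib, h1, h2]
  module

/-- The Bochner formula for the square of a Dirac operator `∑ c_i N_i`, where the `N_i` are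
covariant derivatives along a frame with Christoffel symbols `g`. -/
theorem dirac_sq {c N : Fin n → A} {g : Fin n → Fin n → Fin n → A} {Q : Fin n → Fin n → A}
    (hc : ∀ i j, c i * c j + c j * c i = if i = j then -2 else 0)
    (hN : ∀ i j, N i * c j = c j * N i + ∑ k, g i j k * c k)
    (hg : ∀ i j k, g i j k = -g i k j) (hgc : ∀ i j k l, g i j k * c l = c l * g i j k)
    (hQ : ∀ i j, N i * N j - N j * N i = ∑ k, (g i j k - g j i k) * N k + Q i j) :
    (∑ i, c i * N i) * (∑ i, c i * N i)
      = -∑ i, N i * N i + ∑ i, ∑ k, g i i k * N k + (1 / 2 : ℂ) • ∑ i, ∑ j, c i * c j * Q i j := by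
  -- Moving N_i past c_j costs a Christoffel term. Relabelling its indices gives both sums the same
  -- Clifford factor c_i c_j.
  have h1 : (∑ i, c i * N i) * (∑ i, c i * N i)
      = ∑ i, ∑ j, c i * c j * (N i * N j) + ∑ i, ∑ j, c i * c j * ∑ k, g i k j * N k := by
    rw [Finset.sum_mul_sum, ← Finset.sum_add_distrib]
    refine Finset.sum_congr rfl fun i _ => ?_
    have : ∑ j, c i * c j * ∑ k, g i k j * N k = ∑ j, c i * (∑ k, g i j k * c k) * N j := by
      simp only [Finset.mul_sum, Finset.sum_mul]
      rw [Finset.sum_comm]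
      refine Finset.sum_congr rfl fun j _ => Finset.sum_congr rfl fun k _ => ?_
      rw [hgc, ← mul_assoc, ← mul_assoc, mul_assoc (c i) (c k)]
    rw [this, ← Finset.sum_add_distrib]
    refine Finset.sum_congr rfl fun j _ => ?_
    rw [show c i * N i * (c j * N j) = c i * (N i * c j) * N j by noncomm_ring, hN]
    noncomm_ring
  rw [h1, sum_clifford_swap hc fun i j => N i * N j, sum_clifford_swap hc fun i j => ∑ k, g i k j * N k]
  -- Antisymmetry of g in its last two indices turns the bracket term of the commutator into the
  -- negative of T_{ij} - T_{ji} for T_{ij} = ∑ g_{ikj} N_k. It therefore cancels the antisymmetric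
  -- part of the second sum, and only Q is left.
  have h2 : ∀ i j, N i * N j - N j * N i
      = Q i j - (∑ k, g i k j * N k - ∑ k, g j k i * N k) := by
    intro i j
    rw [hQ, ← Finset.sum_sub_distrib, add_comm, sub_eq_add_neg (Q i j), ← Finset.sum_neg_distrib]
    congr 1
    refine Finset.sum_congr rfl fun k _ => ?_
    rw [hg i j k, hg j i k]
    noncomm_ring
  have h3 : ∑ i, ∑ k, g i i k * N k = - ∑ i, ∑ k, g i k i * N k := by
    simp only [← Finset.sum_neg_distrib]
    refine Finset.sum_congr rfl fun i _ => Finset.sum_congr rfl fun k _ => ?_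
    rw [hg i i k]
    noncomm_ring
  have h4 : ∑ i, ∑ j, c i * c j * (N i * N j - N j * N i) = ∑ i, ∑ j, c i * c j * Q i j
      - ∑ i, ∑ j, c i * c j * (∑ k, g i k j * N k - ∑ k, g j k i * N k) := by
    simp only [h2, mul_sub, Finset.sum_sub_distrib]
  rw [h3, h4, smul_sub]
  abel

/-- The Bochner formula for a product of two perturbations of a Dirac operator by multiples of `a`,
in terms of the connection `N_j - ω_j / 2`. -/
theorem perturbed_dirac_mul {c N h : Fin n → A} {a Δ : A} (s t : ℂ)
    (hcN : ∑ j, N j * c j = ∑ j, c j * N j + ∑ k, h k * c k)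
    (hha : ∀ k, h k * a = a * h k)
    (hsq : (∑ i, c i * N i) * (∑ i, c i * N i) = -∑ i, N i * N i + ∑ k, h k * N k + Δ)
    {w : Fin n → A} (hw : ∀ j, w j = t • (c j * a) + s • (a * c j)) :
    (∑ i, c i * N i + s • a) * (∑ i, c i * N i + t • a)
      = -∑ j, (N j - (1 / 2 : ℂ) • w j) * (N j - (1 / 2 : ℂ) • w j)
        + ∑ k, h k * (N k - (1 / 2 : ℂ) • w k) + Δ
        + (1 / 4 : ℂ) • ∑ j, w j * w j
        + (1 / 2 : ℂ) • ∑ j, (t • (c j * (N j * a - a * N j)) - s • ((N j * a - a * N j) * c j))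
        + (s * t) • (a * a) := by
  have e1 : (∑ j, N j * c j) * a = (∑ j, c j * N j) * a + (∑ k, h k * c k) * a := by
    rw [hcN, add_mul]
  have e2 : a * (∑ j, N j * c j) = a * (∑ j, c j * N j) + a * (∑ k, h k * c k) := by
    rw [hcN, mul_add]
  -- The square is expanded with N_j kept to the left of c_j, so that the relation `hcN` for ∑ N_j
  -- c_j can be substituted at the end.
  have e3 : ∑ j, (N j - (1 / 2 : ℂ) • w j) * (N j - (1 / 2 : ℂ) • w j)
      = ∑ j, N j * N j - (1 / 2 : ℂ) • (t • ((∑ j, N j * c j) * a) + s • ∑ j, N j * (a * c j)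
        + t • (∑ j, c j * a * N j) + s • (a * ∑ j, c j * N j)) + (1 / 4 : ℂ) • ∑ j, w j * w j := by
    simp only [Finset.sum_mul, Finset.mul_sum, Finset.smul_sum, ← Finset.sum_add_distrib,
      ← Finset.sum_sub_distrib]
    refine Finset.sum_congr rfl fun j _ => ?_
    have : N j * w j + w j * N j = t • (N j * c j * a) + s • (N j * (a * c j))
        + t • (c j * a * N j) + s • (a * (c j * N j)) := by
      rw [hw]
      simp only [mul_add, add_mul, mul_smul_comm, smul_mul_assoc, mul_assoc]
      abel
    rw [← this]
    simp only [mul_sub, sub_mul, mul_smul_comm, smul_mul_assoc]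
    module
  have e4 : ∑ k, h k * (N k - (1 / 2 : ℂ) • w k) = ∑ k, h k * N k
      - (1 / 2 : ℂ) • (t • ((∑ k, h k * c k) * a) + s • (a * ∑ k, h k * c k)) := by
    simp only [Finset.sum_mul, Finset.mul_sum, Finset.smul_sum, ← Finset.sum_add_distrib,
      ← Finset.sum_sub_distrib]
    refine Finset.sum_congr rfl fun k _ => ?_
    rw [hw, ← mul_assoc a, ← hha]
    simp only [mul_sub, mul_add, mul_smul_comm, mul_assoc]
  have e5 : ∑ j, (t • (c j * (N j * a - a * N j)) - s • ((N j * a - a * N j) * c j))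
      = t • ((∑ j, c j * N j) * a) - t • (∑ j, c j * a * N j) - s • (∑ j, N j * (a * c j))
        + s • (a * ∑ j, N j * c j) := by
    simp only [Finset.sum_mul, Finset.mul_sum, Finset.smul_sum, ← Finset.sum_add_distrib,
      ← Finset.sum_sub_distrib]
    refine Finset.sum_congr rfl fun j _ => ?_
    simp only [mul_sub, sub_mul, mul_assoc, smul_sub]
    abel
  have e6 : (∑ i, c i * N i + s • a) * (∑ i, c i * N i + t • a)
      = (∑ i, c i * N i) * (∑ i, c i * N i) + t • ((∑ i, c i * N i) * a)
        + s • (a * ∑ i, c i * N i) + (s * t) • (a * a) := by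
    simp only [mul_add, add_mul, mul_smul_comm, smul_mul_assoc]
    module
  -- After this substitution both sides are linear combinations of the same noncommutative words.
  rw [e6, e3, e4, e5, e1, e2, hsq]
  module

end Bochner

/-! ### Clifford contractions of the curvature tensor -/

section Lichnerowicz

variable {A : Type*} [Ring A] [Algebra ℂ A] {n : ℕ} {R : Fin n → Fin n → Fin n → Fin n → ℂ}

/-- By Bianchi, the sums with c_i c_j c_k permuted cyclically add up to zero. Reordering each word
to c_i c_j c_k costs Ricci terms 4S and 2S, where S = ∑ R_{ijjl} c_i. With T for the sum in
question, 3T + 6S = 0. -/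
lemma sum_curvature_cubic {c : Fin n → A}
    (hc : ∀ i j, c i * c j + c j * c i = if i = j then -2 else 0)
    (hR : ∀ i j k l, R j i k l = -R i j k l)
    (hB : ∀ i j k l, R i j k l + R j k i l + R k i j l = 0) (l : Fin n) :
    ∑ i, ∑ j, ∑ k, R i j k l • (c i * c j * c k) = -((2 : ℂ) • ∑ i, ∑ j, R i j j l • c i) := by
  have d : ∀ i j : Fin n, (if i = j then (-2 : A) else 0) = (if i = j then (-2 : ℂ) else 0) • (1 : A) := by
    intro i j
    split_ifs
    · rw [neg_smul, two_smul]; norm_num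
    · rw [zero_smul]
  have e1 : ∀ i j k, c k * c i * c j = c i * c j * c k + (if i = k then (-2 : ℂ) else 0) • c j
      - (if j = k then (-2 : ℂ) else 0) • c i := by
    intro i j k
    have h1 := hc i k
    have h2 := hc j k
    rw [d] at h1 h2
    have h1' := congr($h1 * c j)
    have h2' := congr(c i * $h2)
    simp only [smul_mul_assoc, one_mul, mul_smul_comm, mul_one] at h1' h2'
    rw [← h1', ← h2']
    noncomm_ring
  have e2 : ∀ i j k, c j * c k * c i = c i * c j * c k + (if i = k then (-2 : ℂ) else 0) • c j
      - (if i = j then (-2 : ℂ) else 0) • c k := by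
    intro i j k
    have h1 := hc i k
    have h2 := hc i j
    rw [d] at h1 h2
    have h1' := congr(c j * $h1)
    have h2' := congr($h2 * c k)
    simp only [smul_mul_assoc, one_mul, mul_smul_comm, mul_one] at h1' h2'
    rw [← h1', ← h2']
    noncomm_ring
  have r1 : ∑ i, ∑ j, ∑ k, R j k i l • (c i * c j * c k)
      = ∑ i, ∑ j, ∑ k, R i j k l • (c k * c i * c j) := by
    rw [Finset.sum_comm]
    refine Finset.sum_congr rfl fun i _ => ?_
    rw [Finset.sum_comm]
  have r2 : ∑ i, ∑ j, ∑ k, R k i j l • (c i * c j * c k)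
      = ∑ i, ∑ j, ∑ k, R i j k l • (c j * c k * c i) := by
    calc _ = ∑ i, ∑ k, ∑ j, R k i j l • (c i * c j * c k) :=
          Finset.sum_congr rfl fun i _ => Finset.sum_comm
      _ = _ := Finset.sum_comm
  have h0 : ∑ i, ∑ j, ∑ k, R i j k l • (c i * c j * c k)
      + ∑ i, ∑ j, ∑ k, R i j k l • (c k * c i * c j)
      + ∑ i, ∑ j, ∑ k, R i j k l • (c j * c k * c i) = 0 := by
    rw [← r1, ← r2]
    simp only [← Finset.sum_add_distrib, ← add_smul, hB, zero_smul, Finset.sum_const_zero]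
  have s1 : ∑ i, ∑ j, ∑ k, R i j k l • ((if i = k then (-2 : ℂ) else 0) • c j)
      = (2 : ℂ) • ∑ i, ∑ j, R i j j l • c i := by
    rw [Finset.sum_comm, Finset.smul_sum]
    refine Finset.sum_congr rfl fun j _ => ?_
    rw [Finset.smul_sum]
    refine Finset.sum_congr rfl fun i _ => ?_
    simp only [ite_smul, zero_smul, smul_ite, smul_zero, Finset.sum_ite_eq, Finset.mem_univ, if_true]
    rw [hR j i, smul_smul, smul_smul]
    congr 1; ring
  have s2 : ∑ i, ∑ j, ∑ k, R i j k l • ((if j = k then (-2 : ℂ) else 0) • c i)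
      = -((2 : ℂ) • ∑ i, ∑ j, R i j j l • c i) := by
    simp only [ite_smul, zero_smul, smul_ite, smul_zero, Finset.sum_ite_eq, Finset.mem_univ, if_true,
      Finset.smul_sum, ← Finset.sum_neg_distrib]
    refine Finset.sum_congr rfl fun i _ => Finset.sum_congr rfl fun j _ => ?_
    module
  have hii : ∀ i k, R i i k l = 0 := fun i k => self_eq_neg.mp (hR i i k l)
  have s3 : ∑ i, ∑ j, ∑ k, R i j k l • ((if i = j then (-2 : ℂ) else 0) • c k) = 0 := by
    refine Finset.sum_eq_zero fun i _ => Finset.sum_eq_zero fun j _ => Finset.sum_eq_zero fun k _ => ?_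
    split_ifs with h
    · rw [h, hii, zero_smul]
    · rw [zero_smul, smul_zero]
  have t1 : ∑ i, ∑ j, ∑ k, R i j k l • (c k * c i * c j)
      = ∑ i, ∑ j, ∑ k, R i j k l • (c i * c j * c k) + (4 : ℂ) • ∑ i, ∑ j, R i j j l • c i := by
    rw [Finset.sum_congr rfl fun i _ => Finset.sum_congr rfl fun j _ => Finset.sum_congr rfl
      fun k _ => by rw [e1 i j k, smul_sub, smul_add]]
    simp only [Finset.sum_add_distrib, Finset.sum_sub_distrib, s1, s2]
    module
  have t2 : ∑ i, ∑ j, ∑ k, R i j k l • (c j * c k * c i)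
      = ∑ i, ∑ j, ∑ k, R i j k l • (c i * c j * c k) + (2 : ℂ) • ∑ i, ∑ j, R i j j l • c i := by
    rw [Finset.sum_congr rfl fun i _ => Finset.sum_congr rfl fun j _ => Finset.sum_congr rfl
      fun k _ => by rw [e2 i j k, smul_sub, smul_add]]
    simp only [Finset.sum_add_distrib, Finset.sum_sub_distrib, s1, s3]
    module
  rw [t1, t2] at h0
  set T := ∑ i, ∑ j, ∑ k, R i j k l • (c i * c j * c k)
  set S := ∑ i, ∑ j, R i j j l • c i
  have : (3 : ℂ) • (T + (2 : ℂ) • S) = 0 := by rw [← h0]; module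
  exact eq_neg_of_add_eq_zero_left ((smul_eq_zero.mp this).resolve_left (by norm_num))

/-- Three of the four Clifford factors contract to -2 Ric by the cubic identity. Since Ric is
symmetric, only the diagonal c_i c_i = -1 contributes, giving twice its trace. -/
lemma sum_curvature_quartic {c : Fin n → A}
    (hc : ∀ i j, c i * c j + c j * c i = if i = j then -2 else 0)
    (hR : ∀ i j k l, R j i k l = -R i j k l) (hR' : ∀ i j k l, R i j l k = -R i j k l)
    (hB : ∀ i j k l, R i j k l + R j k i l + R k i j l = 0)
    (hP : ∀ i j k l, R i j k l = R k l i j) :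
    ∑ i, ∑ j, ∑ k, ∑ l, R i j k l • (c i * c j * c k * c l)
      = ((2 : ℂ) * ∑ i, ∑ j, R i j j i) • (1 : A) := by
  have h1 : ∑ i, ∑ j, ∑ k, ∑ l, R i j k l • (c i * c j * c k * c l)
      = ∑ l, (∑ i, ∑ j, ∑ k, R i j k l • (c i * c j * c k)) * c l := by
    simp only [Finset.sum_mul, smul_mul_assoc]
    calc _ = ∑ i, ∑ j, ∑ l, ∑ k, R i j k l • (c i * c j * c k * c l) :=
          Finset.sum_congr rfl fun i _ => Finset.sum_congr rfl fun j _ => Finset.sum_comm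
      _ = ∑ i, ∑ l, ∑ j, ∑ k, R i j k l • (c i * c j * c k * c l) :=
          Finset.sum_congr rfl fun i _ => Finset.sum_comm
      _ = _ := Finset.sum_comm
  have hRic : ∀ i l j, R i j j l = R l j j i := fun i l j => by
    rw [hP, hR, hR', neg_neg]
  have h2 : ∑ l, (∑ i, ∑ j, R i j j l • c i) * c l
      = ∑ i, ∑ l, c i * c l * ((∑ j, R i j j l) • (1 : A)) := by
    rw [Finset.sum_comm]
    refine Finset.sum_congr rfl fun l _ => ?_
    simp only [← Finset.sum_smul, Finset.sum_mul, smul_mul_assoc, mul_smul_comm, mul_one]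
  have h0 : ∑ l, (∑ i, ∑ j, ∑ k, R i j k l • (c i * c j * c k)) * c l
      = -((2 : ℂ) • ∑ l, (∑ i, ∑ j, R i j j l • c i) * c l) := by
    rw [Finset.smul_sum, ← Finset.sum_neg_distrib]
    refine Finset.sum_congr rfl fun l _ => ?_
    rw [sum_curvature_cubic hc hR hB, neg_mul, smul_mul_assoc]
  rw [h1, h0, h2, sum_clifford_swap hc fun i l => (∑ j, R i j j l) • (1 : A)]
  have h3 : ∑ i, ∑ l, c i * c l * ((∑ j, R i j j l) • (1 : A) - (∑ j, R l j j i) • (1 : A)) = 0 := by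
    refine Finset.sum_eq_zero fun i _ => Finset.sum_eq_zero fun l _ => ?_
    rw [Finset.sum_congr rfl fun j _ => hRic i l j, sub_self, mul_zero]
  rw [h3, ← Finset.sum_smul]
  module

omit [Algebra ℂ A] in
lemma CAR.cl_anticomm {ε ι : Fin n → A} (h : CAR ε ι) (i j : Fin n) :
    (ε i - ι i) * (ε j - ι j) + (ε j - ι j) * (ε i - ι i) = if i = j then (-2 : A) else 0 := by
  simp only [sub_mul, mul_sub, h.cre_cre i j, h.ann_ann i j, h.ann_cre]
  by_cases hij : i = j
  · subst hij; simp only [if_true]; rw [← one_add_one_eq_two]; noncomm_ring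
  · simp only [hij, Ne.symm hij, if_false]; noncomm_ring

/-- The curvature term of the Weitzenböck formula. -/
theorem weitzenboeck_curvature {ε ι : Fin n → A} (h : CAR ε ι)
    (hR : ∀ i j k l, R j i k l = -R i j k l) (hR' : ∀ i j k l, R i j l k = -R i j k l)
    (hB : ∀ i j k l, R i j k l + R j k i l + R k i j l = 0)
    (hP : ∀ i j k l, R i j k l = R k l i j) :
    (1 / 2 : ℂ) • ∑ i, ∑ j, (ε i - ι i) * (ε j - ι j) * (∑ k, ∑ l, R i j k l • (ε l * ι k))
      = -((1 / 8 : ℂ) • ∑ i, ∑ j, ∑ k, ∑ l, R i j k l •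
          ((ε i + ι i) * (ε j + ι j) * (ε k - ι k) * (ε l - ι l)))
        + ((1 / 4 : ℂ) * ∑ i, ∑ j, R i j j i) • (1 : A) := by
  have : IsAddTorsionFree A := by
    have : Module ℚ A := Module.compHom A (algebraMap ℚ ℂ)
    exact IsAddTorsionFree.of_module_rat A
  have hc := h.cl_anticomm
  -- For k ≠ l, c_k c_l - ĉ_k ĉ_l = 2(ε_l ι_k - ε_k ι_l), and antisymmetry of R in k, l makes the
  -- two terms contribute equally. Hence the factor ¼; the diagonal drops out.
  have s1 : ∀ i j, ∑ k, ∑ l, R i j k l • (ε l * ι k) = (1 / 4 : ℂ) • ∑ k, ∑ l, R i j k l •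
      ((ε k - ι k) * (ε l - ι l) - (ε k + ι k) * (ε l + ι l)) := by
    intro i j
    have a1 : ∑ k, ∑ l, R i j k l • (ε k * ι l) = -∑ k, ∑ l, R i j k l • (ε l * ι k) := by
      rw [Finset.sum_comm]
      simp only [← Finset.sum_neg_distrib]
      refine Finset.sum_congr rfl fun k _ => Finset.sum_congr rfl fun l _ => ?_
      rw [hR' i j k l]
      module
    have hkk : ∀ k, R i j k k = 0 := fun k => self_eq_neg.mp (hR' i j k k)
    have a2 : ∀ k l, R i j k l • ((ε k - ι k) * (ε l - ι l) - (ε k + ι k) * (ε l + ι l))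
        = (2 : ℂ) • R i j k l • (ε l * ι k) - (2 : ℂ) • R i j k l • (ε k * ι l) := by
      intro k l
      by_cases hkl : k = l
      · rw [hkl, hkk]; module
      · have : (ε k - ι k) * (ε l - ι l) - (ε k + ι k) * (ε l + ι l)
            = (2 : ℂ) • (ε l * ι k) - (2 : ℂ) • (ε k * ι l) := by
          simp only [sub_mul, mul_sub, add_mul, mul_add, h.ann_cre_of_ne hkl]
          module
        rw [this]; module
    simp only [a2, Finset.sum_sub_distrib, ← Finset.smul_sum, a1]
    module
  have hcomm : ∀ i j k l, (ε i - ι i) * (ε j - ι j) * ((ε k + ι k) * (ε l + ι l))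
      = (ε k + ι k) * (ε l + ι l) * (ε i - ι i) * (ε j - ι j) := by
    intro i j k l
    have c1 : ∀ i k l, Commute (ε i - ι i) ((ε k + ι k) * (ε l + ι l)) := fun i k l => by
      change _ * _ = _ * _
      rw [← mul_assoc, h.cl_hat_anticomm i k, neg_mul, mul_assoc, h.cl_hat_anticomm i l, mul_neg,
        neg_neg, mul_assoc]
    rw [((c1 i k l).mul_left (c1 j k l)).eq, mul_assoc _ (ε i - ι i)]
  -- The even products c_i c_j and ĉ_k ĉ_l commute, and pair symmetry of R then allows (i, j) and
  -- (k, l) to be exchanged.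
  have s2 : ∑ i, ∑ j, ∑ k, ∑ l, R i j k l • ((ε i - ι i) * (ε j - ι j) * ((ε k + ι k) * (ε l + ι l)))
      = ∑ i, ∑ j, ∑ k, ∑ l, R i j k l •
          ((ε i + ι i) * (ε j + ι j) * (ε k - ι k) * (ε l - ι l)) := by
    simp only [hcomm]
    calc _ = ∑ i, ∑ k, ∑ j, ∑ l, R i j k l •
          ((ε k + ι k) * (ε l + ι l) * (ε i - ι i) * (ε j - ι j)) :=
          Finset.sum_congr rfl fun i _ => Finset.sum_comm
      _ = ∑ k, ∑ i, ∑ j, ∑ l, R i j k l •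
          ((ε k + ι k) * (ε l + ι l) * (ε i - ι i) * (ε j - ι j)) := Finset.sum_comm
      _ = ∑ k, ∑ i, ∑ l, ∑ j, R i j k l •
          ((ε k + ι k) * (ε l + ι l) * (ε i - ι i) * (ε j - ι j)) :=
          Finset.sum_congr rfl fun i _ => Finset.sum_congr rfl fun k _ => Finset.sum_comm
      _ = ∑ k, ∑ l, ∑ i, ∑ j, R i j k l •
          ((ε k + ι k) * (ε l + ι l) * (ε i - ι i) * (ε j - ι j)) :=
          Finset.sum_congr rfl fun i _ => Finset.sum_comm
      _ = _ := by
          refine Finset.sum_congr rfl fun k _ => Finset.sum_congr rfl fun l _ =>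
            Finset.sum_congr rfl fun i _ => Finset.sum_congr rfl fun j _ => ?_
          rw [hP]
  have s3 := sum_curvature_quartic hc hR hR' hB hP
  have gen : ∀ (x : A) (i j : Fin n) (y z : Fin n → Fin n → A),
      x * ((1 / 4 : ℂ) • ∑ k, ∑ l, R i j k l • (y k l - z k l))
        = (1 / 4 : ℂ) • ∑ k, ∑ l, R i j k l • (x * y k l)
          - (1 / 4 : ℂ) • ∑ k, ∑ l, R i j k l • (x * z k l) := by
    intro x i j y z
    simp only [mul_smul_comm, Finset.mul_sum, mul_sub, smul_sub, Finset.sum_sub_distrib]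
  have s4 : ∑ i, ∑ j, (ε i - ι i) * (ε j - ι j) * (∑ k, ∑ l, R i j k l • (ε l * ι k))
      = (1 / 4 : ℂ) • ∑ i, ∑ j, ∑ k, ∑ l, R i j k l •
          ((ε i - ι i) * (ε j - ι j) * ((ε k - ι k) * (ε l - ι l)))
        - (1 / 4 : ℂ) • ∑ i, ∑ j, ∑ k, ∑ l, R i j k l •
          ((ε i - ι i) * (ε j - ι j) * ((ε k + ι k) * (ε l + ι l))) := by
    rw [Finset.smul_sum, Finset.smul_sum, ← Finset.sum_sub_distrib]
    refine Finset.sum_congr rfl fun i _ => ?_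
    rw [Finset.smul_sum, Finset.smul_sum, ← Finset.sum_sub_distrib]
    refine Finset.sum_congr rfl fun j _ => ?_
    rw [s1, gen]
  rw [s4, s2]
  simp only [← mul_assoc] at s3 ⊢
  rw [s3]
  module

end Lichnerowicz


/-! ### Matrices acting on forms as derivations -/

section Bilinear

variable {n : ℕ}

/-- The operator `∑ g_{kl} ε_k ι_l`. -/
noncomputable def bilin {A : Type*} [Ring A] [Algebra ℂ A] (ε ι : Fin n → A)
    (g : Fin n → Fin n → ℝ) : A := ∑ k, ∑ l, (g k l : ℂ) • (ε k * ι l)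

variable {A : Type*} [Ring A] [Algebra ℂ A] {ε ι : Fin n → A} (g h : Fin n → Fin n → ℝ)

lemma bilin_add : bilin ε ι (g + h) = bilin ε ι g + bilin ε ι h := by
  simp only [bilin, ← Finset.sum_add_distrib, ← add_smul]
  simp

lemma bilin_smul (a : ℝ) : bilin ε ι (a • g) = (a : ℂ) • bilin ε ι g := by
  simp only [bilin, Finset.smul_sum, smul_smul]
  simp

lemma bilin_neg : bilin ε ι (-g) = -bilin ε ι g := by
  have := bilin_smul (ε := ε) (ι := ι) g (-1)
  simpa using this

lemma bilin_sub : bilin ε ι (g - h) = bilin ε ι g - bilin ε ι h := by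
  rw [sub_eq_add_neg, bilin_add, bilin_neg, sub_eq_add_neg]

lemma bilin_sum {κ : Type*} (s : Finset κ) (g : κ → Fin n → Fin n → ℝ) :
    bilin ε ι (∑ i ∈ s, g i) = ∑ i ∈ s, bilin ε ι (g i) := by
  classical
  induction s using Finset.induction_on with
  | empty => simp [bilin]
  | insert a s ha ih => rw [Finset.sum_insert ha, Finset.sum_insert ha, bilin_add, ih]

lemma bilin_cre (hC : CAR ε ι) (i : Fin n) :
    bilin ε ι g * ε i = ε i * bilin ε ι g + ∑ k, (g k i : ℂ) • ε k := by
  have : ∀ k l, ε k * ι l * ε i = ε i * (ε k * ι l) + if l = i then ε k else 0 := fun k l => by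
    rw [mul_assoc, hC.ann_cre, mul_sub, ← mul_assoc, hC.cre_cre k i]
    split_ifs <;> noncomm_ring
  simp only [bilin, Finset.sum_mul, Finset.mul_sum, smul_mul_assoc, mul_smul_comm, this, smul_add,
    Finset.sum_add_distrib, smul_ite, smul_zero, Finset.sum_ite_eq', Finset.mem_univ, if_true]

lemma bilin_ann (hC : CAR ε ι) (i : Fin n) :
    bilin ε ι g * ι i = ι i * bilin ε ι g - ∑ l, (g i l : ℂ) • ι l := by
  have : ∀ k l, ε k * ι l * ι i = ι i * (ε k * ι l) - if i = k then ι l else 0 := fun k l => by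
    rw [mul_assoc, hC.ann_ann l i, ← mul_assoc (ι i), hC.ann_cre]
    split_ifs <;> noncomm_ring
  simp only [bilin, Finset.sum_mul, Finset.mul_sum, smul_mul_assoc, mul_smul_comm, this, smul_sub,
    Finset.sum_sub_distrib, smul_ite, smul_zero]
  congr 1
  rw [Finset.sum_comm]
  simp

/-- Matrices act as a Lie algebra: both products have the same term with two creations followed by
two annihilations. It cancels, and the contractions give the matrix commutator. -/
lemma bilin_comm (hC : CAR ε ι) :
    bilin ε ι g * bilin ε ι h - bilin ε ι h * bilin ε ι g
      = bilin ε ι (fun k l => ∑ m, (g k m * h m l - h k m * g m l)) := by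
  have e1 : bilin ε ι g * bilin ε ι h = ∑ p, ∑ q, (h p q : ℂ) • (ε p * bilin ε ι g * ι q)
      + bilin ε ι fun k l => ∑ m, g k m * h m l := by
    have : ∀ p q, bilin ε ι g * (ε p * ι q) = ε p * bilin ε ι g * ι q
        + ∑ k, (g k p : ℂ) • (ε k * ι q) := fun p q => by
      rw [← mul_assoc, bilin_cre g hC, add_mul, Finset.sum_mul]
      simp only [smul_mul_assoc]
    conv_lhs => rw [bilin.eq_def ε ι h]
    simp only [Finset.mul_sum, mul_smul_comm, this, smul_add, Finset.sum_add_distrib]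
    congr 1
    simp only [Finset.smul_sum, smul_smul]
    rw [bilin]
    calc _ = ∑ q, ∑ p, ∑ k, ((h p q : ℂ) * (g k p : ℂ)) • (ε k * ι q) := Finset.sum_comm
      _ = ∑ q, ∑ k, ∑ p, ((h p q : ℂ) * (g k p : ℂ)) • (ε k * ι q) :=
        Finset.sum_congr rfl fun q _ => Finset.sum_comm
      _ = ∑ k, ∑ q, ∑ p, ((h p q : ℂ) * (g k p : ℂ)) • (ε k * ι q) := Finset.sum_comm
      _ = _ := by
        refine Finset.sum_congr rfl fun k _ => Finset.sum_congr rfl fun q _ => ?_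
        rw [← Finset.sum_smul]
        push_cast
        simp only [mul_comm]
  have e2 : bilin ε ι h * bilin ε ι g = ∑ p, ∑ q, (h p q : ℂ) • (ε p * bilin ε ι g * ι q)
      + bilin ε ι fun k l => ∑ m, h k m * g m l := by
    have : ∀ p q, ε p * ι q * bilin ε ι g = ε p * bilin ε ι g * ι q
        + ∑ l, (g q l : ℂ) • (ε p * ι l) := fun p q => by
      rw [mul_assoc, mul_assoc, bilin_ann g hC, mul_sub, Finset.mul_sum]
      simp only [mul_smul_comm]
      abel
    conv_lhs => rw [bilin.eq_def ε ι h]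
    simp only [Finset.sum_mul, smul_mul_assoc, this, smul_add, Finset.sum_add_distrib]
    congr 1
    simp only [Finset.smul_sum, smul_smul]
    rw [bilin]
    refine Finset.sum_congr rfl fun k _ => ?_
    rw [Finset.sum_comm]
    refine Finset.sum_congr rfl fun q _ => ?_
    rw [← Finset.sum_smul]
    push_cast
    rfl
  rw [e1, e2, add_sub_add_left_eq_sub, ← bilin_sub]
  congr 1
  funext k l
  simp [Finset.sum_sub_distrib]

end Bilinear

/-! ### Commutators of covariant derivatives of forms -/

section Commutator

variable {n : ℕ} {M : Type*} [TopologicalSpace M] [ChartedSpace (EuclideanSpace ℝ (Fin n)) M]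
  [IsManifold (𝓡 n) ∞ M] {U : Set M} {x : M}

/-- The vector valued identity `mvfderiv_mlieBracket_smul` with Z = X, which is why X must not
vanish at x. Real and imaginary parts of g are treated separately. -/
lemma mvfderiv_mlieBracket {g : M → ℂ} {X Y : VField n M} (hU : IsOpen U)
    (hg : ContMDiffOn (𝓡 n) 𝓘(ℝ, ℂ) ∞ g U) (hX : SmoothFieldOn X U) (hY : SmoothFieldOn Y U)
    (hx : x ∈ U) (hX0 : X x ≠ 0) :
    mvfderiv (𝓡 n) (fun y => mvfderiv (𝓡 n) g y (Y y)) x (X x)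
      - mvfderiv (𝓡 n) (fun y => mvfderiv (𝓡 n) g y (X y)) x (Y x)
      = mvfderiv (𝓡 n) g x (VectorField.mlieBracket (𝓡 n) X Y x) := by
  have key : ∀ L : ℂ →L[ℝ] ℝ, L (mvfderiv (𝓡 n) (fun y => mvfderiv (𝓡 n) g y (Y y)) x (X x)
      - mvfderiv (𝓡 n) (fun y => mvfderiv (𝓡 n) g y (X y)) x (Y x))
      = L (mvfderiv (𝓡 n) g x (VectorField.mlieBracket (𝓡 n) X Y x)) := by
    intro L
    have hLg : ContMDiffOn (𝓡 n) 𝓘(ℝ, ℝ) ∞ (fun y => L (g y)) U :=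
      L.contMDiff.comp_contMDiffOn hg
    have h := (smul_eq_zero.mp (mvfderiv_mlieBracket_smul hU hLg hX hY hX hx)).resolve_right hX0
    have h2 : ∀ {X Y : VField n M}, SmoothFieldOn X U → SmoothFieldOn Y U →
        mvfderiv (𝓡 n) (fun y => mvfderiv (𝓡 n) (fun z => L (g z)) y (Y y)) x (X x)
          = L (mvfderiv (𝓡 n) (fun y => mvfderiv (𝓡 n) g y (Y y)) x (X x)) := by
      intro X Y hX hY
      rw [mvfderiv_congr (g' := fun y => L (mvfderiv (𝓡 n) g y (Y y))) hU
        (fun y hy => mvfderiv_clm_comp L (mdiffAt_of_contMDiffOn hU hg hy) (Y y)) hx,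
        mvfderiv_clm_comp L (mdiffAt_of_contMDiffOn hU (contMDiffOn_mvfderiv hU hg hY) hx)]
    rw [h2 hX hY, h2 hY hX, mvfderiv_clm_comp L (mdiffAt_of_contMDiffOn hU hg hx)] at h
    rw [map_sub]
    exact sub_eq_zero.mp h
  exact Complex.ext (key Complex.reCLM) (key Complex.imCLM)

variable [RiemannianBundle (fun x : M => TangentSpace (𝓡 n) x)]
  [IsContMDiffRiemannianBundle (𝓡 n) ∞ (EuclideanSpace ℝ (Fin n))
      (fun x : M => TangentSpace (𝓡 n) x)]
  {D : Connection n M} {e : Fin n → VField n M}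

/-- The operator `∑ g_{kl} ε(e_k) ι(e_l)` at a point. -/
noncomputable abbrev bilinAt (e : Fin n → VField n M) (x : M) (g : Fin n → Fin n → ℝ) :
    Module.End ℂ (Forms (TangentSpace (𝓡 n) x)) :=
  bilin (fun k => extMul (e k x)) (fun k => intMul (e k x)) g

omit [IsManifold (𝓡 n) ∞ M] [IsContMDiffRiemannianBundle (𝓡 n) ∞ (EuclideanSpace ℝ (Fin n))
      (fun x : M => TangentSpace (𝓡 n) x)] in
lemma bilinAt_apply (g : Fin n → Fin n → ℝ) (ζ : Forms (TangentSpace (𝓡 n) x)) :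
    bilinAt e x g ζ = ∑ k, ∑ l, (g k l : ℂ) • extMul (e k x) (intMul (e l x) ζ) := by
  refine (LinearMap.sum_apply _ _ _).trans (Finset.sum_congr rfl fun k _ => ?_)
  exact LinearMap.sum_apply _ _ _

omit [IsManifold (𝓡 n) ∞ M] [IsContMDiffRiemannianBundle (𝓡 n) ∞ (EuclideanSpace ℝ (Fin n))
      (fun x : M => TangentSpace (𝓡 n) x)] in
lemma coeffDeriv_sum_right (η : FormField n M) (a : Fin n → ℝ) :
    coeffDeriv e η x (∑ k, a k • e k x) = ∑ k, (a k : ℂ) • coeffDeriv e η x (e k x) := by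
  refine (map_sum (AddMonoidHom.mk' (coeffDeriv e η x) (coeffDeriv_add_right η x)) _ _).trans ?_
  exact Finset.sum_congr rfl fun k _ => coeffDeriv_smul_right η x _ _

variable (he : IsOrthonormalFrameOn e U)
include he

omit [IsContMDiffRiemannianBundle (𝓡 n) ∞ (EuclideanSpace ℝ (Fin n))
      (fun x : M => TangentSpace (𝓡 n) x)] in
lemma car_frame (hx : x ∈ U) : CAR (A := Module.End ℂ (Forms (TangentSpace (𝓡 n) x)))
    (fun i => extMul (e i x)) (fun i => intMul (e i x)) := by
  have := car_basis (he.basis hx)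
  simpa only [he.basis_apply] using this

omit [IsContMDiffRiemannianBundle (𝓡 n) ∞ (EuclideanSpace ℝ (Fin n))
      (fun x : M => TangentSpace (𝓡 n) x)] in
-- Expanding ∇e_j in the frame: the connection is the coefficientwise derivative plus its connection
-- matrix, which is -Γ on forms.
lemma nabla_eq (η : FormField n M) (hx : x ∈ U) (i : Fin n) :
    nabla D e η x (e i x) = coeffDeriv e η x (e i x)
      + bilinAt e x (fun j k => -chris D e i j k x) (η x) := by
  rw [nabla, sub_eq_add_neg, bilinAt_apply, ← Finset.sum_neg_distrib]
  congr 1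
  refine Finset.sum_congr rfl fun j _ => ?_
  rw [conn_frame he hx, intMul_sum, map_sum, ← Finset.sum_neg_distrib]
  refine Finset.sum_congr rfl fun k _ => ?_
  rw [map_smul]
  ext p u
  change -((_ : ℂ) * (_ : ℂ)) = _ * _
  push_cast
  ring

section
variable (hU : IsOpen U) {η : FormField n M} (hη : SmoothFormOn η U)
include hU hη

omit hU in
lemma SmoothFormOn.bilinAt {g : Fin n → Fin n → M → ℝ}
    (hg : ∀ k l, ContMDiffOn (𝓡 n) 𝓘(ℝ, ℝ) ∞ (g k l) U) :
    SmoothFormOn (fun y => bilinAt e y (fun k l => g k l y) (η y)) U := by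
  simp only [bilinAt_apply]
  exact SmoothFormOn.sum _ fun k _ => SmoothFormOn.sum _ fun l _ =>
    SmoothFormOn.fsmul (g := fun y => (g k l y : ℂ))
      (Complex.ofRealCLM.contMDiff.comp_contMDiffOn (hg k l))
      ((hη.intMul (he.smooth l)).extMul (he.smooth k))

variable (hx : x ∈ U)
include hx

omit hη in
lemma coeffDeriv_sum {κ : Type*} (s : Finset κ) {η : κ → FormField n M}
    (hη : ∀ i ∈ s, SmoothFormOn (η i) U) (v : TangentSpace (𝓡 n) x) :
    coeffDeriv e (fun y => ∑ i ∈ s, η i y) x v = ∑ i ∈ s, coeffDeriv e (η i) x v := by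
  classical
  induction s using Finset.induction_on with
  | empty =>
    simp only [Finset.sum_empty]
    refine ext_frame he hx fun p I => ?_
    rw [coeffDeriv_apply he hU SmoothFormOn.zero hx]
    exact congr($(mvfderiv_const (0 : ℂ)) v)
  | insert a s ha ih =>
    simp only [Finset.sum_insert ha]
    rw [coeffDeriv_add he hU hx v (hη a (by simp))
      (SmoothFormOn.sum _ fun i hi => hη i (by simp [hi])), ih fun i hi => hη i (by simp [hi])]

lemma coeffDeriv_bilinAt {g : Fin n → Fin n → M → ℝ}
    (hg : ∀ k l, ContMDiffOn (𝓡 n) 𝓘(ℝ, ℝ) ∞ (g k l) U) (v : TangentSpace (𝓡 n) x) :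
    coeffDeriv e (fun y => bilinAt e y (fun k l => g k l y) (η y)) x v
      = bilinAt e x (fun k l => g k l x) (coeffDeriv e η x v)
        + bilinAt e x (fun k l => mvfderiv (𝓡 n) (g k l) x v) (η x) := by
  have hgc : ∀ k l, ContMDiffOn (𝓡 n) 𝓘(ℝ, ℂ) ∞ (fun y => (g k l y : ℂ)) U := fun k l =>
    Complex.ofRealCLM.contMDiff.comp_contMDiffOn (hg k l)
  have hει : ∀ k l, SmoothFormOn (fun y => extMul (e k y) (intMul (e l y) (η y))) U := fun k l =>
    (hη.intMul (he.smooth l)).extMul (he.smooth k)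
  simp only [bilinAt_apply]
  rw [coeffDeriv_sum he hU hx _ fun k _ => SmoothFormOn.sum _ fun l _ => (hει k l).fsmul (hgc k l),
    ← Finset.sum_add_distrib]
  refine Finset.sum_congr rfl fun k _ => ?_
  rw [coeffDeriv_sum he hU hx _ fun l _ => (hει k l).fsmul (hgc k l), ← Finset.sum_add_distrib]
  refine Finset.sum_congr rfl fun l _ => ?_
  rw [coeffDeriv_fsmul he hU (hει k l) hx v (hgc k l),
    coeffDeriv_extMul he hU (hη.intMul (he.smooth l)) hx v, coeffDeriv_intMul he hU hη hx v]
  congr 2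
  exact mvfderiv_clm_comp Complex.ofRealCLM (mdiffAt_of_contMDiffOn hU (hg k l) hx) v

lemma coeffDeriv_comm (i j : Fin n) :
    coeffDeriv e (fun y => coeffDeriv e η y (e j y)) x (e i x)
      - coeffDeriv e (fun y => coeffDeriv e η y (e i y)) x (e j x)
      = coeffDeriv e η x (VectorField.mlieBracket (𝓡 n) (e i) (e j) x) := by
  refine ext_frame he hx fun p I => ?_
  have hc := (smoothFormOn_iff_coeff he hU).mp hη p I
  have h0 : e i x ≠ 0 := (he.orthonormal x hx).ne_zero i
  change coeffDeriv e _ x (e i x) p _ - coeffDeriv e _ x (e j x) p _ = _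
  rw [coeffDeriv_apply he hU hη hx, ← mvfderiv_mlieBracket hU hc (he.smooth i) (he.smooth j) hx h0,
    coeffDeriv_apply he hU (hη.coeffDeriv he hU (he.smooth j)) hx,
    coeffDeriv_apply he hU (hη.coeffDeriv he hU (he.smooth i)) hx]
  congr 1
  · exact mvfderiv_congr hU (fun y hy => coeffDeriv_apply he hU hη hy _ p I) hx _
  · exact mvfderiv_congr hU (fun y hy => coeffDeriv_apply he hU hη hy _ p I) hx _

omit hη hx in
lemma SmoothFormOn.nabla (hD : IsLeviCivita D) (i : Fin n) (hη : SmoothFormOn η U) :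
    SmoothFormOn (fun y => nabla D e η y (e i y)) U :=
  ((hη.coeffDeriv he hU (he.smooth i)).add (hη.bilinAt he
    (g := fun j k y => -chris D e i j k y) fun j k => (chris_smooth he hD hU i j k).neg)).congr
    fun _ hy => nabla_eq he η hy i

/-- The commutator of covariant derivatives of forms. -/
lemma nabla_comm (hD : IsLeviCivita D) (i j : Fin n) :
    nabla D e (fun y => nabla D e η y (e j y)) x (e i x)
      - nabla D e (fun y => nabla D e η y (e i y)) x (e j x)
      = ∑ k, ((chris D e i j k x - chris D e j i k x : ℝ) : ℂ) • nabla D e η x (e k x)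
        + bilinAt e x (fun k l => Rm D e x i j l k) (η x) := by
  have hch : ∀ i j k, ContMDiffOn (𝓡 n) 𝓘(ℝ, ℝ) ∞ (fun y => -chris D e i j k y) U := fun i j k =>
    (chris_smooth he hD hU i j k).neg
  have key : ∀ i j, nabla D e (fun y => nabla D e η y (e j y)) x (e i x)
      = coeffDeriv e (fun y => coeffDeriv e η y (e j y)) x (e i x)
        + bilinAt e x (fun k l => -chris D e j k l x) (coeffDeriv e η x (e i x))
        + bilinAt e x (fun k l => -mvfderiv (𝓡 n) (chris D e j k l) x (e i x)) (η x)
        + (bilinAt e x (fun k l => -chris D e i k l x) (coeffDeriv e η x (e j x))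
        + (bilinAt e x (fun k l => -chris D e i k l x) * bilinAt e x (fun k l => -chris D e j k l x))
            (η x)) := by
    intro i j
    have hm : ∀ k l, mvfderiv (𝓡 n) (fun y => -chris D e j k l y) x (e i x)
        = -mvfderiv (𝓡 n) (chris D e j k l) x (e i x) := fun k l => congr($(mvfderiv_fun_neg) _)
    rw [nabla_eq he _ hx, nabla_eq he η hx,
      coeffDeriv_congr hU (fun y hy => nabla_eq he η hy j) hx,
      coeffDeriv_add he hU hx _ (hη.coeffDeriv he hU (he.smooth j))
        (hη.bilinAt he (g := fun k l y => -chris D e j k l y) (hch j)),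
      coeffDeriv_bilinAt he hU hη hx (g := fun k l y => -chris D e j k l y) (hch j), map_add]
    simp only [hm]
    rw [← add_assoc (coeffDeriv e (fun y => coeffDeriv e η y (e j y)) x (e i x))]
    rfl
  have hbr : ∑ k, ((chris D e i j k x - chris D e j i k x : ℝ) : ℂ) • nabla D e η x (e k x)
      = (coeffDeriv e (fun y => coeffDeriv e η y (e j y)) x (e i x)
        - coeffDeriv e (fun y => coeffDeriv e η y (e i y)) x (e j x))
        + bilinAt e x (∑ m, (chris D e i j m x - chris D e j i m x) •
            fun k l => -chris D e m k l x) (η x) := by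
    rw [coeffDeriv_comm he hU hη hx, mlieBracket_frame he hD hU hx, coeffDeriv_sum_right,
      bilinAt, bilin_sum]
    simp only [nabla_eq he η hx, bilin_smul]
    refine Eq.trans ?_ (congrArg (_ + ·) (LinearMap.sum_apply _ _ _).symm)
    rw [← Finset.sum_add_distrib]
    exact Finset.sum_congr rfl fun k _ => Forms.smul_add _ _ _
  -- The terms mixing a connection matrix with a first derivative are the same for both orders of
  -- differentiation and cancel. What remains is the derivative of the connection matrix and the
  -- commutator of the matrices.
  have halg : ∀ {W : Type _} [AddCommGroup W] [Module ℂ W] (B C B' C' K L J J' : Module.End ℂ W)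
      (a b u w z : W), J - J' + (B * C - C * B) = K + L →
      a + C u + J z + (B w + (B * C) z) - (b + B w + J' z + (C u + (C * B) z))
        = a - b + K z + L z := by
    intro W _ _ B C B' C' K L J J' a b u w z h
    have := congr($h z)
    simp only [LinearMap.add_apply, LinearMap.sub_apply, Module.End.mul_apply] at this ⊢
    rw [add_assoc (a - b), ← this]
    abel
  rw [key i j, key j i, hbr]
  refine halg (W := Forms (TangentSpace (𝓡 n) x)) _ _ 0 0 _ _ _ _ _ _ _ _ _ ?_
  refine (congrArg₂ (· + ·) (bilin_sub _ _).symm (bilin_comm _ _ (car_frame he hx))).trans ?_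
  refine (bilin_add _ _).symm.trans (Eq.trans ?_ (bilin_add _ _))
  congr 1
  funext k l
  simp only [Pi.add_apply, Pi.sub_apply, Finset.sum_apply, Pi.smul_apply, smul_eq_mul]
  -- Since forms are differentiated with -Γ, the resulting matrix is -R_{ijkl} = R_{ijlk}.
  rw [Rm_swap_right he hD hU hx, Rm_eq he hD hU hx]
  simp only [Finset.sum_sub_distrib, mul_neg, neg_mul, neg_neg, Finset.sum_neg_distrib]
  ring

end

end Commutator


/-! ### Derivations and differentiability of form valued maps -/

section Derivation

variable {V : Type*} [NormedAddCommGroup V] [InnerProductSpace ℝ V] {n : ℕ}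

/-- The derivation `∑ ε_k ι(w_k)` replaces each argument `b_k` by `w_k`. -/
lemma sum_extMul_intMul_apply (b : OrthonormalBasis (Fin n) ℝ V) (w : Fin n → V) (η : Forms V)
    (q : ℕ) (K : Fin q → Fin n) :
    (∑ k, extMul (b k) (intMul (w k) η)) q (fun a => b (K a))
      = ∑ a, η q (Function.update (fun c => b (K c)) a (w (K a))) := by
  rw [Finset.sum_apply, ContinuousAlternatingMap.sum_apply]
  cases q with
  | zero => exact Finset.sum_eq_zero fun k _ => rfl
  | succ q =>
    simp only [extMul_apply_succ, orthonormal_iff_ite.mp b.orthonormal]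
    rw [Finset.sum_comm]
    refine Finset.sum_congr rfl fun a _ => ?_
    rw [Finset.sum_eq_single (K a) (fun k _ hk => by simp [hk]) (by simp), intMul_apply,
      ← Fin.insertNth_removeNth, ContinuousAlternatingMap.map_insertNth]
    simp

lemma differentiableAt_of_apply_basis {E : Type*} [NormedAddCommGroup E] [NormedSpace ℝ E]
    (b : OrthonormalBasis (Fin n) ℝ V) {f : E → Forms V} {z : E}
    (h : ∀ p (I : Fin p → Fin n), DifferentiableAt ℝ (fun y => f y p fun a => b (I a)) z) (q : ℕ) :
    DifferentiableAt ℝ (fun y => f y q) z := by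
  have : (fun y => f y q) = fun y => ∑ I : Finset (Fin n), scaleCLM (CAR.revSign I.card)
      (extMulProd b I oneForm q) (f y I.card fun k => b (I.orderEmbOfFin rfl k)) := by
    funext y
    have h := congrFun (sum_extMulProd b (f y)) q
    rw [Finset.sum_apply] at h
    rw [← h]
    refine Finset.sum_congr rfl fun I _ => ?_
    ext u
    exact (mul_assoc _ _ _).symm
  rw [this]
  exact DifferentiableAt.fun_sum fun I _ =>
    (scaleCLM _ _).differentiableAt.comp z (h _ _)

end Derivation

/-! ### The exterior derivative through the flat connection of a chart -/

section Chart

variable {n : ℕ} {M : Type*} [TopologicalSpace M] [ChartedSpace (EuclideanSpace ℝ (Fin n)) M]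
  [IsManifold (𝓡 n) ∞ M] {U : Set M} {x : M}

lemma mfderiv_extChartAt_symm {z : EuclideanSpace ℝ (Fin n)}
    (hz : z ∈ (extChartAt (𝓡 n) x).target) :
    mfderiv 𝓘(ℝ, EuclideanSpace ℝ (Fin n)) (𝓡 n) (extChartAt (𝓡 n) x).symm z
      = (mfderiv (𝓡 n) 𝓘(ℝ, EuclideanSpace ℝ (Fin n)) (extChartAt (𝓡 n) x)
          ((extChartAt (𝓡 n) x).symm z)).inverse := by
  have h1 := mfderiv_extChartAt_comp_mfderivWithin_extChartAt_symm (I := 𝓡 n) hz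
  have h2 := mfderivWithin_extChartAt_symm_comp_mfderiv_extChartAt (I := 𝓡 n) hz
  rw [ModelWithCorners.range_eq_univ, mfderivWithin_univ] at h1 h2
  exact (ContinuousLinearMap.inverse_eq h1 h2).symm

/-- The coordinate representation of a vector field in the preferred chart at `x`, as a function on
the manifold. -/
noncomputable def chartField (x : M) (X : VField n M) (m : M) : EuclideanSpace ℝ (Fin n) :=
  mvfderiv (𝓡 n) (extChartAt (𝓡 n) x) m (X m)

/-- The inverse of the differential of the preferred chart at `x`. -/
noncomputable def chartInv (x m : M) : EuclideanSpace ℝ (Fin n) →L[ℝ] TangentSpace (𝓡 n) m :=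
  (mfderiv (𝓡 n) 𝓘(ℝ, EuclideanSpace ℝ (Fin n)) (extChartAt (𝓡 n) x) m).inverse

lemma chartInv_chartField {m : M} (hm : m ∈ (extChartAt (𝓡 n) x).source) (X : VField n M) :
    chartInv x m (chartField x X m) = X m :=
  (isInvertible_mfderiv_extChartAt hm).inverse_apply_eq.mpr rfl

variable (n) in
/-- The coordinate domain in `U`. -/
def chartDom (x : M) (U : Set M) : Set M := (extChartAt (𝓡 n) x).source ∩ U

omit [IsManifold (𝓡 n) ∞ M] in
lemma isOpen_chartDom (hU : IsOpen U) : IsOpen (chartDom n x U) :=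
  (isOpen_extChartAt_source x).inter hU

omit [IsManifold (𝓡 n) ∞ M] in
lemma mem_chartDom (hx : x ∈ U) : x ∈ chartDom n x U := ⟨mem_extChartAt_source x, hx⟩

omit [IsManifold (𝓡 n) ∞ M] in
lemma eventually_chartDom (hU : IsOpen U) {m : M} (hm : m ∈ chartDom n x U) :
    ∀ᶠ z in nhds (extChartAt (𝓡 n) x m),
      z ∈ (extChartAt (𝓡 n) x).target ∧ (extChartAt (𝓡 n) x).symm z ∈ chartDom n x U := by
  have h1 := (isOpen_extChartAt_target (I := 𝓡 n) x).mem_nhds ((extChartAt (𝓡 n) x).map_source hm.1)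
  have h2 := (continuousAt_extChartAt_symm' (I := 𝓡 n) hm.1).preimage_mem_nhds
    ((isOpen_chartDom hU).mem_nhds (by rwa [(extChartAt (𝓡 n) x).left_inv hm.1]))
  filter_upwards [h1, h2] with z hz1 hz2 using ⟨hz1, hz2⟩

lemma smooth_extChartAt : ContMDiffOn (𝓡 n) 𝓘(ℝ, EuclideanSpace ℝ (Fin n)) ∞
    (extChartAt (𝓡 n) x) (chartDom n x U) :=
  contMDiffOn_extChartAt.mono fun m hm => by simpa using hm.1

/-- Smooth functions are smooth in the chart. -/
lemma contDiffAt_comp_symm {F : Type*} [NormedAddCommGroup F] [NormedSpace ℝ F] {g : M → F}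
    (hU : IsOpen U) (hg : ContMDiffOn (𝓡 n) 𝓘(ℝ, F) ∞ g (chartDom n x U)) {m : M}
    (hm : m ∈ chartDom n x U) :
    ContDiffAt ℝ ∞ (fun z => g ((extChartAt (𝓡 n) x).symm z)) (extChartAt (𝓡 n) x m) := by
  have h1 : ContMDiffAt 𝓘(ℝ, EuclideanSpace ℝ (Fin n)) (𝓡 n) ∞ (extChartAt (𝓡 n) x).symm
      (extChartAt (𝓡 n) x m) :=
    (contMDiffOn_extChartAt_symm x).contMDiffAt
      ((isOpen_extChartAt_target (I := 𝓡 n) x).mem_nhds ((extChartAt (𝓡 n) x).map_source hm.1))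
  have h2 : ContMDiffAt (𝓡 n) 𝓘(ℝ, F) ∞ g
      ((extChartAt (𝓡 n) x).symm (extChartAt (𝓡 n) x m)) := by
    rw [(extChartAt (𝓡 n) x).left_inv hm.1]
    exact hg.contMDiffAt ((isOpen_chartDom hU).mem_nhds hm)
  exact (h2.comp _ h1).contDiffAt

lemma fderiv_comp_symm {F : Type*} [NormedAddCommGroup F] [NormedSpace ℝ F] {g : M → F}
    (hU : IsOpen U) (hg : ContMDiffOn (𝓡 n) 𝓘(ℝ, F) ∞ g (chartDom n x U)) {m : M}
    (hm : m ∈ chartDom n x U) (X : VField n M) :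
    fderiv ℝ (fun z => g ((extChartAt (𝓡 n) x).symm z)) (extChartAt (𝓡 n) x m) (chartField x X m)
      = mvfderiv (𝓡 n) g m (X m) := by
  have h1 : DifferentiableAt ℝ (fun z => g ((extChartAt (𝓡 n) x).symm z)) (extChartAt (𝓡 n) x m) :=
    (contDiffAt_comp_symm hU hg hm).differentiableAt (by simp)
  have h2 : MDifferentiableAt (𝓡 n) 𝓘(ℝ, EuclideanSpace ℝ (Fin n)) (extChartAt (𝓡 n) x) m :=
    mdiffAt_of_contMDiffOn (isOpen_chartDom hU) smooth_extChartAt hm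
  have h3 := mfderiv_comp_apply m h1.mdifferentiableAt h2 (X m)
  rw [mfderiv_eq_fderiv] at h3
  refine h3.symm.trans ?_
  exact mvfderiv_congr (isOpen_chartDom hU)
    (fun y hy => congrArg g ((extChartAt (𝓡 n) x).left_inv hy.1)) hm (X m)

lemma chartField_smooth (hU : IsOpen U) {X : VField n M} (hX : SmoothFieldOn X U) :
    ContMDiffOn (𝓡 n) 𝓘(ℝ, EuclideanSpace ℝ (Fin n)) ∞ (chartField x X) (chartDom n x U) :=
  contMDiffOn_mvfderiv (isOpen_chartDom hU) smooth_extChartAt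
    (ContMDiffOn.mono hX Set.inter_subset_right)

lemma chartInv_smooth (v : EuclideanSpace ℝ (Fin n)) :
    SmoothFieldOn (fun m => chartInv x m v) (chartDom n x U) := fun m hm => by
  have h1 : ContMDiffAt (𝓡 n) 𝓘(ℝ, EuclideanSpace ℝ (Fin n)) ∞ (extChartAt (𝓡 n) x) m :=
    contMDiffOn_extChartAt.contMDiffAt ((chartAt _ x).open_source.mem_nhds (by simpa using hm.1))
  have h2 : ContMDiffAt 𝓘(ℝ, EuclideanSpace ℝ (Fin n)) 𝓘(ℝ, EuclideanSpace ℝ (Fin n)).tangent ∞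
      (fun z => (⟨z, v⟩ : TangentBundle 𝓘(ℝ, EuclideanSpace ℝ (Fin n)) (EuclideanSpace ℝ (Fin n))))
      (extChartAt (𝓡 n) x m) :=
    (contMDiffAt_vectorSpace_iff_contDiffAt (V := fun _ => v)).mpr contDiffAt_const
  exact (ContMDiffAt.mpullback_vectorField_preimage (V := fun _ => v) (n := ∞) h2 h1
    (isInvertible_mfderiv_extChartAt hm.1) (by simp)).contMDiffWithinAt

/-- The covariant derivative of `Y` along `X` for the flat connection of the chart. -/
noncomputable def flatDeriv (x : M) (X Y : VField n M) : TangentSpace (𝓡 n) x :=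
  chartInv x x (fderiv ℝ (fun z => chartField x Y ((extChartAt (𝓡 n) x).symm z))
    (extChartAt (𝓡 n) x x) (chartField x X x))

/-- The flat connection of the chart has no torsion, because the bracket on the manifold is the
coordinate bracket transported by the chart. -/
lemma flatDeriv_sub (hU : IsOpen U) (hx : x ∈ U) (X Y : VField n M) :
    flatDeriv x X Y - flatDeriv x Y X = VectorField.mlieBracket (𝓡 n) X Y x := by
  have hpull : ∀ X : VField n M, VectorField.mpullbackWithin 𝓘(ℝ, EuclideanSpace ℝ (Fin n)) (𝓡 n)
      (extChartAt (𝓡 n) x).symm X (Set.range (𝓡 n)) =ᶠ[nhds (extChartAt (𝓡 n) x x)]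
      fun z => chartField x X ((extChartAt (𝓡 n) x).symm z) := by
    intro X
    filter_upwards [eventually_chartDom hU (mem_chartDom hx)] with z hz
    have hinv := isInvertible_mfderivWithin_extChartAt_symm (I := 𝓡 n) hz.1
    rw [VectorField.mpullbackWithin_apply]
    refine hinv.inverse_apply_eq.mpr ?_
    have h2 := mfderivWithin_extChartAt_symm_comp_mfderiv_extChartAt (I := 𝓡 n) hz.1
    exact congr($h2 _).symm
  have hpull0 : ∀ X : VField n M, chartField x X ((extChartAt (𝓡 n) x).symm (extChartAt (𝓡 n) x x))
      = chartField x X x := fun X => by rw [extChartAt_to_inv]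
  have hb : VectorField.mlieBracket (𝓡 n) X Y x = chartInv x x
      (VectorField.lieBracket ℝ (fun z => chartField x X ((extChartAt (𝓡 n) x).symm z))
        (fun z => chartField x Y ((extChartAt (𝓡 n) x).symm z)) (extChartAt (𝓡 n) x x)) := by
    rw [← VectorField.mlieBracketWithin_univ, VectorField.mlieBracketWithin_apply]
    have : (extChartAt (𝓡 n) x).symm ⁻¹' Set.univ ∩ Set.range (𝓡 n) = Set.univ := by
      rw [ModelWithCorners.range_eq_univ]; simp
    rw [this]
    refine congrArg (chartInv x x) ?_
    refine (congrFun VectorField.lieBracketWithin_univ _).trans ?_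
    exact Filter.EventuallyEq.lieBracket_vectorField_eq (hpull X) (hpull Y)
  rw [hb, VectorField.lieBracket_eq]
  simp only [hpull0]
  rw [map_sub]
  rfl

variable [RiemannianBundle (fun x : M => TangentSpace (𝓡 n) x)]

/-- The coordinate representation of a form in the preferred chart at `x`, as a function on the
manifold. -/
noncomputable def chartForm (x : M) (η : FormField n M) (m : M) :
    Forms (EuclideanSpace ℝ (Fin n)) :=
  fun q => (η m q).compContinuousLinearMap (chartInv x m)

lemma dForm_succ (hU : IsOpen U) (hx : x ∈ U) (η : FormField n M) (q : ℕ)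
    (v : Fin (q + 1) → VField n M) :
    dForm η x (q + 1) (fun a => v a x)
      = extDeriv (fun z => chartForm x η ((extChartAt (𝓡 n) x).symm z) q) (extChartAt (𝓡 n) x x)
          (fun a => chartField x (v a) x) := by
  have h : (fun y : EuclideanSpace ℝ (Fin n) =>
      (η ((extChartAt (𝓡 n) x).symm y) q).compContinuousLinearMap
        (mfderiv 𝓘(ℝ, EuclideanSpace ℝ (Fin n)) (𝓡 n) (extChartAt (𝓡 n) x).symm y))
      =ᶠ[nhds (extChartAt (𝓡 n) x x)]
        fun z => chartForm x η ((extChartAt (𝓡 n) x).symm z) q := by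
    filter_upwards [eventually_chartDom hU (mem_chartDom hx)] with z hz
    rw [mfderiv_extChartAt_symm hz.1]
    rfl
  have h2 := h.extDeriv_eq
  exact congr($h2 (fun a => chartField x (v a) x))

lemma differentiableAt_chartForm (hU : IsOpen U) (hx : x ∈ U) {η : FormField n M}
    (hη : SmoothFormOn η U) (q : ℕ) :
    DifferentiableAt ℝ (fun z => chartForm x η ((extChartAt (𝓡 n) x).symm z) q)
      (extChartAt (𝓡 n) x x) := by
  refine differentiableAt_of_apply_basis (EuclideanSpace.basisFun (Fin n) ℝ)
    (f := fun z => chartForm x η ((extChartAt (𝓡 n) x).symm z)) (fun p I => ?_) q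
  have h := hη p (chartDom n x U)
    (fun a m => chartInv x m (EuclideanSpace.basisFun (Fin n) ℝ (I a))) (isOpen_chartDom hU)
    Set.inter_subset_right fun a => chartInv_smooth _
  exact (contDiffAt_comp_symm hU h (mem_chartDom hx)).differentiableAt (by simp)

variable [IsContMDiffRiemannianBundle (𝓡 n) ∞ (EuclideanSpace ℝ (Fin n))
      (fun x : M => TangentSpace (𝓡 n) x)]
  {D : Connection n M} {e : Fin n → VField n M} (he : IsOrthonormalFrameOn e U)
include he

/-- The exterior derivative in terms of the flat connection of the chart. -/
lemma dForm_flat (hU : IsOpen U) (hx : x ∈ U) {η : FormField n M} (hη : SmoothFormOn η U) :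
    dForm η x = ∑ i, extMul (e i x) (coeffDeriv e η x (e i x)
      - ∑ k, extMul (e k x) (intMul (flatDeriv x (e i) (e k)) (η x))) := by
  refine ext_frame he hx fun p J => ?_
  rw [Finset.sum_apply, ContinuousAlternatingMap.sum_apply]
  cases p with
  | zero => exact (Finset.sum_eq_zero fun i _ => rfl).symm
  | succ q =>
    have hdiff := differentiableAt_chartForm hU hx hη q
    have hx' := mem_chartDom (n := n) hx
    rw [dForm_succ hU hx η q fun a => e (J a), extDeriv,
      ContinuousAlternatingMap.alternatizeUncurryFin_apply]
    -- Product rule for the coefficient η(e_{K 1}, …, e_{K q}) read in the chart: the derivative of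
    -- the form itself is the derivative of the coefficient minus the terms in which one frame field
    -- is differentiated.
    have key : ∀ (i : Fin n) (K : Fin q → Fin n),
        fderiv ℝ (fun z => chartForm x η ((extChartAt (𝓡 n) x).symm z) q) (extChartAt (𝓡 n) x x)
          (chartField x (e i) x) (fun a => chartField x (e (K a)) x)
        = (coeffDeriv e η x (e i x)
            - ∑ k, extMul (e k x) (intMul (flatDeriv x (e i) (e k)) (η x))) q
              (fun a => e (K a) x) := by
      intro i K
      have hfd : ∀ a, DifferentiableAt ℝ
          (fun z => chartField x (e (K a)) ((extChartAt (𝓡 n) x).symm z))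
          (extChartAt (𝓡 n) x x) := fun a =>
        (contDiffAt_comp_symm hU (chartField_smooth hU (he.smooth (K a))) hx').differentiableAt
          (by simp)
      have h1 := fderiv_continuousAlternatingMap_apply_apply hdiff hfd (chartField x (e i) x)
      have hc : ContMDiffOn (𝓡 n) 𝓘(ℝ, ℂ) ∞ (coeff e η q K) (chartDom n x U) :=
        ((smoothFormOn_iff_coeff he hU).mp hη q K).mono Set.inter_subset_right
      have h2 : fderiv ℝ (fun z => chartForm x η ((extChartAt (𝓡 n) x).symm z) q
          (fun a => chartField x (e (K a)) ((extChartAt (𝓡 n) x).symm z)))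
            (extChartAt (𝓡 n) x x) (chartField x (e i) x)
          = coeffDeriv e η x (e i x) q (fun a => e (K a) x) := by
        rw [coeffDeriv_apply he hU hη hx, ← fderiv_comp_symm hU hc hx' (e i)]
        have : (fun z => chartForm x η ((extChartAt (𝓡 n) x).symm z) q
            (fun a => chartField x (e (K a)) ((extChartAt (𝓡 n) x).symm z)))
            =ᶠ[nhds (extChartAt (𝓡 n) x x)]
            fun z => coeff e η q K ((extChartAt (𝓡 n) x).symm z) := by
          filter_upwards [eventually_chartDom hU hx'] with z hz
          refine congrArg (η ((extChartAt (𝓡 n) x).symm z) q) (funext fun a => ?_)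
          exact chartInv_chartField hz.2.1 _
        rw [this.fderiv_eq]
      rw [h2] at h1
      rw [extChartAt_to_inv] at h1
      have h3 := sum_extMul_intMul_apply (he.basis hx) (fun k => flatDeriv x (e i) (e k)) (η x) q K
      simp only [he.basis_apply] at h3
      change _ = _ - (∑ k, extMul (e k x) (intMul (flatDeriv x (e i) (e k)) (η x))) q _
      rw [h3]
      refine eq_sub_of_add_eq (Eq.trans (congrArg (_ + ·) ?_) h1.symm)
      refine Finset.sum_congr rfl fun a _ => ?_
      refine congrArg (η x q) (funext fun c => ?_)
      change _ = chartInv x x (Function.update (fun c => chartField x (e (K c)) x) a _ c)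
      by_cases hca : c = a
      · subst hca
        rw [Function.update_self, Function.update_self]
        rfl
      · rw [Function.update_of_ne hca, Function.update_of_ne hca]
        exact (chartInv_chartField hx'.1 _).symm
    simp only [extMul_apply_succ, inner_frame he hx]
    rw [Finset.sum_comm]
    refine Finset.sum_congr rfl fun a _ => ?_
    rw [Finset.sum_eq_single (J a) (fun k _ hk => by simp [hk]) (by simp)]
    have := key (J a) (a.removeNth J)
    refine (congrArg (fun c : ℂ => (-1 : ℤ) ^ (a : ℕ) • c) this).trans ?_
    simp
    rfl

/-- The exterior derivative in terms of the Levi-Civita connection. -/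
theorem dForm_eq (hD : IsLeviCivita D) (hU : IsOpen U) (hx : x ∈ U) {η : FormField n M}
    (hη : SmoothFormOn η U) :
    dForm η x = ∑ i, extMul (e i x) (nabla D e η x (e i x)) := by
  -- The difference of two torsion-free connections is symmetric.
  have hsymm : ∀ i k, D (e k) x (e i x) - flatDeriv x (e i) (e k)
      = D (e i) x (e k x) - flatDeriv x (e k) (e i) := fun i k => by
    have h1 := conn_torsion hD hU (he.smooth i) (he.smooth k) hx
    rw [← flatDeriv_sub hU hx (e i) (e k)] at h1
    rw [sub_eq_sub_iff_add_eq_add] at h1 ⊢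
    rw [h1, add_comm]
  -- A symmetric family contracted with the antisymmetric product ε_i ε_k equals its own negative.
  have hzero : ∑ i, extMul (e i x) (∑ k, extMul (e k x)
      (intMul (D (e k) x (e i x) - flatDeriv x (e i) (e k)) (η x))) = 0 := by
    simp only [map_sum]
    set S := ∑ i, ∑ k, extMul (e i x) (extMul (e k x)
      (intMul (D (e k) x (e i x) - flatDeriv x (e i) (e k)) (η x))) with hS
    have : S = -S := by
      conv_lhs => rw [hS, Finset.sum_comm]
      rw [hS, ← Finset.sum_neg_distrib]
      refine Finset.sum_congr rfl fun i _ => ?_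
      rw [← Finset.sum_neg_distrib]
      refine Finset.sum_congr rfl fun k _ => ?_
      rw [extMul_extMul, hsymm i k]
    funext p
    ext u
    have h2 : S p u = -S p u := congr($this p u)
    exact self_eq_neg.mp h2
  rw [dForm_flat he hU hx hη, ← sub_eq_zero, ← hzero, ← Finset.sum_sub_distrib]
  refine Finset.sum_congr rfl fun i _ => ?_
  rw [nabla, ← map_sub]
  congr 1
  have : ∀ k, extMul (e k x) (intMul (D (e k) x (e i x) - flatDeriv x (e i) (e k)) (η x))
      = extMul (e k x) (intMul (D (e k) x (e i x)) (η x))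
        - extMul (e k x) (intMul (flatDeriv x (e i) (e k)) (η x)) := fun k => by
    rw [← map_sub]
    congr 1
    exact congr($(map_sub intMulₗ (D (e k) x (e i x)) (flatDeriv x (e i) (e k))) (η x))
  simp only [this, Finset.sum_sub_distrib]
  abel

end Chart


/-! ### Compatibility of the Hodge star with rotations and degrees -/

section Fibre

variable {n : ℕ}

/-- Antisymmetric bilinear elements commute with `hatVol`. -/
lemma bilin_mul_hatVol {A : Type*} [Ring A] [Algebra ℂ A] [IsAddTorsionFree A] {ε ι : Fin n → A}
    (hC : CAR ε ι) {g : Fin n → Fin n → ℝ} (hg : ∀ k l, g k l = -g l k) :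
    bilin ε ι g * CAR.hatVol ε ι = CAR.hatVol ε ι * bilin ε ι g := by
  have h : ∀ k l, (g k l : ℂ) • (ι k * ε l) = (g l k : ℂ) • (ε l * ι k) := fun k l => by
    rw [hC.ann_cre]
    split_ifs with hkl
    · subst hkl
      have : g k k = 0 := self_eq_neg.mp (hg k k)
      simp [this]
    · rw [hg k l]
      simp
  simp only [bilin, Finset.sum_mul, smul_mul_assoc, hC.cre_ann_mul_hatVol]
  rw [Finset.sum_comm]
  simp only [Finset.mul_sum, ← mul_smul_comm, h]

variable {V : Type*} [NormedAddCommGroup V] [InnerProductSpace ℝ V]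

lemma degScale_add (s : ℕ → ℂ) (η ξ : Forms V) :
    degScale s (η + ξ) = degScale s η + degScale s ξ := by
  funext p
  ext u
  exact mul_add _ _ _

lemma degScale_smul (s : ℕ → ℂ) (c : ℂ) (η : Forms V) :
    degScale s (c • η) = c • degScale s η := by
  funext p
  ext u
  exact mul_left_comm _ _ _

lemma degScale_sum {κ : Type*} (s : ℕ → ℂ) (t : Finset κ) (η : κ → Forms V) :
    degScale s (∑ i ∈ t, η i) = ∑ i ∈ t, degScale s (η i) :=
  map_sum (AddMonoidHom.mk' (degScale (V := V) s) (degScale_add s)) _ _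

lemma extMul_intMul_degScale (s : ℕ → ℂ) (v w : V) (η : Forms V) :
    extMul v (intMul w (degScale s η)) = degScale s (extMul v (intMul w η)) := by
  funext p
  cases p with
  | zero =>
    ext u
    exact (mul_zero _).symm
  | succ p =>
    ext u
    change _ = s (p + 1) * extMul v (intMul w η) (p + 1) u
    rw [extMul_apply_succ, extMul_apply_succ, Finset.mul_sum]
    refine Finset.sum_congr rfl fun i _ => ?_
    change _ * (_ * (s (p + 1) * intMul w η p _)) = _
    ring

lemma hodgeStar_add (b : OrthonormalBasis (Fin n) ℝ V) (η ξ : Forms V) :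
    hodgeStar b (η + ξ) = hodgeStar b η + hodgeStar b ξ := by
  simp only [hodgeStar_eq, degScale_add, map_add]

lemma hodgeStar_sum {κ : Type*} (b : OrthonormalBasis (Fin n) ℝ V) (t : Finset κ)
    (η : κ → Forms V) : hodgeStar b (∑ i ∈ t, η i) = ∑ i ∈ t, hodgeStar b (η i) := by
  simp only [hodgeStar_eq, degScale_sum, map_sum]

end Fibre

/-! ### The codifferential in terms of the connection -/

section Codifferential

variable {n : ℕ} {M : Type*} [TopologicalSpace M] [ChartedSpace (EuclideanSpace ℝ (Fin n)) M]
  [IsManifold (𝓡 n) ∞ M] {U : Set M} {x : M}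
  [RiemannianBundle (fun x : M => TangentSpace (𝓡 n) x)]
  [IsContMDiffRiemannianBundle (𝓡 n) ∞ (EuclideanSpace ℝ (Fin n))
      (fun x : M => TangentSpace (𝓡 n) x)]
  {D : Connection n M} {e : Fin n → VField n M} (he : IsOrthonormalFrameOn e U)
include he

omit [IsContMDiffRiemannianBundle (𝓡 n) ∞ (EuclideanSpace ℝ (Fin n))
      (fun x : M => TangentSpace (𝓡 n) x)] in
lemma hodgeStar_frame (hx : x ∈ U) (ζ : Forms (TangentSpace (𝓡 n) x)) :
    hodgeStar (fun i => e i x) ζ = volOp (fun i => e i x) (degScale (starSign n) ζ) := by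
  have := hodgeStar_eq (he.basis hx) ζ
  rwa [he.basis_coe hx] at this

omit [IsContMDiffRiemannianBundle (𝓡 n) ∞ (EuclideanSpace ℝ (Fin n))
      (fun x : M => TangentSpace (𝓡 n) x)] in
-- An antisymmetric matrix is an infinitesimal rotation: it commutes with ω and preserves degrees,
-- hence commutes with the signs in ⋆ as well.
lemma bilinAt_hodgeStar (hx : x ∈ U) {g : Fin n → Fin n → ℝ} (hg : ∀ k l, g k l = -g l k)
    (ζ : Forms (TangentSpace (𝓡 n) x)) :
    bilinAt e x g (hodgeStar (fun i => e i x) ζ) = hodgeStar (fun i => e i x) (bilinAt e x g ζ) := by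
  rw [hodgeStar_frame he hx, hodgeStar_frame he hx]
  have h1 := congr($(bilin_mul_hatVol (car_frame he hx) hg) (degScale (starSign n) ζ))
  refine Eq.trans h1 (congrArg (volOp fun i => e i x) ?_)
  rw [bilinAt_apply, bilinAt_apply, degScale_sum]
  refine Finset.sum_congr rfl fun k _ => ?_
  rw [degScale_sum]
  refine Finset.sum_congr rfl fun l _ => ?_
  rw [degScale_smul, extMul_intMul_degScale]

variable (hU : IsOpen U) {η : FormField n M} (hη : SmoothFormOn η U)
include hU hη

omit hU in
lemma SmoothFormOn.hatProd (l : List (Fin n)) :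
    SmoothFormOn (fun y => (CAR.hatProd (fun i => SubSignature.extMul (e i y))
      (fun i => SubSignature.intMul (e i y)) l :
      Module.End ℂ (Forms (TangentSpace (𝓡 n) y))) (η y)) U := by
  induction l with
  | nil => exact hη
  | cons a l ih => exact (ih.extMul (he.smooth a)).add (ih.intMul (he.smooth a))

omit hU in
lemma SmoothFormOn.hodgeStar :
    SmoothFormOn (fun y => SubSignature.hodgeStar (fun i => e i y) (η y)) U :=
  ((hη.degScale (starSign n)).hatProd he (List.finRange n)).congr
    fun _ hy => hodgeStar_frame he hy _

variable (hx : x ∈ U)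
include hx

lemma coeffDeriv_hatProd (v : TangentSpace (𝓡 n) x) (l : List (Fin n)) :
    coeffDeriv e (fun y => (CAR.hatProd (fun i => extMul (e i y)) (fun i => intMul (e i y)) l :
      Module.End ℂ (Forms (TangentSpace (𝓡 n) y))) (η y)) x v
      = (CAR.hatProd (fun i => extMul (e i x)) (fun i => intMul (e i x)) l :
      Module.End ℂ (Forms (TangentSpace (𝓡 n) x))) (coeffDeriv e η x v) := by
  induction l with
  | nil => rfl
  | cons a l ih =>
    have hl := hη.hatProd he l
    refine (coeffDeriv_add he hU hx v (hl.extMul (he.smooth a)) (hl.intMul (he.smooth a))).trans ?_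
    rw [coeffDeriv_extMul he hU hl hx, coeffDeriv_intMul he hU hl hx, ih]
    rfl

lemma coeffDeriv_hodgeStar (v : TangentSpace (𝓡 n) x) :
    coeffDeriv e (fun y => hodgeStar (fun i => e i y) (η y)) x v
      = hodgeStar (fun i => e i x) (coeffDeriv e η x v) := by
  rw [coeffDeriv_congr hU (fun y hy => hodgeStar_frame he hy (η y)) hx, hodgeStar_frame he hx,
    ← coeffDeriv_degScale he hU hη hx]
  exact coeffDeriv_hatProd he hU (hη.degScale _) hx v _

/-- The Hodge star is parallel. -/
lemma nabla_hodgeStar (hD : IsLeviCivita D) (i : Fin n) :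
    nabla D e (fun y => hodgeStar (fun i => e i y) (η y)) x (e i x)
      = hodgeStar (fun i => e i x) (nabla D e η x (e i x)) := by
  rw [nabla_eq he _ hx, nabla_eq he _ hx, coeffDeriv_hodgeStar he hU hη hx,
    bilinAt_hodgeStar he hx fun k l => by rw [chris_antisymm he hD hU hx]]
  have := hodgeStar_add (he.basis hx) (coeffDeriv e η x (e i x))
    (bilinAt e x (fun j k => -chris D e i j k x) (η x))
  rw [he.basis_coe hx] at this
  exact this.symm

/-- The codifferential in terms of the Levi-Civita connection. -/
theorem codiff_eq (hD : IsLeviCivita D) :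
    codiff e η x = -∑ i, intMul (e i x) (nabla D e η x (e i x)) := by
  funext p
  have h : hodgeStar (fun i => e i x)
      (dForm (fun y => hodgeStar (fun i => e i y) (η y)) x) p
      = ∑ i, ((-1 : ℂ) ^ (n * p)) • intMul (e i x) (nabla D e η x (e i x)) p := by
    rw [dForm_eq he hD hU hx (hη.hodgeStar he)]
    simp only [nabla_hodgeStar he hU hη hx hD]
    have h1 := hodgeStar_sum (he.basis hx) Finset.univ fun i => extMul (e i x)
      (hodgeStar (fun i => e i x) (nabla D e η x (e i x)))
    rw [he.basis_coe hx] at h1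
    rw [h1, Finset.sum_apply]
    refine Finset.sum_congr rfl fun i _ => ?_
    have h2 := hodgeStar_extMul_hodgeStar (he.basis hx) i (nabla D e η x (e i x)) p
    rw [he.basis_coe hx] at h2
    exact h2
  -- The sign (-1)^(np+1) of the codifferential meets the (-1)^(np) of ⋆ε⋆, leaving -1.
  have halg : ∀ {W : Type} [AddCommGroup W] [Module ℂ W] (z : Fin n → W),
      (-1 : ℂ) ^ (n * p + 1) • ∑ i, ((-1 : ℂ) ^ (n * p)) • z i = -∑ i, z i := by
    intro W _ _ z
    rw [← Finset.smul_sum, smul_smul, ← pow_add,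
      show n * p + 1 + n * p = 2 * (n * p) + 1 by ring, pow_succ, pow_mul]
    simp
  rw [codiff, h]
  refine (halg (W := TangentSpace (𝓡 n) x [⋀^Fin p]→L[ℝ] ℂ) _).trans ?_
  change _ = -((∑ i, intMul (e i x) (nabla D e η x (e i x))) p)
  rw [Finset.sum_apply]

end Codifferential


/-! ### Smoothness of S and of the endomorphism field A -/

section SmoothTensor

variable {n : ℕ} {M : Type*} [TopologicalSpace M] [ChartedSpace (EuclideanSpace ℝ (Fin n)) M]
  [IsManifold (𝓡 n) ∞ M] {U : Set M} {x : M}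
  [RiemannianBundle (fun x : M => TangentSpace (𝓡 n) x)]
  [IsContMDiffRiemannianBundle (𝓡 n) ∞ (EuclideanSpace ℝ (Fin n))
      (fun x : M => TangentSpace (𝓡 n) x)]
  {D : Connection n M} {e : Fin n → VField n M} (he : IsOrthonormalFrameOn e U)

section
include he

/-- Covariant derivatives of smooth fields are smooth. -/
lemma conn_smooth (hD : IsLeviCivita D) (hU : IsOpen U) {X : VField n M} (hX : SmoothFieldOn X U)
    (i : Fin n) : SmoothFieldOn (fun y => D X y (e i y)) U := by
  have hg : ∀ k, ContMDiffOn (𝓡 n) 𝓘(ℝ, ℝ) ∞ (fun y => inner ℝ (X y) (e k y)) U := fun k =>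
    smooth_inner hX (he.smooth k)
  have hs : ∀ k, SmoothFieldOn ((fun y => inner ℝ (X y) (e k y)) • e k) U := fun k =>
    (he.smooth k).smul (hg k)
  refine (SmoothFieldOn.sum Finset.univ fun k _ => ((conn_frame_smooth he hD hU i k).smul (hg k)).add
    ((he.smooth k).smul (contMDiffOn_mvfderiv hU (hg k) (he.smooth i)))).congr fun y hy => ?_
  rw [conn_congr hU (SmoothFieldOn.sum Finset.univ fun k _ => hs k)
    (fun z hz => frame_expand he hz (X z)) hy, conn_sum hU _ (fun k _ => hs k) hy]
  exact Finset.sum_congr rfl fun k _ => conn_smul hU (hg k) (he.smooth k) hy _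

end

variable {k : ℕ} {F : ∀ x : M, Submodule ℝ (TangentSpace (𝓡 n) x)} {f : Fin k → VField n M}
  (hf : IsOrthonormalFrameOn f U)
  (hfF : ∀ x ∈ U, Submodule.span ℝ (Set.range (fun α => f α x)) = (F x)ᗮ)
include hf hfF

omit [IsContMDiffRiemannianBundle (𝓡 n) ∞ (EuclideanSpace ℝ (Fin n))
      (fun x : M => TangentSpace (𝓡 n) x)] in
lemma starProjection_frame (hx : x ∈ U) (v : TangentSpace (𝓡 n) x) :
    (F x)ᗮ.starProjection v = ∑ β, inner ℝ (f β x) v • f β x := by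
  have hmem : ∀ β, f β x ∈ (F x)ᗮ := fun β => by
    rw [← hfF x hx]
    exact Submodule.subset_span ⟨β, rfl⟩
  refine Submodule.eq_starProjection_of_mem_orthogonal
    (Submodule.sum_mem _ fun β _ => Submodule.smul_mem _ _ (hmem β)) ?_
  rw [← hfF x hx, Submodule.mem_orthogonal]
  intro u hu
  induction hu using Submodule.span_induction with
  | mem u hu =>
    obtain ⟨β, rfl⟩ := hu
    rw [inner_sub_right, inner_sum]
    simp only [inner_smul_right, orthonormal_iff_ite.mp (hf.orthonormal x hx)]
    simp
  | zero => exact inner_zero_left _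
  | add u w _ _ hu hw => rw [inner_add_left, hu, hw, add_zero]
  | smul a u _ hu => rw [inner_smul_left, hu, mul_zero]

omit [IsContMDiffRiemannianBundle (𝓡 n) ∞ (EuclideanSpace ℝ (Fin n))
      (fun x : M => TangentSpace (𝓡 n) x)] in
-- On U the field f_α lies in F^⊥, so its F-part is zero and S(e_i)f_α is ∇_{e_i} f_α minus its
-- projection to F^⊥. Writing that projection with the frame f makes smoothness evident without a
-- frame of F.
lemma tensorS_frame (hU : IsOpen U) (hx : x ∈ U) (i : Fin n) (α : Fin k) :
    tensorS D F (e i) (f α) x = D (f α) x (e i x)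
      - ∑ β, inner ℝ (f β x) (D (f α) x (e i x)) • f β x := by
  have hmem : ∀ y ∈ U, f α y ∈ (F y)ᗮ := fun y hy => by
    rw [← hfF y hy]
    exact Submodule.subset_span ⟨α, rfl⟩
  have h1 : D (proj F (f α)) x = D 0 x := by
    refine conn_congr hU (Y := proj F (f α)) (X := 0) ?_ (fun y hy => ?_) hx
    -- The zero field is smooth as an empty sum.
    · exact SmoothFieldOn.sum (n := n) (∅ : Finset (Fin 0)) (X := fun _ => f α) (by simp) |>.congr
        fun y hy => by simp
    · exact (F y).starProjection_apply_eq_zero_iff.mpr (hmem y hy)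
  have h2 : D (proj (fun z => (F z)ᗮ) (f α)) x = D (f α) x :=
    conn_congr hU (hf.smooth α) (fun y hy => Submodule.starProjection_eq_self_iff.mpr (hmem y hy)) hx
  have h3 : D (0 : VField n M) x = 0 := D.isCovariantDerivativeOn.zero (s := Set.univ)
  rw [tensorS, proj, proj, h1, h2, h3, starProjection_frame hf hfF hx]
  simp

include he

lemma tensorS_smooth (hD : IsLeviCivita D) (hU : IsOpen U) (i : Fin n) (α : Fin k) :
    SmoothFieldOn (tensorS D F (e i) (f α)) U := by
  have h := conn_smooth he hD hU (hf.smooth α) i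
  exact (h.sub (SmoothFieldOn.sum Finset.univ fun β _ =>
    (hf.smooth β).smul (smooth_inner (hf.smooth β) h))).congr
    fun y hy => tensorS_frame hf hfF hU hy i α

omit he hf hfF in
lemma SmoothFormOn.cl {X : VField n M} (hX : SmoothFieldOn X U) {η : FormField n M}
    (hη : SmoothFormOn η U) : SmoothFormOn (fun y => SubSignature.cl (X y) (η y)) U :=
  (hη.extMul hX).sub (hη.intMul hX)

omit he hf hfF in
lemma SmoothFormOn.clHat {X : VField n M} (hX : SmoothFieldOn X U) {η : FormField n M}
    (hη : SmoothFormOn η U) : SmoothFormOn (fun y => SubSignature.clHat (X y) (η y)) U :=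
  (hη.extMul hX).add (hη.intMul hX)

omit [IsContMDiffRiemannianBundle (𝓡 n) ∞ (EuclideanSpace ℝ (Fin n))
      (fun x : M => TangentSpace (𝓡 n) x)] he hf hfF in
lemma opA_apply (ζ : Forms (TangentSpace (𝓡 n) x)) : opA D F e f x ζ
    = ∑ i, ∑ α, cl (e i x) (clHat (tensorS D F (e i) (f α) x) (clHat (f α x) ζ)) := by
  refine (LinearMap.sum_apply _ _ _).trans (Finset.sum_congr rfl fun k _ => ?_)
  exact LinearMap.sum_apply _ _ _

lemma SmoothFormOn.opA (hD : IsLeviCivita D) (hU : IsOpen U) {η : FormField n M}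
    (hη : SmoothFormOn η U) : SmoothFormOn (fun y => opA D F e f y (η y)) U := by
  simp only [opA_apply]
  exact SmoothFormOn.sum _ fun i _ => SmoothFormOn.sum _ fun α _ =>
    ((hη.clHat (hf.smooth α)).clHat (tensorS_smooth he hf hfF hD hU i α)).cl (he.smooth i)

end SmoothTensor


/-! ### Scalar multiplication on forms -/

section Fibre

variable {V : Type*} [NormedAddCommGroup V] [InnerProductSpace ℝ V]

lemma Forms.smul_sub (a : ℂ) (η ξ : Forms V) : a • (η - ξ) = a • η - a • ξ := _root_.smul_sub a η ξ

lemma Forms.sub_smul (a b : ℂ) (η : Forms V) : (a - b) • η = a • η - b • η := _root_.sub_smul a b η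

lemma Forms.neg_smul (a : ℂ) (η : Forms V) : -a • η = -(a • η) := _root_.neg_smul a η

lemma Forms.add_neg_one_smul (η ξ : Forms V) : η + (-1 : ℂ) • ξ = η - ξ :=
  (congrArg (η + ·) (_root_.neg_one_smul ℂ ξ)).trans (sub_eq_add_neg η ξ).symm

lemma neg_two_apply {W : Type*} [AddCommGroup W] [Module ℂ W] (w : W) :
    (-2 : Module.End ℂ W) w = -(w + w) := by
  rw [← one_add_one_eq_two]
  rfl

end Fibre

/-! ### Smooth forms over U as a module, and operators on it -/

section Operators

variable {n : ℕ} {M : Type*} [TopologicalSpace M] [ChartedSpace (EuclideanSpace ℝ (Fin n)) M]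
  [IsManifold (𝓡 n) ∞ M] [RiemannianBundle (fun x : M => TangentSpace (𝓡 n) x)] {U : Set M} {x : M}

variable (n U) in
/-- Smooth forms over `U`, extended by zero. -/
def sectionsSubmodule : Submodule ℂ (FormField n M) where
  carrier := {η | SmoothFormOn η U ∧ ∀ y ∉ U, η y = 0}
  add_mem' {η ξ} hη hξ := ⟨hη.1.add hξ.1, fun y hy => by
    change η y + ξ y = 0
    rw [hη.2 y hy, hξ.2 y hy, add_zero]⟩
  zero_mem' := ⟨SmoothFormOn.zero, fun _ _ => rfl⟩
  smul_mem' c {η} hη := ⟨hη.1.smul c, fun y hy => by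
    change c • η y = 0
    rw [hη.2 y hy, Forms.smul_zero]⟩

variable (n U) in
/-- Smooth forms over `U`, extended by zero. -/
def Sections : Type _ := sectionsSubmodule n U

noncomputable instance : AddCommGroup (Sections n U) := (sectionsSubmodule n U).addCommGroup

noncomputable instance : Module ℂ (Sections n U) := (sectionsSubmodule n U).module

/-- The form underlying a section. -/
def Sections.form (σ : Sections n U) : FormField n M := Subtype.val σ

lemma Sections.smooth (σ : Sections n U) : SmoothFormOn σ.form U := (Subtype.property σ).1

/-- Evaluation of a section at a point. -/
def evalAt (U : Set M) (x : M) : Sections n U →ₗ[ℂ] Forms (TangentSpace (𝓡 n) x) where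
  toFun s := s.form x
  map_add' _ _ := rfl
  map_smul' _ _ := rfl

open Classical in
/-- The section with the same values as a given smooth form. -/
noncomputable def toSection (U : Set M) (η : FormField n M) (hη : SmoothFormOn η U) :
    Sections n U :=
  ⟨fun y => if y ∈ U then η y else 0, hη.congr fun _ hy => if_pos hy, fun _ hy => if_neg hy⟩

lemma evalAt_toSection {η : FormField n M} (hη : SmoothFormOn η U) (hx : x ∈ U) :
    evalAt U x (toSection U η hη) = η x := if_pos hx

/-- Extension by zero serves this purpose: values on U determine a section, so operator identities
can be checked pointwise on U. -/
lemma sections_ext {s s' : Sections n U} (h : ∀ x ∈ U, evalAt U x s = evalAt U x s') : s = s' := by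
  refine Subtype.ext (funext fun y => ?_)
  by_cases hy : y ∈ U
  · exact h y hy
  · rw [s.2.2 y hy, s'.2.2 y hy]

/-- `T` is a linear operator on smooth forms over `U`. -/
structure IsOperatorOn (T : FormField n M → FormField n M) (U : Set M) : Prop where
  smooth : ∀ {η}, SmoothFormOn η U → SmoothFormOn (T η) U
  add : ∀ {η ξ}, SmoothFormOn η U → SmoothFormOn ξ U → ∀ x ∈ U,
    T (fun y => η y + ξ y) x = T η x + T ξ x
  smul : ∀ (c : ℂ) {η}, SmoothFormOn η U → ∀ x ∈ U, T (fun y => c • η y) x = c • T η x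

/-- The endomorphism of the space of sections induced by an operator. -/
noncomputable def IsOperatorOn.lift {T : FormField n M → FormField n M} (hT : IsOperatorOn T U) :
    Module.End ℂ (Sections n U) where
  toFun s := toSection U (T s.form) (hT.smooth s.smooth)
  map_add' s s' := sections_ext fun x hx => by
    rw [map_add, evalAt_toSection _ hx, evalAt_toSection _ hx, evalAt_toSection _ hx]
    exact hT.add s.smooth s'.smooth x hx
  map_smul' c s := sections_ext fun x hx => by
    rw [RingHom.id_apply, map_smul, evalAt_toSection _ hx, evalAt_toSection _ hx]
    exact hT.smul c s.smooth x hx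

lemma IsOperatorOn.lift_apply {T : FormField n M → FormField n M} (hT : IsOperatorOn T U)
    (hx : x ∈ U) (s : Sections n U) : evalAt U x (hT.lift s) = T s.form x :=
  evalAt_toSection (hT.smooth s.smooth) hx

lemma isOperatorOn_of_end {B : EndField n M}
    (hB : ∀ {η}, SmoothFormOn η U → SmoothFormOn (fun y => B y (η y)) U) :
    IsOperatorOn (fun η y => B y (η y)) U where
  smooth := hB
  add _ _ _ _ := map_add _ _ _
  smul _ _ _ _ _ := map_smul _ _ _

variable [IsContMDiffRiemannianBundle (𝓡 n) ∞ (EuclideanSpace ℝ (Fin n))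
      (fun x : M => TangentSpace (𝓡 n) x)]
  {D : Connection n M} {e : Fin n → VField n M} (he : IsOrthonormalFrameOn e U)

omit [IsContMDiffRiemannianBundle (𝓡 n) ∞ (EuclideanSpace ℝ (Fin n))
      (fun x : M => TangentSpace (𝓡 n) x)] in
lemma nabla_congr (hU : IsOpen U) {η ξ : FormField n M} (h : ∀ y ∈ U, η y = ξ y) (hx : x ∈ U)
    (v : TangentSpace (𝓡 n) x) : nabla D e η x v = nabla D e ξ x v := by
  rw [nabla, nabla, coeffDeriv_congr hU h hx, h x hx]

include he

lemma isOperatorOn_nabla (hD : IsLeviCivita D) (hU : IsOpen U) (i : Fin n) :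
    IsOperatorOn (fun η y => nabla D e η y (e i y)) U where
  smooth hη := hη.nabla he hU hD i
  add {η ξ} hη hξ x hx := by
    simp only [nabla_eq he _ hx]
    rw [coeffDeriv_add he hU hx _ hη hξ, map_add]
    abel
  smul c η hη x hx := by
    simp only [nabla_eq he _ hx]
    rw [coeffDeriv_smul he hU hη hx, map_smul, ← Forms.smul_add]

lemma coeffDeriv_cl (hU : IsOpen U) {η : FormField n M} (hη : SmoothFormOn η U) (hx : x ∈ U)
    (v : TangentSpace (𝓡 n) x) (j : Fin n) :
    coeffDeriv e (fun y => cl (e j y) (η y)) x v = cl (e j x) (coeffDeriv e η x v) := by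
  have h := coeffDeriv_add he hU hx v (hη.extMul (he.smooth j)) ((hη.intMul (he.smooth j)).smul (-1))
  rw [coeffDeriv_smul he hU (hη.intMul (he.smooth j)) hx, coeffDeriv_extMul he hU hη hx,
    coeffDeriv_intMul he hU hη hx] at h
  simp only [Forms.add_neg_one_smul] at h
  exact h

/-- The covariant derivative is compatible with the Clifford action. -/
lemma nabla_cl (hD : IsLeviCivita D) (hU : IsOpen U) {η : FormField n M} (hη : SmoothFormOn η U)
    (hx : x ∈ U) (i j : Fin n) :
    nabla D e (fun y => cl (e j y) (η y)) x (e i x)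
      = cl (e j x) (nabla D e η x (e i x))
        + ∑ k, (chris D e i j k x : ℂ) • cl (e k x) (η x) := by
  have hC := car_frame he hx
  -- The commutators of the connection matrix with ε_j and with ι_j have coefficients Γ_{ikj} with
  -- opposite signs and transposed indices. Antisymmetry of Γ makes them agree, so they combine to
  -- c(e_k).
  have hA : bilinAt e x (fun k l => -chris D e i k l x) * cl (e j x)
      = cl (e j x) * bilinAt e x (fun k l => -chris D e i k l x)
        + ∑ k, (chris D e i j k x : ℂ) • cl (e k x) := by
    have h1 := bilin_cre (fun k l => -chris D e i k l x) hC j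
    have h2 := bilin_ann (fun k l => -chris D e i k l x) hC j
    have h3 : ∀ {W : Type _} [AddCommGroup W] [Module ℂ W] (B P Q : Module.End ℂ W)
        (p q : Fin n → Module.End ℂ W), B * P = P * B + ∑ k, ((-chris D e i k j x : ℝ) : ℂ) • p k →
        B * Q = Q * B - ∑ k, ((-chris D e i j k x : ℝ) : ℂ) • q k →
        B * (P - Q) = (P - Q) * B + ∑ k, (chris D e i j k x : ℂ) • (p k - q k) := by
      intro W _ _ B P Q p q hP hQ
      rw [mul_sub, hP, hQ, sub_mul]
      simp only [chris_antisymm he hD hU hx i _ j, smul_sub, Finset.sum_sub_distrib]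
      simp
      abel
    exact h3 (W := Forms (TangentSpace (𝓡 n) x)) _ _ _ _ _ h1 h2
  rw [nabla_eq he _ hx, nabla_eq he _ hx, coeffDeriv_cl he hU hη hx, map_add, add_assoc]
  congr 1
  have h4 : ∀ {W : Type _} [AddCommGroup W] [Module ℂ W] (B P : Module.End ℂ W)
      (p : Fin n → Module.End ℂ W) (z : W),
      B * P = P * B + ∑ k, (chris D e i j k x : ℂ) • p k →
      B (P z) = P (B z) + ∑ k, (chris D e i j k x : ℂ) • p k z := by
    intro W _ _ B P p z h
    have := congr($h z)
    simpa [LinearMap.sum_apply] using this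
  exact h4 (W := Forms (TangentSpace (𝓡 n) x)) _ _ _ _ hA

omit [IsContMDiffRiemannianBundle (𝓡 n) ∞ (EuclideanSpace ℝ (Fin n))
      (fun x : M => TangentSpace (𝓡 n) x)] he in
lemma nabla_sum_right (η : FormField n M) (a : Fin n → ℝ) :
    nabla D e η x (∑ k, a k • e k x) = ∑ k, (a k : ℂ) • nabla D e η x (e k x) := by
  have h : ∀ k, (a k : ℂ) • nabla D e η x (e k x) = (a k : ℂ) • coeffDeriv e η x (e k x)
      - ∑ i, extMul (e i x) ((a k : ℂ) • intMul (D (e i) x (e k x)) (η x)) := fun k => by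
    rw [nabla, Forms.smul_sub, Forms.smul_sum]
    simp only [map_smul]
  simp only [h]
  rw [nabla, coeffDeriv_sum_right, Finset.sum_sub_distrib, Finset.sum_comm]
  congr 1
  refine Finset.sum_congr rfl fun i _ => ?_
  rw [← map_sum, map_sum (D (e i) x)]
  simp only [map_smul]
  rw [intMul_sum]

end Operators


/-! ### The geometric operators as elements of one endomorphism ring -/

section Bochner

variable {n k : ℕ} {M : Type*} [TopologicalSpace M] [ChartedSpace (EuclideanSpace ℝ (Fin n)) M]
  [IsManifold (𝓡 n) ∞ M] [RiemannianBundle (fun x : M => TangentSpace (𝓡 n) x)]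

/-- The connection `∇_v - ½ (t c(v) A + s A c(v))`. -/
noncomputable def pertNabla (D : Connection n M) (F : ∀ x : M, Submodule ℝ (TangentSpace (𝓡 n) x))
    (e : Fin n → VField n M) (f : Fin k → VField n M) (s t : ℂ) (η : FormField n M) (x : M)
    (v : TangentSpace (𝓡 n) x) : Forms (TangentSpace (𝓡 n) x) :=
  nabla D e η x v
    - (1 / 2 : ℂ) • (t • (cl v * opA D F e f x) + s • (opA D F e f x * cl v)) (η x)

variable {U : Set M} {x : M} {D : Connection n M}
  {F : ∀ x : M, Submodule ℝ (TangentSpace (𝓡 n) x)} {e : Fin n → VField n M}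
  {f : Fin k → VField n M} {s t : ℂ}

lemma pertNabla_congr (hU : IsOpen U) {η ξ : FormField n M} (h : ∀ y ∈ U, η y = ξ y) (hx : x ∈ U)
    (v : TangentSpace (𝓡 n) x) : pertNabla D F e f s t η x v = pertNabla D F e f s t ξ x v := by
  rw [pertNabla, pertNabla, nabla_congr hU h hx, h x hx]

omit [IsManifold (𝓡 n) ∞ M] in
lemma cl_sum (a : Fin n → ℝ) (ζ : Forms (TangentSpace (𝓡 n) x)) :
    cl (∑ k, a k • e k x) ζ = ∑ k, (a k : ℂ) • cl (e k x) ζ := by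
  change extMul _ ζ - intMul _ ζ = _
  rw [extMul_sum, intMul_sum, ← Finset.sum_sub_distrib]
  exact Finset.sum_congr rfl fun k _ => (Forms.smul_sub _ _ _).symm

lemma pertNabla_sum_right (η : FormField n M) (a : Fin n → ℝ) :
    pertNabla D F e f s t η x (∑ k, a k • e k x)
      = ∑ k, (a k : ℂ) • pertNabla D F e f s t η x (e k x) := by
  have h : ∀ v, pertNabla D F e f s t η x v = nabla D e η x v
      - (1 / 2 : ℂ) • (t • cl v (opA D F e f x (η x)) + s • opA D F e f x (cl v (η x))) :=
    fun v => rfl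
  simp only [h]
  have h2 : ∀ {W : Type _} [AddCommGroup W] [Module ℂ W] (A : Module.End ℂ W) (p q r : Fin n → W),
      ∑ k, (a k : ℂ) • p k - (1 / 2 : ℂ) • (t • ∑ k, (a k : ℂ) • q k + s • A (∑ k, (a k : ℂ) • r k))
      = ∑ k, (a k : ℂ) • (p k - (1 / 2 : ℂ) • (t • q k + s • A (r k))) := by
    intro W _ _ A p q r
    rw [map_sum]
    simp only [Finset.smul_sum, ← Finset.sum_add_distrib, ← Finset.sum_sub_distrib]
    refine Finset.sum_congr rfl fun k _ => ?_
    rw [map_smul]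
    module
  rw [nabla_sum_right, cl_sum, cl_sum]
  exact h2 (W := Forms (TangentSpace (𝓡 n) x)) _ _ _ _

variable [IsContMDiffRiemannianBundle (𝓡 n) ∞ (EuclideanSpace ℝ (Fin n))
      (fun x : M => TangentSpace (𝓡 n) x)]
  (he : IsOrthonormalFrameOn e U)
include he

/-- The sub-signature operator as a perturbed Dirac operator. -/
lemma subSig_eq (hD : IsLeviCivita D) (hU : IsOpen U) {η : FormField n M} (hη : SmoothFormOn η U)
    (hx : x ∈ U) : subSig D F e f t η x
      = ∑ i, cl (e i x) (nabla D e η x (e i x)) + t • opA D F e f x (η x) := by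
  rw [subSig, dForm_eq he hD hU hx hη, codiff_eq he hU hη hx hD, ← sub_eq_add_neg,
    ← Finset.sum_sub_distrib]
  rfl

omit he in
variable (D F e f U) in
/-- The Clifford action, the perturbation, the covariant derivatives and the Christoffel symbols as
operators on sections. -/
structure LocalOperators where
  c : Fin n → Module.End ℂ (Sections n U)
  a : Module.End ℂ (Sections n U)
  N : Fin n → Module.End ℂ (Sections n U)
  g : Fin n → Fin n → Fin n → Module.End ℂ (Sections n U)
  eval_c : ∀ y ∈ U, ∀ i σ, evalAt U y (c i σ) = cl (e i y) (evalAt U y σ)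
  eval_a : ∀ y ∈ U, ∀ σ, evalAt U y (a σ) = opA D F e f y (evalAt U y σ)
  eval_N : ∀ y ∈ U, ∀ i (σ : Sections n U), evalAt U y (N i σ) = nabla D e σ.form y (e i y)
  eval_g : ∀ y ∈ U, ∀ i j l σ, evalAt U y (g i j l σ) = (chris D e i j l y : ℂ) • evalAt U y σ

lemma nonempty_localOperators (hf : IsOrthonormalFrameOn f U)
    (hfF : ∀ x ∈ U, Submodule.span ℝ (Set.range (fun α => f α x)) = (F x)ᗮ)
    (hD : IsLeviCivita D) (hU : IsOpen U) : Nonempty (LocalOperators U D F e f) := by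
  have oc : ∀ i, IsOperatorOn (fun (η : FormField n M) y => cl (e i y) (η y)) U := fun i =>
    isOperatorOn_of_end (B := fun y => cl (e i y)) fun hη => hη.cl (he.smooth i)
  have oa : IsOperatorOn (fun (η : FormField n M) y => opA D F e f y (η y)) U :=
    isOperatorOn_of_end (B := opA D F e f) fun hη => hη.opA he hf hfF hD hU
  have oN := isOperatorOn_nabla he hD hU
  have og : ∀ i j l, IsOperatorOn (fun (η : FormField n M) y => (chris D e i j l y : ℂ) • η y) U :=
    fun i j l =>
    { smooth := fun hη => hη.fsmul
        (Complex.ofRealCLM.contMDiff.comp_contMDiffOn (chris_smooth he hD hU i j l))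
      add := fun _ _ _ _ => Forms.smul_add _ _ _
      smul := fun c η _ x _ => by
        rw [Forms.smul_smul, Forms.smul_smul, mul_comm] }
  exact ⟨{
    c := fun i => (oc i).lift
    a := oa.lift
    N := fun i => (oN i).lift
    g := fun i j l => (og i j l).lift
    eval_c := fun y hy i σ => (oc i).lift_apply hy σ
    eval_a := fun y hy σ => oa.lift_apply hy σ
    eval_N := fun y hy i σ => (oN i).lift_apply hy σ
    eval_g := fun y hy i j l σ => (og i j l).lift_apply hy σ }⟩

namespace LocalOperators

variable (O : LocalOperators U D F e f) (hD : IsLeviCivita D) (hU : IsOpen U)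

omit [IsContMDiffRiemannianBundle (𝓡 n) ∞ (EuclideanSpace ℝ (Fin n))
      (fun x : M => TangentSpace (𝓡 n) x)] in
include he in
lemma clifford (i j : Fin n) : O.c i * O.c j + O.c j * O.c i = if i = j then -2 else 0 :=
  LinearMap.ext fun σ => sections_ext fun y hy => by
    rw [LinearMap.add_apply, map_add, Module.End.mul_apply, Module.End.mul_apply]
    simp only [O.eval_c y hy]
    have h := congr($((car_frame he hy).cl_anticomm i j) (evalAt U y σ))
    refine Eq.trans h ?_
    split_ifs
    · refine (neg_two_apply (W := Forms (TangentSpace (𝓡 n) y)) _).trans ?_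
      rw [neg_two_apply (W := Sections n U), map_neg, map_add]
    · rfl

include he hD hU in
lemma g_antisymm (i j l : Fin n) : O.g i j l = -O.g i l j :=
  LinearMap.ext fun σ => sections_ext fun y hy => by
    rw [LinearMap.neg_apply, map_neg, O.eval_g y hy, O.eval_g y hy, chris_antisymm he hD hU hy,
      Complex.ofReal_neg]
    exact Forms.neg_smul _ _

omit [IsContMDiffRiemannianBundle (𝓡 n) ∞ (EuclideanSpace ℝ (Fin n))
      (fun x : M => TangentSpace (𝓡 n) x)] he in
lemma g_mul_c (i j l m : Fin n) : O.g i j l * O.c m = O.c m * O.g i j l :=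
  LinearMap.ext fun σ => sections_ext fun y hy => by
    simp only [Module.End.mul_apply, O.eval_c y hy, O.eval_g y hy, map_smul]

omit [IsContMDiffRiemannianBundle (𝓡 n) ∞ (EuclideanSpace ℝ (Fin n))
      (fun x : M => TangentSpace (𝓡 n) x)] he in
lemma g_mul_a (i j l : Fin n) : O.g i j l * O.a = O.a * O.g i j l :=
  LinearMap.ext fun σ => sections_ext fun y hy => by
    simp only [Module.End.mul_apply, O.eval_a y hy, O.eval_g y hy, map_smul]

include he hD hU in
lemma N_mul_c (i j : Fin n) : O.N i * O.c j = O.c j * O.N i + ∑ l, O.g i j l * O.c l :=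
  LinearMap.ext fun σ => sections_ext fun y hy => by
    rw [LinearMap.add_apply, map_add, LinearMap.sum_apply, map_sum]
    simp only [Module.End.mul_apply, O.eval_c y hy, O.eval_N y hy, O.eval_g y hy]
    rw [nabla_congr hU (η := (O.c j σ).form) (fun z hz => O.eval_c z hz j σ) hy]
    exact nabla_cl he hD hU σ.smooth hy i j

/-- The curvature of the connection on forms. -/
noncomputable def Q (i j : Fin n) : Module.End ℂ (Sections n U) :=
  O.N i * O.N j - O.N j * O.N i - ∑ l, (O.g i j l - O.g j i l) * O.N l

/-- The term subtracted from the connection. -/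
noncomputable def w (s t : ℂ) (j : Fin n) : Module.End ℂ (Sections n U) :=
  t • (O.c j * O.a) + s • (O.a * O.c j)

include he hD hU in
lemma eval_dirac (y : M) (hy : y ∈ U) (r : ℂ) (σ : Sections n U) :
    evalAt U y ((∑ i, O.c i * O.N i + r • O.a) σ) = subSig D F e f r σ.form y := by
  rw [subSig_eq he hD hU σ.smooth hy, LinearMap.add_apply, map_add, LinearMap.sum_apply, map_sum,
    LinearMap.smul_apply, map_smul, O.eval_a y hy]
  simp only [Module.End.mul_apply, O.eval_c y hy, O.eval_N y hy]
  rfl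

omit [IsContMDiffRiemannianBundle (𝓡 n) ∞ (EuclideanSpace ℝ (Fin n))
      (fun x : M => TangentSpace (𝓡 n) x)] he in
lemma eval_w (y : M) (hy : y ∈ U) (j : Fin n) (σ : Sections n U) : evalAt U y (O.w s t j σ)
      = (t • (cl (e j y) * opA D F e f y) + s • (opA D F e f y * cl (e j y)))
          (evalAt U y σ) := by
  simp only [w, LinearMap.add_apply, LinearMap.smul_apply, Module.End.mul_apply, map_add,
    map_smul, O.eval_c y hy, O.eval_a y hy]

omit [IsContMDiffRiemannianBundle (𝓡 n) ∞ (EuclideanSpace ℝ (Fin n))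
      (fun x : M => TangentSpace (𝓡 n) x)] he in
lemma eval_pertNabla (y : M) (hy : y ∈ U) (j : Fin n) (σ : Sections n U) :
    evalAt U y ((O.N j - (1 / 2 : ℂ) • O.w s t j) σ)
      = pertNabla D F e f s t σ.form y (e j y) := by
  rw [LinearMap.sub_apply, map_sub, LinearMap.smul_apply, map_smul, O.eval_N y hy, O.eval_w y hy]
  rfl

include hU in
omit [IsContMDiffRiemannianBundle (𝓡 n) ∞ (EuclideanSpace ℝ (Fin n))
      (fun x : M => TangentSpace (𝓡 n) x)] he in
lemma eval_nablaEnd (y : M) (hy : y ∈ U) (j : Fin n) (σ : Sections n U) :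
    evalAt U y ((O.N j * O.a - O.a * O.N j) σ)
      = nablaEnd D e (opA D F e f) σ.form y (e j y) := by
  rw [LinearMap.sub_apply, map_sub, Module.End.mul_apply, Module.End.mul_apply, O.eval_N y hy,
    O.eval_a y hy, O.eval_N y hy,
    nabla_congr hU (η := (O.a σ).form) (fun z hz => O.eval_a z hz σ) hy]
  rfl

include he hD hU in
lemma eval_Q (y : M) (hy : y ∈ U) (i j : Fin n) (σ : Sections n U) : evalAt U y (O.Q i j σ)
      = bilinAt e y (fun k l => Rm D e y i j l k) (evalAt U y σ) := by
  have h1 := nabla_comm he hU σ.smooth hy hD i j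
  rw [Q, LinearMap.sub_apply, map_sub, LinearMap.sub_apply, map_sub, LinearMap.sum_apply, map_sum]
  simp only [Module.End.mul_apply, LinearMap.sub_apply, map_sub, O.eval_g y hy, O.eval_N y hy]
  rw [nabla_congr hU (η := (O.N j σ).form) (fun z hz => O.eval_N z hz j σ) hy,
    nabla_congr hU (η := (O.N i σ).form) (fun z hz => O.eval_N z hz i σ) hy, h1]
  simp only [Complex.ofReal_sub, Forms.sub_smul]
  exact add_sub_cancel_left _ _

include he hD hU in
-- The element h_k of `perturbed_dirac_mul` is ∑_i Γ_{iik}, the k-th component of ∑_i ∇_{e_i} e_i.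
-- It appears when each N_j is moved past its own c_j.
lemma dirac_mul (s t : ℂ) :
    (∑ i, O.c i * O.N i + s • O.a) * (∑ i, O.c i * O.N i + t • O.a)
      = -∑ j, (O.N j - (1 / 2 : ℂ) • O.w s t j) * (O.N j - (1 / 2 : ℂ) • O.w s t j)
        + ∑ k, (∑ i, O.g i i k) * (O.N k - (1 / 2 : ℂ) • O.w s t k)
        + (1 / 2 : ℂ) • ∑ i, ∑ j, O.c i * O.c j * O.Q i j
        + (1 / 4 : ℂ) • ∑ j, O.w s t j * O.w s t j
        + (1 / 2 : ℂ) • ∑ j, (t • (O.c j * (O.N j * O.a - O.a * O.N j))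
            - s • ((O.N j * O.a - O.a * O.N j) * O.c j))
        + (s * t) • (O.a * O.a) := by
  refine perturbed_dirac_mul s t ?_ (fun l => ?_) ?_ fun _ => rfl
  · simp only [O.N_mul_c he hD hU, Finset.sum_add_distrib, Finset.sum_mul]
    rw [Finset.sum_comm (f := fun i j => O.g i i j * O.c j)]
  · simp only [Finset.sum_mul, Finset.mul_sum, O.g_mul_a]
  · rw [dirac_sq (Q := O.Q) (O.clifford he) (O.N_mul_c he hD hU) (O.g_antisymm he hD hU) O.g_mul_c
      fun i j => by rw [Q]; abel]
    simp only [Finset.sum_mul]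
    rw [Finset.sum_comm (f := fun i j => O.g i i j * O.N j)]

end LocalOperators

end Bochner


lemma half_sum_apply {W : Type*} [AddCommGroup W] [Module ℂ W] {n : ℕ} (C : Fin n → Module.End ℂ W)
    (B : Fin n → Fin n → Module.End ℂ W) (z : W) :
    ((1 / 2 : ℂ) • ∑ i, ∑ j, C i * C j * B i j) z
      = (1 / 2 : ℂ) • ∑ i, ∑ j, C i (C j (B i j z)) := by
  simp [LinearMap.sum_apply]

/-! ### Evaluation of the operator identity at a point -/

section Bochner

variable {n k : ℕ} {M : Type*} [TopologicalSpace M] [ChartedSpace (EuclideanSpace ℝ (Fin n)) M]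
  [IsManifold (𝓡 n) ∞ M] [RiemannianBundle (fun x : M => TangentSpace (𝓡 n) x)]
  [IsContMDiffRiemannianBundle (𝓡 n) ∞ (EuclideanSpace ℝ (Fin n))
      (fun x : M => TangentSpace (𝓡 n) x)]
  {U : Set M} {x : M} {D : Connection n M}
  {F : ∀ x : M, Submodule ℝ (TangentSpace (𝓡 n) x)} {e : Fin n → VField n M}
  {f : Fin k → VField n M} {s t : ℂ}
  (he : IsOrthonormalFrameOn e U) (hD : IsLeviCivita D) (hU : IsOpen U)
  (O : LocalOperators U D F e f) (σ : Sections n U) (hx : x ∈ U)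

namespace LocalOperators

include hU hx in
omit [IsContMDiffRiemannianBundle (𝓡 n) ∞ (EuclideanSpace ℝ (Fin n))
      (fun x : M => TangentSpace (𝓡 n) x)] in
-- The perturbed connection is linear in its direction, so the sum weighted by ∑_i Γ_{iik} is its
-- derivative along ∑_i ∇_{e_i} e_i.
lemma eval_laplacian (he : IsOrthonormalFrameOn e U) :
    evalAt U x ((-∑ j, (O.N j - (1 / 2 : ℂ) • O.w s t j) * (O.N j - (1 / 2 : ℂ) • O.w s t j)
        + ∑ k, (∑ i, O.g i i k) * (O.N k - (1 / 2 : ℂ) • O.w s t k)) σ)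
      = laplacian D e (pertNabla D F e f s t) σ.form x := by
  rw [laplacian, LinearMap.add_apply, map_add, LinearMap.neg_apply, map_neg]
  simp only [LinearMap.sum_apply, map_sum, Finset.sum_mul]
  congr 1
  · congr 1
    refine Finset.sum_congr rfl fun j _ => ?_
    rw [Module.End.mul_apply, O.eval_pertNabla x hx]
    exact pertNabla_congr hU (fun y hy => O.eval_pertNabla y hy j σ) hx _
  · rw [Finset.sum_comm]
    refine Finset.sum_congr rfl fun i _ => ?_
    rw [conn_frame he hx, pertNabla_sum_right]
    refine Finset.sum_congr rfl fun l _ => ?_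
    rw [Module.End.mul_apply, O.eval_g x hx, O.eval_pertNabla x hx]

include he hD hU hx in
lemma eval_curvature :
    evalAt U x (((1 / 2 : ℂ) • ∑ i, ∑ j, O.c i * O.c j * O.Q i j) σ)
      = -((1 / 8 : ℂ) • curvEnd D e x (evalAt U x σ))
        + (1 / 4 : ℂ) • (scal D e x : ℂ) • evalAt U x σ := by
  have h := weitzenboeck_curvature (R := fun i j k l => (Rm D e x i j k l : ℂ)) (car_frame he hx)
    (fun i j k l => by rw [Rm_swap_left he hD hU hx, Complex.ofReal_neg])
    (fun i j k l => by rw [Rm_swap_right he hD hU hx, Complex.ofReal_neg])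
    (fun i j k l => by exact_mod_cast Rm_bianchi he hD hU hx i j k l)
    (fun i j k l => by rw [Rm_pair_symm he hD hU hx])
  have h1 := congr($h (evalAt U x σ))
  have h3 : ∀ {W : Type _} [AddCommGroup W] [Module ℂ W] (B : Module.End ℂ W) (r : ℝ) (z : W),
      (-((1 / 8 : ℂ) • B) + ((1 / 4 : ℂ) * r) • (1 : Module.End ℂ W)) z
        = -((1 / 8 : ℂ) • B z) + (1 / 4 : ℂ) • (r : ℂ) • z := by
    intro W _ _ B r z
    simp [mul_smul]
  have hs : ∑ i, ∑ j, (Rm D e x i j j i : ℂ) = (scal D e x : ℂ) := by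
    rw [scal]
    push_cast
    rfl
  rw [hs] at h1
  refine Eq.trans ?_ (h1.trans (h3 (W := Forms (TangentSpace (𝓡 n) x)) _ _ _))
  rw [half_sum_apply]
  refine Eq.trans ?_ (half_sum_apply (W := Forms (TangentSpace (𝓡 n) x)) _ _ _).symm
  rw [map_smul, map_sum]
  congr 1
  refine Finset.sum_congr rfl fun i _ => ?_
  rw [map_sum]
  refine Finset.sum_congr rfl fun j _ => ?_
  rw [O.eval_c x hx, O.eval_c x hx, O.eval_Q he hD hU x hx]
  -- Renaming the two summation indices brings the curvature operator to the form ∑ R_{ijkl} ε_l ι_k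
  -- of the Weitzenböck identity.
  have h4 : bilinAt e x (fun k l => Rm D e x i j l k)
      = ∑ k, ∑ l, (Rm D e x i j k l : ℂ) • (extMul (e l x) * intMul (e k x)) := Finset.sum_comm
  rw [h4]
  rfl

end LocalOperators

set_option maxHeartbeats 1000000 in
include he in
/-- The Bochner formula for products of sub-signature operators. -/
theorem subSig_subSig (hf : IsOrthonormalFrameOn f U)
    (hfF : ∀ x ∈ U, Submodule.span ℝ (Set.range (fun α => f α x)) = (F x)ᗮ)
    (hD : IsLeviCivita D) (hU : IsOpen U) {η : FormField n M}
    (hη : SmoothFormOn η U) (hx : x ∈ U) :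
    subSig D F e f s (subSig D F e f t η) x =
      laplacian D e (pertNabla D F e f s t) η x
        - (1 / 8 : ℂ) • curvEnd D e x (η x)
        + (1 / 4 : ℂ) • (scal D e x : ℂ) • η x
        + (1 / 4 : ℂ) • ∑ j, ((t • (cl (e j x) * opA D F e f x)
            + s • (opA D F e f x * cl (e j x))) ^ 2) (η x)
        + (1 / 2 : ℂ) • ∑ j, (t • cl (e j x) (nablaEnd D e (opA D F e f) η x (e j x))
            - s • nablaEnd D e (opA D F e f) (fun y => cl (e j y) (η y)) x (e j x))
        + (s * t) • (opA D F e f x ^ 2) (η x) := by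
  obtain ⟨O⟩ := nonempty_localOperators he hf hfF hD hU
  -- Off U nothing is known about η. It is replaced by a section with the same values on U; every
  -- operator involved is local, so nothing changes at x.
  obtain ⟨σ, e0⟩ : ∃ σ : Sections n U, ∀ y ∈ U, σ.form y = η y :=
    ⟨toSection U η hη, fun y hy => evalAt_toSection hη hy⟩
  have ex : evalAt U x σ = η x := e0 x hx
  have hdirac : ∀ {ξ : FormField n M} {r : ℂ} (τ : Sections n U), (∀ y ∈ U, τ.form y = ξ y) →
      ∀ y ∈ U, evalAt U y ((∑ i, O.c i * O.N i + r • O.a) τ) = subSig D F e f r ξ y := by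
    intro ξ r τ hτ y hy
    rw [O.eval_dirac he hD hU y hy, subSig_eq he hD hU τ.smooth hy,
      subSig_eq he hD hU (τ.smooth.congr fun z hz => (hτ z hz).symm) hy, hτ y hy]
    simp only [nabla_congr hU hτ hy]
  have hend : ∀ {ξ : FormField n M} (τ : Sections n U) (j : Fin n), (∀ y ∈ U, τ.form y = ξ y) →
      evalAt U x ((O.N j * O.a - O.a * O.N j) τ)
        = nablaEnd D e (opA D F e f) ξ x (e j x) := by
    intro ξ τ j hτ
    rw [O.eval_nablaEnd hU x hx, nablaEnd, nablaEnd, nabla_congr hU hτ hx,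
      nabla_congr hU (η := fun y => opA D F e f y (τ.form y)) (fun z hz => by rw [hτ z hz]) hx]
  have hlap : laplacian D e (pertNabla D F e f s t) σ.form x
      = laplacian D e (pertNabla D F e f s t) η x := by
    simp only [laplacian, pertNabla_congr hU e0 hx]
    congr 2
    refine Finset.sum_congr rfl fun i _ => ?_
    exact pertNabla_congr hU (fun y hy => pertNabla_congr hU e0 hy _) hx _
  rw [← hdirac ((∑ i, O.c i * O.N i + t • O.a) σ) (fun y hy => hdirac σ e0 y hy) x hx, ← Module.End.mul_apply,
    O.dirac_mul he hD hU]
  have hsum : ∀ A B C E G : Module.End ℂ (Sections n U), evalAt U x ((A + B + C + E + G) σ)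
      = evalAt U x (A σ) + evalAt U x (B σ) + evalAt U x (C σ) + evalAt U x (E σ)
        + evalAt U x (G σ) := fun A B C E G => by
    simp only [LinearMap.add_apply, map_add]
  rw [hsum, O.eval_laplacian hU σ hx he, O.eval_curvature he hD hU σ hx, ex, hlap]
  have h4 : evalAt U x (((1 / 4 : ℂ) • ∑ j, O.w s t j * O.w s t j) σ)
      = (1 / 4 : ℂ) • ∑ j, ((t • (cl (e j x) * opA D F e f x)
            + s • (opA D F e f x * cl (e j x))) ^ 2) (η x) := by
    rw [LinearMap.smul_apply, map_smul, LinearMap.sum_apply, map_sum]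
    congr 1
    refine Finset.sum_congr rfl fun j _ => ?_
    rw [Module.End.mul_apply, O.eval_w x hx, O.eval_w x hx, ex, pow_two]
    rfl
  have h5 : evalAt U x (((1 / 2 : ℂ) • ∑ j, (t • (O.c j * (O.N j * O.a - O.a * O.N j))
            - s • ((O.N j * O.a - O.a * O.N j) * O.c j))) σ)
      = (1 / 2 : ℂ) • ∑ j, (t • cl (e j x) (nablaEnd D e (opA D F e f) η x (e j x))
            - s • nablaEnd D e (opA D F e f) (fun y => cl (e j y) (η y)) x (e j x)) := by
    rw [LinearMap.smul_apply, map_smul, LinearMap.sum_apply, map_sum]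
    -- The operator (∇A)c(e_j) is evaluated as ∇A acting on the form field c(e_j)η, which the
    -- section c_j σ represents on U.
    congr 1
    refine Finset.sum_congr rfl fun j _ => ?_
    rw [LinearMap.sub_apply, map_sub, LinearMap.smul_apply, map_smul, LinearMap.smul_apply,
      map_smul, Module.End.mul_apply, Module.End.mul_apply, O.eval_c x hx, hend σ j e0,
      hend (O.c j σ) (ξ := fun y => cl (e j y) (η y)) j fun y hy => ?_]
    rw [← e0 y hy]
    exact O.eval_c y hy j σ
  have h6 : evalAt U x (((s * t) • (O.a * O.a)) σ)
      = (s * t) • (opA D F e f x ^ 2) (η x) := by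
    rw [LinearMap.smul_apply, map_smul, Module.End.mul_apply, O.eval_a x hx, O.eval_a x hx, ex,
      pow_two]
    rfl
  rw [h4, h5, h6]
  abel

end Bochner

end SubSignature

/-! ### The two formulas, for s = t̄ and s = t -/

open SubSignature in
theorem theorem2p1 {n r k : ℕ} {M : Type*} [TopologicalSpace M]
    [ChartedSpace (EuclideanSpace ℝ (Fin n)) M] [IsManifold (𝓡 n) ∞ M]
    [RiemannianBundle (fun x : M => TangentSpace (𝓡 n) x)]
    [IsContMDiffRiemannianBundle (𝓡 n) ∞ (EuclideanSpace ℝ (Fin n))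
      (fun x : M => TangentSpace (𝓡 n) x)]
    (D : Connection n M) (hD : IsLeviCivita D)
    (F : ∀ x : M, Submodule ℝ (TangentSpace (𝓡 n) x)) (hF : IsSmoothSubbundle F r)
    (hrk : r + k = n)
    (U : Set M) (hU : IsOpen U)
    (e : Fin n → VField n M) (he : IsOrthonormalFrameOn e U)
    (f : Fin k → VField n M) (hf : IsOrthonormalFrameOn f U)
    (hfF : ∀ x ∈ U, Submodule.span ℝ (Set.range (fun α => f α x)) = (F x)ᗮ)
    (t : ℂ) (η : FormField n M) (hη : SmoothFormOn η U) (x : M) (hx : x ∈ U) :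
    (subSigStar D F e f t (subSig D F e f t η) x =
      laplacian D e (nabla1 D F e f t) η x
        - (1 / 8 : ℂ) • curvEnd D e x (η x)
        + (1 / 4 : ℂ) • (scal D e x : ℂ) • η x
        + (1 / 4 : ℂ) • ∑ j, ((t • (cl (e j x) * opA D F e f x)
            + conj t • (opA D F e f x * cl (e j x))) ^ 2) (η x)
        + (1 / 2 : ℂ) • ∑ j, (t • cl (e j x) (nablaEnd D e (opA D F e f) η x (e j x))
            - conj t • nablaEnd D e (opA D F e f) (fun y => cl (e j y) (η y)) x (e j x))
        + (conj t * t) • (opA D F e f x ^ 2) (η x)) ∧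
    (subSig D F e f t (subSig D F e f t η) x =
      laplacian D e (nabla2 D F e f t) η x
        - (1 / 8 : ℂ) • curvEnd D e x (η x)
        + (1 / 4 : ℂ) • (scal D e x : ℂ) • η x
        + (1 / 4 : ℂ) • ∑ j, t ^ 2 • ((cl (e j x) * opA D F e f x
            + opA D F e f x * cl (e j x)) ^ 2) (η x)
        + (t / 2) • ∑ j, (cl (e j x) (nablaEnd D e (opA D F e f) η x (e j x))
            - nablaEnd D e (opA D F e f) (fun y => cl (e j y) (η y)) x (e j x))
        + t ^ 2 • (opA D F e f x ^ 2) (η x)) := by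
  have hs : subSigStar D F e f t = subSig D F e f (conj t) := rfl
  have hn1 : nabla1 D F e f t = pertNabla D F e f (conj t) t := rfl
  rw [hs, hn1]
  refine ⟨subSig_subSig he hf hfF hD hU hη hx, ?_⟩
  clear hs hn1
  have h := subSig_subSig (s := t) (t := t) he hf hfF hD hU hη hx
  -- For s = t the common factor t leaves the brackets: it turns ½ into t/2 in the connection and in
  -- the derivative term, and comes out squared from the quadratic term.
  have hn : pertNabla D F e f t t = nabla2 D F e f t := by
    funext ξ y v
    have : ∀ {W : Type _} [AddCommGroup W] [Module ℂ W] (p : W) (A B : Module.End ℂ W) (z : W),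
        p - (1 / 2 : ℂ) • (t • A + t • B) z = p - (t / 2) • (A + B) z := by
      intro W _ _ p A B z
      simp only [LinearMap.add_apply, LinearMap.smul_apply]
      module
    exact this (W := Forms (TangentSpace (𝓡 n) y)) _ _ _ _
  rw [hn] at h
  have h4 : ∀ {W : Type _} [AddCommGroup W] [Module ℂ W] (A B : Module.End ℂ W) (z : W),
      ((t • A + t • B) ^ 2) z = t ^ 2 • ((A + B) ^ 2) z := by
    intro W _ _ A B z
    rw [← smul_add, smul_pow]
    rfl
  have h5 : ∀ {W : Type _} [AddCommGroup W] [Module ℂ W] (p q : Fin n → W),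
      (1 / 2 : ℂ) • ∑ j, (t • p j - t • q j) = (t / 2) • ∑ j, (p j - q j) := by
    intro W _ _ p q
    rw [Finset.smul_sum, Finset.smul_sum]
    refine Finset.sum_congr rfl fun j _ => ?_
    module
  have h4' := Finset.sum_congr rfl fun j (_ : j ∈ Finset.univ) =>
    h4 (W := Forms (TangentSpace (𝓡 n) x)) (cl (e j x) * opA D F e f x)
      (opA D F e f x * cl (e j x)) (η x)
  have h5' := h5 (W := Forms (TangentSpace (𝓡 n) x))
    (fun j => cl (e j x) (nablaEnd D e (opA D F e f) η x (e j x)))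
    (fun j => nablaEnd D e (opA D F e f) (fun y => cl (e j y) (η y)) x (e j x))
  rw [h, pow_two t]
  rw [pow_two t] at h4'
  exact congrArg₂ (fun a b => laplacian D e (nabla2 D F e f t) η x
        - (1 / 8 : ℂ) • curvEnd D e x (η x)
        + (1 / 4 : ℂ) • (scal D e x : ℂ) • η x + (1 / 4 : ℂ) • a + b
        + (t * t) • (opA D F e f x ^ 2) (η x)) h4' h5'
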